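/- **Setting.** Let $Q$ and $Q'$ be finite sets of qubits (original and dual lattice), placed in a common (pseudo)metric space. A generalized Ising (GI) model on $Q$ is given by finitely many products $\mathcal O^Z_\alpha$ of Pauli-$Z$ operators and $\mathcal O^X_i$ of Pauli-$X$ operators, with Hamiltonian $-\sum_\alpha J_\alpha\mathcal O^Z_\alpha-\sum_i h_i\mathcal O^X_i$. A dual of it consists of $Z$-products $\Delta^Z_\alpha$ and $X$-products $\Delta^X_i$ on $Q'$ such that $\Delta^Z_\alpha,\Delta^X_i$ commute if and only if $\mathcal O^Z_\alpha,\mathcal O^X_i$ commute; a product of $\mathcal O$'s and the product of the $\Delta$'s with the same indices are called dual to each other. The $Z$-type symmetries of the model are all $Z$-products commuting with all $\mathcal O^X_i$; its $X$-type symmetries are the $X$-products commuting with all $\mathcal O^Z_\alpha$ and with all $Z$-type symmetries. For the dual, the $X$-type symmetries are all $X$-products commuting with all $\Delta^Z_\alpha$, and the $Z$-type symmetries are the $Z$-products commuting with all $\Delta^X_i$ and all $X$-type symmetries. Let $G^Z_r,G^X_s$ (for the model) and $\Gamma^X_\rho,\Gamma^Z_\sigma$ (for the dual) be finite families of such symmetries,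 and let $U^Z_1,\dots,U^Z_{n_Z}$; $U^X_1,\dots,U^X_{n_X}$; $\Omega^X_1,\dots,\Omega^X_{m_X}$; $\Omega^Z_1,\dots,\Omega^Z_{m_Z}$ be maximal families of symmetries of the respective type that are independent modulo the groups generated by $G^Z$, $G^X$, $\Gamma^X$, $\Gamma^Z$. **Locality assumptions.** There are constants $\ell,c\ge 0$ and a scale $R\ge 3\ell+c$ such that: each $G^Z_r,G^X_s,\Gamma^X_\rho,\Gamma^Z_\sigma$ has support of diameter $\le\ell$, and so has each union $\operatorname{supp}\mathcal O^Z_\alpha\cup\operatorname{supp}\Delta^Z_\alpha$ and $\operatorname{supp}\mathcal O^X_i\cup\operatorname{supp}\Delta^X_i$. Call a Pauli product local if its support has diameter $\le R$, and locally generated by a family if, up to a phase, it is a product of members supported in a region that contains its support and whose diameter exceeds that of the support by at most $c$. Every local Pauli product commuting with all $\mathcal O^X_i,G^Z_r$ is locally generated by $\{\mathcal O^X_i\}\cup\{G^Z_r\}$; every local Pauli product on $Q'$ commuting with all $\Delta^Z_\alpha,\Gamma^X_\rho$ is locally generated by $\{\Delta^Z_\alpha\}\cup\{\Gamma^X_\rho\}$;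 every local $X$-type symmetry of the model is locally generated by $\{G^X_s\}$; every local $Z$-type symmetry of the dual is locally generated by $\{\Gamma^Z_\sigma\}$. **Layered system.** Let $L\ge 3$ be odd, put a copy of $Q$ on each odd layer and a copy of $Q'$ on each even layer of $1,\dots,L$, and let $H_{\rm bulk}$ be minus the sum of all operators $\Delta^Z_{\alpha,2j}\mathcal O^Z_{\alpha,2j+1}\Delta^Z_{\alpha,2j+2}$ and $\mathcal O^X_{i,2j-1}\Delta^X_{i,2j}\mathcal O^X_{i,2j+1}$ that lie inside the system, all $G^Z_r,G^X_s$ on all odd layers, and all $\Gamma^X_\rho,\Gamma^Z_\sigma$ on all even layers (the second index is the layer). Let $\mathcal L_{\rm bdry}$ be the ground subspace of $H_{\rm bulk}$. The boundary terms acting on it are $\mathcal O^X_{i,1}$, $\mathcal O^X_{i,L}$, $\mathcal O^Z_{\alpha,1}\Delta^Z_{\alpha,2}$, $\Delta^Z_{\alpha,L-1}\mathcal O^Z_{\alpha,L}$. Let $\mathcal L$ be the Hilbert space of $Q$, and $\mathcal L_G\subset\mathcal L$ the subspace where all $G^Z_r=G^X_s=1$. For a subspace $\mathcal F\subset\mathcal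 L_G\otimes\mathcal L_G$, say that a subspace $W\subset\mathcal L_{\rm bdry}$ is *isomorphic to $\mathcal F$ with signs* $\varepsilon_i,\varepsilon'_i,\eta_\alpha,\eta'_\alpha\in\{\pm1\}$ if the boundary terms preserve $W$ and some unitary $W\cong\mathcal F$ carries them, in the above order, to $\varepsilon_i\,\mathcal O^X_i\otimes 1$, $\varepsilon'_i\,1\otimes\mathcal O^X_i$, $\eta_\alpha\,\mathcal O^Z_\alpha\otimes1$, $\eta'_\alpha\,1\otimes\mathcal O^Z_\alpha$. The boundary theory is *nonanomalous* if $\mathcal L_{\rm bdry}$ is an orthogonal direct sum of subspaces each isomorphic to all of $\mathcal L_G\otimes\mathcal L_G$ with all signs $+1$, and *anomalous* otherwise. **Claim.** The boundary theory is anomalous if and only if at least one of the following holds. 1. For some nonempty $\mathcal N\subset\{1,\dots,n_X\}$, $U^X_{\mathcal N}=\prod_{k\in\mathcal N}U^X_k$ can be written as a product $\prod_{i\in J}\mathcal O^X_i$ whose dual $\prod_{i\in J}\Delta^X_i$ is a product of operators $\Gamma^X_\rho$. 2. For some nonempty $\mathcal M\subset\{1,\dots,m_Z\}$, $\Omega^Z_{\mathcal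 M}=\prod_{k\in\mathcal M}\Omega^Z_k$ can be written as a product $\prod_{\alpha\in S}\Delta^Z_\alpha$ whose dual $\prod_{\alpha\in S}\mathcal O^Z_\alpha$ is a product of operators $G^Z_r$. Moreover, fix an even layer $2l_0$, and for every choice of signs let the corresponding *sector* be the joint eigenspace in $\mathcal L_{\rm bdry}$ of all $\Omega^Z_{k,2l_0}$, of the $U^Z_k$ on all internal odd layers $3,\dots,L-2$, and of the $\Omega^X_k$ on all even layers, with these signs as eigenvalues. Let $\mathcal L_{\rm fic}\subset\mathcal L_G\otimes\mathcal L_G$ be the subspace where $U^X_k\otimes U^X_k=1$ for $k=1,\dots,n_X$. Then: * $\mathcal L_{\rm bdry}$ is the orthogonal direct sum of the sectors. The sector with all eigenvalues $+1$ is nonzero and isomorphic to $\mathcal L_{\rm fic}$ with all signs $+1$. Every other nonzero sector is isomorphic to $\mathcal L_{\rm fic}$ with some signs satisfying $\varepsilon'_i=1$ and $\eta'_\alpha=\eta_\alpha$. * (Locked symmetry charges.) If $\mathcal N$ is as in 1, then $U^X_{\mathcal N,1}=U^X_{\mathcal N,L}$ on all of $\mathcal L_{\rm bdry}$, and in each nonzero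 sector both common values $\pm1$ occur. * (Locked boundary conditions.) If $\mathcal M,S$ are as in 2, then for every isomorphism of a nonzero sector to $\mathcal L_{\rm fic}$ with signs, $\prod_{\alpha\in S}\eta_\alpha=\prod_{\alpha\in S}\eta'_\alpha$ equals the eigenvalue of $\Omega^Z_{\mathcal M,2l_0}$ in that sector, and both values $\pm1$ of it occur among the nonzero sectors. -/

import Mathlib

open scoped TensorProduct Matrix

noncomputable section

namespace GI

/-! ### Qubits and Pauli operators

A product of Pauli `Z` (or Pauli `X`) operators over a set of qubits is encoded by the indicator
vector of that set over `ZMod 2`; the product of two such operators is the sum of the vectors. -/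

/-- Exponent vectors of `Z`-type (or `X`-type) Pauli products on the qubits `Q`. -/
abbrev Bits (Q : Type*) : Type _ := Q → ZMod 2

/-- The Hilbert space of the qubits `Q`, written in the computational basis. -/
abbrev Hilb (Q : Type*) [Fintype Q] [DecidableEq Q] : Type _ := EuclideanSpace ℂ (Q → ZMod 2)

/-- The sign `±1` as a complex number. -/
def sgn (s : ℤˣ) : ℂ := ((s : ℤ) : ℂ)

section Pauli

variable {Q : Type*} [Fintype Q] [DecidableEq Q]

/-- `∏_{q : a q = 1} X_q`: it flips the qubits in the support of `a`. -/
def pauliX (a : Bits Q) : Hilb Q →ₗ[ℂ] Hilb Q where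
  toFun ψ := WithLp.toLp 2 fun x => ψ (x + a)
  map_add' _ _ := rfl
  map_smul' _ _ := rfl

/-- `∏_{q : b q = 1} Z_q`: it multiplies the basis state `x` by `(-1) ^ (b ⬝ x)`. -/
def pauliZ (b : Bits Q) : Hilb Q →ₗ[ℂ] Hilb Q where
  toFun ψ := WithLp.toLp 2 fun x => (-1 : ℂ) ^ (b ⬝ᵥ x).val * ψ x
  map_add' φ ψ := by ext x; simp [mul_add]
  map_smul' c ψ := by ext x; simp [mul_left_comm]

theorem pauliX_apply (a : Bits Q) (ψ : Hilb Q) (x : Bits Q) : pauliX a ψ x = ψ (x + a) := rfl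

theorem pauliZ_apply (b : Bits Q) (ψ : Hilb Q) (x : Bits Q) :
    pauliZ b ψ x = (-1 : ℂ) ^ (b ⬝ᵥ x).val * ψ x := rfl

theorem neg_one_pow_val_add (u v : ZMod 2) :
    (-1 : ℂ) ^ (u + v).val = (-1) ^ u.val * (-1) ^ v.val := by
  have h : (u + v).val % 2 = (u.val + v.val) % 2 := by
    revert u v; decide
  rw [← pow_add, neg_one_pow_eq_pow_mod_two, h, ← neg_one_pow_eq_pow_mod_two]

theorem pauliX_add (a b : Bits Q) : pauliX (a + b) = pauliX a ∘ₗ pauliX b := by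
  refine LinearMap.ext fun ψ => ?_
  ext x
  simp only [LinearMap.comp_apply, pauliX_apply, add_assoc]

theorem pauliZ_add (a b : Bits Q) : pauliZ (a + b) = pauliZ a ∘ₗ pauliZ b := by
  refine LinearMap.ext fun ψ => ?_
  ext x
  simp only [LinearMap.comp_apply, pauliZ_apply, add_dotProduct, neg_one_pow_val_add, mul_assoc]

/-- The two operators commute if `b ⬝ᵥ a = 0` and anticommute if `b ⬝ᵥ a = 1`. -/
theorem pauliX_comp_pauliZ (a b : Bits Q) :
    pauliX a ∘ₗ pauliZ b = (-1 : ℂ) ^ (b ⬝ᵥ a).val • (pauliZ b ∘ₗ pauliX a) := by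
  refine LinearMap.ext fun ψ => ?_
  ext x
  simp only [LinearMap.comp_apply, LinearMap.smul_apply, PiLp.smul_apply, smul_eq_mul,
    pauliX_apply, pauliZ_apply, dotProduct_add, neg_one_pow_val_add]
  ring

end Pauli

/-! ### Locality -/

section Locality

variable {M : Type*} [PseudoMetricSpace M] {Q : Type*} [Fintype Q]

/-- The support of a `Z`-type or `X`-type Pauli product. -/
def supp (a : Bits Q) : Set Q := {q | a q ≠ 0}

/-- A general Pauli product, up to a phase: the pair `(a, b)` stands for `X^a Z^b`. -/
abbrev PauliVec (Q : Type*) : Type _ := Bits Q × Bits Q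

/-- The support of a Pauli product. -/
def PauliVec.supp (P : PauliVec Q) : Set Q := GI.supp P.1 ∪ GI.supp P.2

/-- Two Pauli products commute. -/
def PauliVec.Commutes (P P' : PauliVec Q) : Prop := P.2 ⬝ᵥ P'.1 + P'.2 ⬝ᵥ P.1 = 0

/-- `P` is, up to a phase, a product of members of the family `F` that lie inside a region
containing the support of `P`, whose diameter exceeds that of the support by at most `c`. -/
def LocallyGenerated (pos : Q → M) (c : ℝ) {ι : Type*} (F : ι → PauliVec Q) (P : PauliVec Q) :
    Prop :=
  ∃ U : Set Q, P.supp ⊆ U ∧ Metric.diam (pos '' U) ≤ Metric.diam (pos '' P.supp) + c ∧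
    P ∈ Submodule.span (ZMod 2) (F '' {i | (F i).supp ⊆ U})

/-- The family `F` is a complete set of local observables: each Pauli product of diameter at most
`R` that commutes with all members of `F` is locally generated by `F`. -/
def IsCSLO (pos : Q → M) (R c : ℝ) {ι : Type*} (F : ι → PauliVec Q) : Prop :=
  ∀ P : PauliVec Q, Metric.diam (pos '' P.supp) ≤ R → (∀ i, P.Commutes (F i)) →
    LocallyGenerated pos c F P

end Locality

/-! ### Symmetries -/

section Symmetries

variable {Q : Type*} [Fintype Q]

/-- The Pauli products of one type that commute with all the terms `T` of the other type. -/
def symmetries {ι : Type*} (T : ι → Bits Q) : Submodule (ZMod 2) (Bits Q) where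
  carrier := {b | ∀ i, b ⬝ᵥ T i = 0}
  zero_mem' := by intro i; simp
  add_mem' := by intro a b ha hb i; simp [add_dotProduct, ha i, hb i]
  smul_mem' := by intro t a ha i; simp [smul_dotProduct, ha i]

/-- The Pauli products of one type that commute with the Hamiltonian terms `T` of the other type
and with all the symmetries in `S`, which are of the other type too. -/
def compatibleSymmetries {ι : Type*} (T : ι → Bits Q) (S : Submodule (ZMod 2) (Bits Q)) :
    Submodule (ZMod 2) (Bits Q) :=
  symmetries T ⊓ symmetries (fun s : S => (s : Bits Q))

/-- `U` is a maximal family of elements of the symmetry group `S` that is independent modulo the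
group generated by the local symmetries `G`. -/
structure IsNonlocalGenerators {ι : Type*} (S : Submodule (ZMod 2) (Bits Q)) (G : ι → Bits Q)
    {n : ℕ} (U : Fin n → Bits Q) : Prop where
  mem : ∀ k, U k ∈ S
  indep : ∀ N : Finset (Fin n),
    ∑ k ∈ N, U k ∈ Submodule.span (ZMod 2) (Set.range G) → N = ∅
  maximal : S ≤ Submodule.span (ZMod 2) (Set.range G) ⊔ Submodule.span (ZMod 2) (Set.range U)

end Symmetries

/-! ### Generalized Ising models with a dual -/

/-- A generalized Ising model on the qubits `Q` with Ising terms `OZ` and transverse-field terms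
`OX`, a Kramers–Wannier dual of it on the qubits `Q'` with terms `DZ` and `DX`, and the chosen
generators of the local symmetries of both. -/
structure DualPair (Q Q' A I ιr ιs ιρ ισ : Type*) [Fintype Q] [Fintype Q'] where
  /-- The Ising terms. -/
  OZ : A → Bits Q
  /-- The transverse-field terms. -/
  OX : I → Bits Q
  /-- The duals of the Ising terms. -/
  DZ : A → Bits Q'
  /-- The duals of the transverse-field terms. -/
  DX : I → Bits Q'
  /-- The duality preserves commutation and anticommutation. -/
  dual : ∀ α i, OZ α ⬝ᵥ OX i = DZ α ⬝ᵥ DX i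
  /-- Local `Z`-type symmetries of the model. -/
  GZ : ιr → Bits Q
  /-- Local compatible `X`-type symmetries of the model. -/
  GX : ιs → Bits Q
  /-- Local `X`-type symmetries of the dual. -/
  ΓX : ιρ → Bits Q'
  /-- Local compatible `Z`-type symmetries of the dual. -/
  ΓZ : ισ → Bits Q'
  GZ_mem : ∀ r, GZ r ∈ symmetries OX
  GX_mem : ∀ s, GX s ∈ compatibleSymmetries OZ (symmetries OX)
  ΓX_mem : ∀ ρ, ΓX ρ ∈ symmetries DZ
  ΓZ_mem : ∀ σ, ΓZ σ ∈ compatibleSymmetries DX (symmetries DZ)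

namespace DualPair

variable {Q Q' A I ιr ιs ιρ ισ : Type*} [Fintype Q] [Fintype Q']
variable (P : DualPair Q Q' A I ιr ιs ιρ ισ)

/-- All `Z`-type symmetries of the model. -/
def symZ : Submodule (ZMod 2) (Bits Q) := symmetries P.OX

/-- The compatible `X`-type symmetries of the model. -/
def symX : Submodule (ZMod 2) (Bits Q) := compatibleSymmetries P.OZ P.symZ

/-- All `X`-type symmetries of the dual. -/
def dualSymX : Submodule (ZMod 2) (Bits Q') := symmetries P.DZ

/-- The compatible `Z`-type symmetries of the dual. -/
def dualSymZ : Submodule (ZMod 2) (Bits Q') := compatibleSymmetries P.DX P.dualSymX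

/-- The locality assumptions, for qubits placed in a common space `M` by `pos` and `pos'`. All
given operators have diameter at most `ℓ`, also jointly with their duals; operators of diameter at
most `R` count as local; local generation enlarges diameters by at most `c`; and the scale `R` is
large compared with `ℓ` and `c`. -/
structure IsLocal {M : Type*} [PseudoMetricSpace M] (pos : Q → M) (pos' : Q' → M)
    (ℓ c R : ℝ) : Prop where
  nonneg_ℓ : 0 ≤ ℓ
  nonneg_c : 0 ≤ c
  scale : 3 * ℓ + c ≤ R
  diam_Z : ∀ α, Metric.diam (pos '' supp (P.OZ α) ∪ pos' '' supp (P.DZ α)) ≤ ℓ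
  diam_X : ∀ i, Metric.diam (pos '' supp (P.OX i) ∪ pos' '' supp (P.DX i)) ≤ ℓ
  diam_GZ : ∀ r, Metric.diam (pos '' supp (P.GZ r)) ≤ ℓ
  diam_GX : ∀ s, Metric.diam (pos '' supp (P.GX s)) ≤ ℓ
  diam_ΓX : ∀ ρ, Metric.diam (pos' '' supp (P.ΓX ρ)) ≤ ℓ
  diam_ΓZ : ∀ σ, Metric.diam (pos' '' supp (P.ΓZ σ)) ≤ ℓ
  cslo : IsCSLO pos R c (Sum.elim (fun i => (P.OX i, 0)) (fun r => (0, P.GZ r)))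
  local_symX : ∀ a ∈ P.symX, Metric.diam (pos '' supp a) ≤ R →
    LocallyGenerated pos c (fun s => (P.GX s, 0)) (a, 0)
  dual_cslo : IsCSLO pos' R c (Sum.elim (fun α => (0, P.DZ α)) (fun ρ => (P.ΓX ρ, 0)))
  local_dualSymZ : ∀ b ∈ P.dualSymZ, Metric.diam (pos' '' supp b) ≤ R →
    LocallyGenerated pos' c (fun σ => (0, P.ΓZ σ)) (0, b)

/-! ### The two conditions -/

/-- The product of the `U_k`, `k ∈ N`, is the product of the `OX i`, `i ∈ J`, and the dual product
of the `DX i` is the identity modulo the local symmetries `ΓX`. -/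
def ChargeRelation {n : ℕ} (U : Fin n → Bits Q) (N : Finset (Fin n)) (J : Finset I) : Prop :=
  ∑ k ∈ N, U k = ∑ i ∈ J, P.OX i ∧
    ∑ i ∈ J, P.DX i ∈ Submodule.span (ZMod 2) (Set.range P.ΓX)

/-- The product of the `Ω_k`, `k ∈ N`, is the product of the `DZ α`, `α ∈ S`, and the dual product
of the `OZ α` is the identity modulo the local symmetries `GZ`. -/
def BoundaryRelation {n : ℕ} (Ω : Fin n → Bits Q') (N : Finset (Fin n)) (S : Finset A) : Prop :=
  ∑ k ∈ N, Ω k = ∑ α ∈ S, P.DZ α ∧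
    ∑ α ∈ S, P.OZ α ∈ Submodule.span (ZMod 2) (Set.range P.GZ)

end DualPair

/-! ### The layered system

For `K : ℕ` there are `L = 2 * K + 3` layers. The odd layers `1, 3, …, L` carry the qubits `Q` and
are indexed by `Fin (K + 2)`; the even layers `2, 4, …, L - 1` carry the qubits `Q'` and are indexed
by `Fin (K + 1)`. The even layer `j` lies between the odd layers `j.castSucc` and `j.succ`; the
internal odd layer `j.succ.castSucc`, `j : Fin K`, lies between the even layers `j.castSucc` and
`j.succ`. -/

/-- The qubits of the layered system. -/
abbrev Stack (Q Q' : Type*) (K : ℕ) : Type _ := (Fin (K + 2) × Q) ⊕ (Fin (K + 1) × Q')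

/-- A Pauli product of the original lattice, placed on an odd layer. -/
def onOdd {Q Q' : Type*} {K : ℕ} (j : Fin (K + 2)) (a : Bits Q) : Bits (Stack Q Q' K) :=
  Sum.elim (fun p => if p.1 = j then a p.2 else 0) 0

/-- A Pauli product of the dual lattice, placed on an even layer. -/
def onEven {Q Q' : Type*} {K : ℕ} (j : Fin (K + 1)) (a : Bits Q') : Bits (Stack Q Q' K) :=
  Sum.elim 0 (fun p => if p.1 = j then a p.2 else 0)

/-- The least eigenvalue of a self-adjoint operator on a finite-dimensional space. -/
def groundEnergy {E : Type*} [AddCommGroup E] [Module ℂ E] (H : E →ₗ[ℂ] E) : ℝ :=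
  sInf {e : ℝ | Module.End.HasEigenvalue H (e : ℂ)}

/-- The ground subspace of a self-adjoint operator on a finite-dimensional space. -/
def groundSpace {E : Type*} [AddCommGroup E] [Module ℂ E] (H : E →ₗ[ℂ] E) : Submodule ℂ E :=
  Module.End.eigenspace H (groundEnergy H : ℂ)

/-- The unitary `e` between the subspaces `W` and `F` carries the operator `T`, which preserves
`W`, to the operator `T'`. -/
def Carries {E E' : Type*} [NormedAddCommGroup E] [InnerProductSpace ℂ E]
    [NormedAddCommGroup E'] [InnerProductSpace ℂ E'] {W : Submodule ℂ E} {F : Submodule ℂ E'}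
    (e : W ≃ₗᵢ[ℂ] F) (T : E →ₗ[ℂ] E) (T' : E' →ₗ[ℂ] E') : Prop :=
  ∀ ψ : W, ∃ h : T ψ ∈ W, ((e ⟨T ψ, h⟩ : F) : E') = T' (e ψ : E')

/-- `W` is the orthogonal direct sum of the family `V` of subspaces. -/
def IsOrthogonalSum {E ι : Type*} [NormedAddCommGroup E] [InnerProductSpace ℂ E]
    (W : Submodule ℂ E) (V : ι → Submodule ℂ E) : Prop :=
  OrthogonalFamily ℂ (fun a => V a) (fun a => (V a).subtypeₗᵢ) ∧ ⨆ a, V a = W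

/-- Eigenvalues of the nonlocal operators that label the sectors. -/
structure SectorLabel (K nZ mX mZ : ℕ) where
  /-- Eigenvalues of the `ΩZ` on one even layer. -/
  dualZ : Fin mZ → ℤˣ
  /-- Eigenvalues of the `UZ` on the internal odd layers. -/
  origZ : Fin K → Fin nZ → ℤˣ
  /-- Eigenvalues of the `ΩX` on all even layers. -/
  dualX : Fin (K + 1) → Fin mX → ℤˣ

/-- The label with all eigenvalues `+1`. -/
def SectorLabel.trivial (K nZ mX mZ : ℕ) : SectorLabel K nZ mX mZ := ⟨1, 1, 1⟩

namespace DualPair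

variable {Q Q' A I ιr ιs ιρ ισ : Type*} [Fintype Q] [DecidableEq Q] [Fintype Q'] [DecidableEq Q']
variable (P : DualPair Q Q' A I ιr ιs ιρ ισ)

/-- The suspension `OX ΔX OX` centered at an even layer. -/
def suspX (K : ℕ) (i : I) (j : Fin (K + 1)) : Bits (Stack Q Q' K) :=
  onOdd j.castSucc (P.OX i) + onEven j (P.DX i) + onOdd j.succ (P.OX i)

/-- The suspension `ΔZ OZ ΔZ` centered at an internal odd layer. -/
def suspZ (K : ℕ) (α : A) (j : Fin K) : Bits (Stack Q Q' K) :=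
  onEven j.castSucc (P.DZ α) + onOdd j.succ.castSucc (P.OZ α) + onEven j.succ (P.DZ α)

/-- The bulk Hamiltonian with open boundary condition in the stacking direction. -/
def bulkHamiltonian [Fintype A] [Fintype I] [Fintype ιr] [Fintype ιs] [Fintype ιρ] [Fintype ισ]
    (K : ℕ) : Hilb (Stack Q Q' K) →ₗ[ℂ] Hilb (Stack Q Q' K) :=
  - (∑ α, ∑ j, pauliZ (P.suspZ K α j)) - (∑ i, ∑ j, pauliX (P.suspX K i j))
    - (∑ r, ∑ j, pauliZ (onOdd j (P.GZ r))) - (∑ s, ∑ j, pauliX (onOdd j (P.GX s)))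
    - (∑ ρ, ∑ j, pauliX (onEven j (P.ΓX ρ))) - (∑ σ, ∑ j, pauliZ (onEven j (P.ΓZ σ)))

/-- The boundary Hilbert space: the ground subspace of the bulk Hamiltonian. -/
def bdrySpace [Fintype A] [Fintype I] [Fintype ιr] [Fintype ιs] [Fintype ιρ] [Fintype ισ]
    (K : ℕ) : Submodule ℂ (Hilb (Stack Q Q' K)) :=
  groundSpace (P.bulkHamiltonian K)

/-- The boundary term `OX` on the first layer. -/
def firstX (K : ℕ) (i : I) : Hilb (Stack Q Q' K) →ₗ[ℂ] Hilb (Stack Q Q' K) :=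
  pauliX (onOdd 0 (P.OX i))

/-- The boundary term `OX` on the last layer. -/
def lastX (K : ℕ) (i : I) : Hilb (Stack Q Q' K) →ₗ[ℂ] Hilb (Stack Q Q' K) :=
  pauliX (onOdd (Fin.last (K + 1)) (P.OX i))

/-- The boundary term `OZ ΔZ` on the first two layers. -/
def firstZ (K : ℕ) (α : A) : Hilb (Stack Q Q' K) →ₗ[ℂ] Hilb (Stack Q Q' K) :=
  pauliZ (onOdd 0 (P.OZ α) + onEven 0 (P.DZ α))

/-- The boundary term `ΔZ OZ` on the last two layers. -/
def lastZ (K : ℕ) (α : A) : Hilb (Stack Q Q' K) →ₗ[ℂ] Hilb (Stack Q Q' K) :=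
  pauliZ (onEven (Fin.last K) (P.DZ α) + onOdd (Fin.last (K + 1)) (P.OZ α))

/-- The gauge-invariant space of the model: all local symmetries equal `1`. -/
def gaugeSpace : Submodule ℂ (Hilb Q) :=
  (⨅ r, Module.End.eigenspace (pauliZ (P.GZ r)) 1) ⊓
    ⨅ s, Module.End.eigenspace (pauliX (P.GX s)) 1

/-- The tensor square of the gauge-invariant space, inside the tensor square of the full space. -/
def twoCopies : Submodule ℂ (Hilb Q ⊗[ℂ] Hilb Q) :=
  LinearMap.range (TensorProduct.mapIncl P.gaugeSpace P.gaugeSpace)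

/-- The part of `twoCopies` on which all `U_k ⊗ U_k` equal `1`. -/
def ficSpace {n : ℕ} (U : Fin n → Bits Q) : Submodule ℂ (Hilb Q ⊗[ℂ] Hilb Q) :=
  P.twoCopies ⊓ ⨅ k, Module.End.eigenspace (TensorProduct.map (pauliX (U k)) (pauliX (U k))) 1

/-- The subspace `W` of the layered system is unitarily equivalent to the space `F` of two copies
of the model in such a way that the boundary terms on the two sides become, up to the given signs,
the terms of the first and of the second copy. The boundary Hamiltonian with coefficients `J, h` and
`J', h'` on the two sides then becomes the sum of the Hamiltonians of the two copies with
coefficients `η J, ε h` and `η' J', ε' h'`. -/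
def IsTwoCopies (K : ℕ) (W : Submodule ℂ (Hilb (Stack Q Q' K)))
    (F : Submodule ℂ (Hilb Q ⊗[ℂ] Hilb Q)) (ε ε' : I → ℤˣ) (η η' : A → ℤˣ) : Prop :=
  ∃ e : W ≃ₗᵢ[ℂ] F,
    (∀ i, Carries e (P.firstX K i)
      (sgn (ε i) • TensorProduct.map (pauliX (P.OX i)) LinearMap.id)) ∧
    (∀ i, Carries e (P.lastX K i)
      (sgn (ε' i) • TensorProduct.map LinearMap.id (pauliX (P.OX i)))) ∧
    (∀ α, Carries e (P.firstZ K α)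
      (sgn (η α) • TensorProduct.map (pauliZ (P.OZ α)) LinearMap.id)) ∧
    (∀ α, Carries e (P.lastZ K α)
      (sgn (η' α) • TensorProduct.map LinearMap.id (pauliZ (P.OZ α))))

/-- The boundary theory with `2 * K + 3` layers is anomalous: the boundary space is not an
orthogonal direct sum of sectors each of which is an unconstrained pair of copies of the model, with
the same action of the boundary terms in all sectors. -/
def Anomalous [Fintype A] [Fintype I] [Fintype ιr] [Fintype ιs] [Fintype ιρ] [Fintype ισ]
    (K : ℕ) : Prop :=
  ¬ ∃ (D : ℕ) (W : Fin D → Submodule ℂ (Hilb (Stack Q Q' K))),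
    IsOrthogonalSum (P.bdrySpace K) W ∧ ∀ a, P.IsTwoCopies K (W a) P.twoCopies 1 1 1 1

/-- The sector of the boundary space with given eigenvalues of the nonlocal operators `ΩZ` on the
even layer `l`, `UZ` on all internal odd layers, and `ΩX` on all even layers. -/
def sector [Fintype A] [Fintype I] [Fintype ιr] [Fintype ιs] [Fintype ιρ] [Fintype ισ]
    {nZ mX mZ : ℕ} (UZ : Fin nZ → Bits Q) (ΩX : Fin mX → Bits Q') (ΩZ : Fin mZ → Bits Q')
    (K : ℕ) (l : Fin (K + 1)) (t : SectorLabel K nZ mX mZ) :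
    Submodule ℂ (Hilb (Stack Q Q' K)) :=
  P.bdrySpace K ⊓
    (⨅ k, Module.End.eigenspace (pauliZ (onEven l (ΩZ k))) (sgn (t.dualZ k))) ⊓
    (⨅ j : Fin K, ⨅ k,
      Module.End.eigenspace (pauliZ (onOdd j.succ.castSucc (UZ k))) (sgn (t.origZ j k))) ⊓
    (⨅ j, ⨅ k, Module.End.eigenspace (pauliX (onEven j (ΩX k))) (sgn (t.dualX j k)))

end DualPair

end GI

end

/-!
The bulk Hamiltonian is minus a sum of commuting Pauli products with a common `+1` eigenvector, so
its ground space is a stabilizer space, and so is each sector. In the computational basis such a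
space consists of the functions on a coset `x₀ + D` of binary vectors that are invariant under
a group `E`, once signs have been removed by conjugation with a Pauli operator. Reading off the two
end layers identifies the pairs of vectors on the ends, modulo the pairs that extend to stabilizers
of the sector, with the boundary degrees of freedom. The suspensions `OX ΔX OX` along all layers
multiply to the same string on both ends, and the labels of the sector leave exactly the relations
`UX ⊗ UX = 1`. Without the labels, the only products of transverse-field terms on both ends that
are stabilizers are the ones whose dual is locally generated.

Locality enters only through the comparison of products of terms with products of their duals:
a locally generated symmetry is a product of terms in a slightly larger region, whose dual is
again local and hence locally generated. Therefore a product of transverse-field terms whose dual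
is locally generated is, up to local symmetries, a product of the `UX k` as in the first
condition, and similarly for the Ising terms and the second condition. If both conditions fail, the
stabilizers on the ends are the local symmetries, and moving vectors into the end layers makes all
signs trivial, so each coset carries two full copies of the model. Conversely, the first condition
puts `UX_N ⊗ UX_N` in the stabilizer group, and the second one makes a product of boundary Ising
terms equal to `ΩZ_M`, which takes the value `-1` in some sector.
-/

noncomputable section

namespace GI

section DotProduct

variable {k Q κ : Type*} [Field k] [Fintype Q]

theorem exists_dotProduct_eq (v : κ → Q → k) (c : κ → k)
    (h : ∀ w, Finsupp.linearCombination k v w = 0 → Finsupp.linearCombination k c w = 0) :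
    ∃ a, ∀ i, v i ⬝ᵥ a = c i := by
  classical
  have hc : Finsupp.linearCombination k c ∈
      (LinearMap.ker (Finsupp.linearCombination k v)).dualAnnihilator :=
    (Submodule.mem_dualAnnihilator _).2 fun w hw => h w hw
  rw [← LinearMap.range_dualMap_eq_dualAnnihilator_ker] at hc
  obtain ⟨f, hf⟩ := hc
  obtain ⟨a, rfl⟩ := (dotProductEquiv k Q).surjective f
  refine ⟨a, fun i => ?_⟩
  simpa [dotProduct_comm] using LinearMap.congr_fun hf (Finsupp.single i 1)

theorem mem_of_forall_dotProduct_eq_zero {S : Submodule k (Q → k)} {x : Q → k}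
    (h : ∀ a, (∀ v ∈ S, v ⬝ᵥ a = 0) → x ⬝ᵥ a = 0) : x ∈ S := by
  classical
  by_contra hx
  obtain ⟨f, hfx, hf⟩ := Submodule.exists_le_ker_of_notMem hx
  obtain ⟨a, rfl⟩ := (dotProductEquiv k Q).surjective f
  exact hfx ((dotProduct_comm a x).trans (h a fun v hv => (dotProduct_comm v a).trans (hf hv)))

theorem dotProduct_eq_zero_of_mem_span {S : Set (Q → k)} {a x : Q → k}
    (hx : x ∈ Submodule.span k S) (h : ∀ v ∈ S, v ⬝ᵥ a = 0) : x ⬝ᵥ a = 0 := by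
  classical
  have hS : Submodule.span k S ≤ LinearMap.ker (dotProductEquiv k Q a) :=
    Submodule.span_le.2 fun v hv => (dotProduct_comm a v).trans (h v hv)
  exact (dotProduct_comm x a).trans (hS hx)

theorem mem_span_range_iff_dotProduct (v : κ → Q → k) (x : Q → k) :
    x ∈ Submodule.span k (Set.range v) ↔ ∀ a, (∀ i, v i ⬝ᵥ a = 0) → x ⬝ᵥ a = 0 := by
  refine ⟨fun hx a ha => dotProduct_eq_zero_of_mem_span hx (Set.forall_mem_range.2 ha), fun h => ?_⟩
  exact mem_of_forall_dotProduct_eq_zero fun a ha =>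
    h a fun i => ha _ (Submodule.subset_span ⟨i, rfl⟩)

theorem exists_dotProduct_eq_on_of_inf {E L : Submodule k (Q → k)} {w : Q → k}
    (h : ∀ x ∈ E ⊓ L, w ⬝ᵥ x = 0) :
    ∃ w', (∀ x ∈ E, w' ⬝ᵥ x = w ⬝ᵥ x) ∧ ∀ x ∈ L, w' ⬝ᵥ x = 0 := by
  classical
  have hw : dotProductEquiv k Q w ∈ (E ⊓ L).dualAnnihilator :=
    (Submodule.mem_dualAnnihilator _).2 h
  rw [Subspace.dualAnnihilator_inf_eq] at hw
  obtain ⟨f, hf, g, hg, hfg⟩ := Submodule.mem_sup.1 hw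
  obtain ⟨w', rfl⟩ := (dotProductEquiv k Q).surjective g
  rw [Submodule.mem_dualAnnihilator] at hf hg
  refine ⟨w', fun x hx => ?_, hg⟩
  simpa [hf x hx] using LinearMap.congr_fun hfg x

end DotProduct

section BinaryVectors

variable {V : Type*} [AddCommGroup V] [Module (ZMod 2) V]

theorem add_add_cancel_of_zmod_two (x y : V) : x + y + y = x := by
  rw [add_assoc, ZModModule.add_self, add_zero]

theorem eq_of_add_eq_zero_of_zmod_two {x y : V} (h : x + y = 0) : x = y := by
  rwa [← sub_eq_zero, ZModModule.sub_eq_add]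

theorem zmod_two_eq_zero_or_one (u : ZMod 2) : u = 0 ∨ u = 1 := by
  decide +revert

end BinaryVectors

section Signs

/-- The sign `(-1) ^ v`. -/
def bitSign (v : ZMod 2) : ℤˣ := (-1) ^ v.val

theorem sgn_bitSign (v : ZMod 2) : sgn (bitSign v) = (-1 : ℂ) ^ v.val := by
  simp [sgn, bitSign]

@[simp] theorem bitSign_zero : bitSign 0 = 1 := rfl

@[simp] theorem bitSign_one : bitSign 1 = -1 := rfl

theorem bitSign_add (u v : ZMod 2) : bitSign (u + v) = bitSign u * bitSign v := by
  decide +revert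

theorem bitSign_sum {ι : Type*} (S : Finset ι) (f : ι → ZMod 2) :
    bitSign (∑ i ∈ S, f i) = ∏ i ∈ S, bitSign (f i) := by
  classical
  induction S using Finset.induction_on with
  | empty => simp
  | insert i S hi ih => rw [Finset.sum_insert hi, Finset.prod_insert hi, bitSign_add, ih]

theorem bitSign_bijective : Function.Bijective bitSign := by
  decide +revert

@[simp] theorem sgn_one : sgn 1 = 1 := by simp [sgn]

@[simp] theorem sgn_neg_one : sgn (-1) = -1 := by simp [sgn]

theorem sgn_mul (s t : ℤˣ) : sgn (s * t) = sgn s * sgn t := by simp [sgn]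

theorem sgn_mul_self (s : ℤˣ) : sgn s * sgn s = 1 := by
  rw [← sgn_mul, Int.units_mul_self, sgn_one]

theorem sgn_injective : Function.Injective sgn :=
  fun s t h => Units.ext (by simpa [sgn] using h)

theorem sgn_ne_zero (s : ℤˣ) : sgn s ≠ 0 :=
  left_ne_zero_of_mul_eq_one (sgn_mul_self s)

@[simp] theorem norm_sgn (s : ℤˣ) : ‖sgn s‖ = 1 := by
  rcases Int.units_eq_one_or s with rfl | rfl <;> simp

end Signs

section PauliOperators

variable {Q κ : Type*} [Fintype Q] [DecidableEq Q]

theorem pauliZ_apply_eq_sgn (b : Bits Q) (ψ : Hilb Q) (x : Bits Q) :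
    pauliZ b ψ x = sgn (bitSign (b ⬝ᵥ x)) * ψ x := by
  rw [pauliZ_apply, sgn_bitSign]

@[simp] theorem pauliX_zero : pauliX (0 : Bits Q) = LinearMap.id := by
  ext ψ x
  simp [pauliX_apply]

@[simp] theorem pauliZ_zero : pauliZ (0 : Bits Q) = LinearMap.id := by
  ext ψ x
  simp [pauliZ_apply]

theorem pauliX_pauliX (a : Bits Q) (ψ : Hilb Q) : pauliX a (pauliX a ψ) = ψ := by
  rw [← LinearMap.comp_apply, ← pauliX_add, ZModModule.add_self, pauliX_zero, LinearMap.id_apply]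

theorem pauliZ_pauliZ (b : Bits Q) (ψ : Hilb Q) : pauliZ b (pauliZ b ψ) = ψ := by
  rw [← LinearMap.comp_apply, ← pauliZ_add, ZModModule.add_self, pauliZ_zero, LinearMap.id_apply]

theorem pauliX_comm (a b : Bits Q) (ψ : Hilb Q) :
    pauliX a (pauliX b ψ) = pauliX b (pauliX a ψ) := by
  rw [← LinearMap.comp_apply, ← LinearMap.comp_apply, ← pauliX_add, ← pauliX_add, add_comm]

theorem pauliZ_comm (a b : Bits Q) (ψ : Hilb Q) :
    pauliZ a (pauliZ b ψ) = pauliZ b (pauliZ a ψ) := by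
  rw [← LinearMap.comp_apply, ← LinearMap.comp_apply, ← pauliZ_add, ← pauliZ_add, add_comm]

theorem pauliX_pauliZ (a b : Bits Q) (ψ : Hilb Q) :
    pauliX a (pauliZ b ψ) = sgn (bitSign (b ⬝ᵥ a)) • pauliZ b (pauliX a ψ) := by
  rw [sgn_bitSign]
  exact LinearMap.congr_fun (pauliX_comp_pauliZ a b) ψ

theorem pauliZ_pauliX (a b : Bits Q) (ψ : Hilb Q) :
    pauliZ b (pauliX a ψ) = sgn (bitSign (b ⬝ᵥ a)) • pauliX a (pauliZ b ψ) := by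
  rw [pauliX_pauliZ, smul_smul, sgn_mul_self, one_smul]

theorem norm_pauliX (a : Bits Q) (ψ : Hilb Q) : ‖pauliX a ψ‖ = ‖ψ‖ := by
  rw [EuclideanSpace.norm_eq, EuclideanSpace.norm_eq]
  congr 1
  exact Fintype.sum_equiv (Equiv.addRight a) _ _ fun x => by simp [pauliX_apply]

theorem norm_pauliZ (b : Bits Q) (ψ : Hilb Q) : ‖pauliZ b ψ‖ = ‖ψ‖ := by
  rw [EuclideanSpace.norm_eq, EuclideanSpace.norm_eq]
  simp [pauliZ_apply_eq_sgn]

theorem pauliZ_eq_smul_iff {b : Bits Q} {t : ℤˣ} {ψ : Hilb Q} :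
    pauliZ b ψ = sgn t • ψ ↔ ∀ y, ψ y ≠ 0 → bitSign (b ⬝ᵥ y) = t := by
  rw [PiLp.ext_iff]
  refine forall_congr' fun y => ?_
  rw [pauliZ_apply_eq_sgn, PiLp.smul_apply, smul_eq_mul]
  refine ⟨fun h hy => sgn_injective (mul_right_cancel₀ hy h), fun h => ?_⟩
  by_cases hy : ψ y = 0
  · simp only [hy, mul_zero]
  · rw [h hy]

theorem pauliX_eq_smul_iff {a : Bits Q} {t : ℤˣ} {ψ : Hilb Q} :
    pauliX a ψ = sgn t • ψ ↔ ∀ y, ψ (y + a) = sgn t * ψ y := by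
  rw [PiLp.ext_iff]
  rfl

theorem pauliX_linearCombination_eq_smul {x : κ → Bits Q} {c : κ → ZMod 2} {ψ : Hilb Q}
    (h : ∀ k, pauliX (x k) ψ = sgn (bitSign (c k)) • ψ) (w : κ →₀ ZMod 2) :
    pauliX (Finsupp.linearCombination (ZMod 2) x w) ψ =
      sgn (bitSign (Finsupp.linearCombination (ZMod 2) c w)) • ψ := by
  induction w using Finsupp.induction_linear with
  | zero => simp
  | add v w hv hw =>
    rw [map_add, map_add, pauliX_add, LinearMap.comp_apply, hw, map_smul, hv, smul_smul,
      bitSign_add, sgn_mul, mul_comm]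
  | single k t =>
    rw [Finsupp.linearCombination_single, Finsupp.linearCombination_single]
    rcases zmod_two_eq_zero_or_one t with rfl | rfl
    · simp
    · rw [one_smul, one_smul, h]

/-- The unitary `X^a Z^b`. -/
def pauliXZ (a b : Bits Q) : Hilb Q ≃ₗᵢ[ℂ] Hilb Q where
  toLinearEquiv := LinearEquiv.ofLinearMap (pauliX a ∘ₗ pauliZ b) (pauliZ b ∘ₗ pauliX a)
    (LinearMap.ext fun ψ => by simp [pauliZ_pauliZ, pauliX_pauliX])
    (LinearMap.ext fun ψ => by simp [pauliZ_pauliZ, pauliX_pauliX])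
  norm_map' ψ := by simp [norm_pauliX, norm_pauliZ]

theorem pauliXZ_apply (a b : Bits Q) (ψ : Hilb Q) : pauliXZ a b ψ = pauliX a (pauliZ b ψ) := rfl

theorem pauliX_pauliXZ (a b v : Bits Q) (ψ : Hilb Q) :
    pauliX v (pauliXZ a b ψ) = sgn (bitSign (b ⬝ᵥ v)) • pauliXZ a b (pauliX v ψ) := by
  rw [pauliXZ_apply, pauliX_comm, pauliX_pauliZ, map_smul, pauliXZ_apply]

theorem pauliZ_pauliXZ (a b v : Bits Q) (ψ : Hilb Q) :
    pauliZ v (pauliXZ a b ψ) = sgn (bitSign (v ⬝ᵥ a)) • pauliXZ a b (pauliZ v ψ) := by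
  rw [pauliXZ_apply, pauliZ_pauliX, pauliZ_comm, pauliXZ_apply]

end PauliOperators

section StabSpace

variable {Q κ κ' : Type*} [Fintype Q] [DecidableEq Q]

/-- The joint eigenspace of the `Z`-type operators `z` and of the `X`-type operators `x`, with
eigenvalues `s` and `s'`. -/
def stabSpace (z : κ → Bits Q) (s : κ → ℤˣ) (x : κ' → Bits Q) (s' : κ' → ℤˣ) :
    Submodule ℂ (Hilb Q) :=
  (⨅ k, Module.End.eigenspace (pauliZ (z k)) (sgn (s k))) ⊓
    ⨅ k, Module.End.eigenspace (pauliX (x k)) (sgn (s' k))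

variable {z : κ → Bits Q} {s : κ → ℤˣ} {x : κ' → Bits Q} {s' : κ' → ℤˣ} {a b v : Bits Q}

theorem mem_stabSpace {ψ : Hilb Q} : ψ ∈ stabSpace z s x s' ↔
    (∀ k, pauliZ (z k) ψ = sgn (s k) • ψ) ∧ ∀ k, pauliX (x k) ψ = sgn (s' k) • ψ := by
  simp [stabSpace, Submodule.mem_iInf]

theorem pauliX_mem_stabSpace (hv : ∀ k, z k ⬝ᵥ v = 0) {ψ : Hilb Q} (hψ : ψ ∈ stabSpace z s x s') :
    pauliX v ψ ∈ stabSpace z s x s' := by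
  rw [mem_stabSpace] at hψ ⊢
  refine ⟨fun k => ?_, fun k => ?_⟩
  · rw [pauliZ_pauliX, hv, bitSign_zero, sgn_one, one_smul, hψ.1, map_smul]
  · rw [pauliX_comm, hψ.2, map_smul]

theorem pauliZ_mem_stabSpace (hv : ∀ k, v ⬝ᵥ x k = 0) {ψ : Hilb Q} (hψ : ψ ∈ stabSpace z s x s') :
    pauliZ v ψ ∈ stabSpace z s x s' := by
  rw [mem_stabSpace] at hψ ⊢
  refine ⟨fun k => ?_, fun k => ?_⟩
  · rw [pauliZ_comm, hψ.1, map_smul]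
  · rw [pauliX_pauliZ, hv, bitSign_zero, sgn_one, one_smul, hψ.2, map_smul]

theorem pauliXZ_mem_stabSpace_iff (ha : ∀ k, bitSign (z k ⬝ᵥ a) = s k)
    (hb : ∀ k, bitSign (b ⬝ᵥ x k) = s' k) {ψ : Hilb Q} :
    pauliXZ a b ψ ∈ stabSpace z s x s' ↔ ψ ∈ stabSpace z 1 x 1 := by
  have cancel (t : ℤˣ) (φ : Hilb Q) :
      sgn t • pauliXZ a b φ = sgn t • pauliXZ a b ψ ↔ φ = sgn 1 • ψ := by
    rw [smul_right_inj (sgn_ne_zero t), (pauliXZ a b).injective.eq_iff, sgn_one, one_smul]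
  simp only [mem_stabSpace, pauliZ_pauliXZ, pauliX_pauliXZ, ha, hb, cancel, Pi.one_apply]

theorem exists_signs_of_stabSpace_ne_bot (h : stabSpace z s x s' ≠ ⊥) :
    (∃ a, ∀ k, bitSign (z k ⬝ᵥ a) = s k) ∧ ∃ b, ∀ k, bitSign (b ⬝ᵥ x k) = s' k := by
  obtain ⟨ψ, hψ, h0⟩ := Submodule.exists_mem_ne_zero_of_ne_bot h
  rw [mem_stabSpace] at hψ
  constructor
  · obtain ⟨a, ha⟩ : ∃ a, ψ a ≠ 0 := by
      by_contra! hzero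
      exact h0 (PiLp.ext hzero)
    exact ⟨a, fun k => pauliZ_eq_smul_iff.1 (hψ.1 k) a ha⟩
  · choose c hc using fun k => bitSign_bijective.2 (s' k)
    have heigen : ∀ k, pauliX (x k) ψ = sgn (bitSign (c k)) • ψ := fun k => by rw [hc, hψ.2]
    obtain ⟨b, hb⟩ := exists_dotProduct_eq x c fun w hw => by
      have hw' := pauliX_linearCombination_eq_smul heigen w
      rw [hw, pauliX_zero, LinearMap.id_apply] at hw'
      refine bitSign_bijective.1 (sgn_injective (smul_left_injective ℂ h0 ?_))
      simpa using hw'.symm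
    exact ⟨b, fun k => by rw [dotProduct_comm, hb, hc]⟩

theorem stabSpace_one_ne_bot (hzx : ∀ k k', z k ⬝ᵥ x k' = 0) : stabSpace z 1 x 1 ≠ ⊥ := by
  classical
  let S := Submodule.span (ZMod 2) (Set.range x)
  let ψ : Hilb Q := WithLp.toLp 2 fun y => if y ∈ S then 1 else 0
  have hψ : ∀ y, ψ y = if y ∈ S then 1 else 0 := fun _ => rfl
  refine Submodule.ne_bot_iff _ |>.2 ⟨ψ, mem_stabSpace.2 ⟨fun k => ?_, fun k => ?_⟩, fun h => ?_⟩
  · refine pauliZ_eq_smul_iff.2 fun y hy => ?_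
    have hyS : y ∈ S := by
      by_contra h
      exact hy (by rw [hψ, if_neg h])
    rw [dotProduct_comm, (mem_span_range_iff_dotProduct x y).1 hyS (z k)
      fun k' => (dotProduct_comm _ _).trans (hzx k k'), bitSign_zero, Pi.one_apply]
  · refine pauliX_eq_smul_iff.2 fun y => ?_
    simp [hψ, S.add_mem_iff_left (Submodule.subset_span ⟨k, rfl⟩ : x k ∈ S)]
  · simpa [h] using hψ 0

theorem stabSpace_ne_bot (hzx : ∀ k k', z k ⬝ᵥ x k' = 0)
    (ha : ∀ k, bitSign (z k ⬝ᵥ a) = s k) (hb : ∀ k, bitSign (b ⬝ᵥ x k) = s' k) :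
    stabSpace z s x s' ≠ ⊥ := by
  obtain ⟨ψ, hψ, h0⟩ := Submodule.exists_mem_ne_zero_of_ne_bot (stabSpace_one_ne_bot hzx)
  exact Submodule.ne_bot_iff _ |>.2
    ⟨pauliXZ a b ψ, (pauliXZ_mem_stabSpace_iff ha hb).2 hψ, by simpa using h0⟩

/-- A Pauli operator with the commutation signs prescribed by the eigenvalues identifies the joint
eigenspace with the one where all eigenvalues are `1`. -/
def stabSpaceEquiv (ha : ∀ k, bitSign (z k ⬝ᵥ a) = s k) (hb : ∀ k, bitSign (b ⬝ᵥ x k) = s' k) :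
    stabSpace z s x s' ≃ₗᵢ[ℂ] stabSpace z 1 x 1 :=
  ((pauliXZ a b).symm.submoduleMap (stabSpace z s x s')).trans
    (LinearIsometryEquiv.ofEq _ _ (by
      ext ψ
      rw [← pauliXZ_mem_stabSpace_iff ha hb]
      exact ⟨by rintro ⟨φ, hφ, rfl⟩; simpa using hφ, fun h => ⟨_, h, by simp⟩⟩))

theorem stabSpaceEquiv_apply (ha : ∀ k, bitSign (z k ⬝ᵥ a) = s k)
    (hb : ∀ k, bitSign (b ⬝ᵥ x k) = s' k) (ψ : stabSpace z s x s') :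
    (stabSpaceEquiv ha hb ψ : Hilb Q) = (pauliXZ a b).symm ψ := rfl

theorem carries_stabSpaceEquiv_pauliX (ha : ∀ k, bitSign (z k ⬝ᵥ a) = s k)
    (hb : ∀ k, bitSign (b ⬝ᵥ x k) = s' k) (hv : ∀ k, z k ⬝ᵥ v = 0) :
    Carries (stabSpaceEquiv ha hb) (pauliX v) (sgn (bitSign (b ⬝ᵥ v)) • pauliX v) := by
  refine fun ψ => ⟨pauliX_mem_stabSpace hv ψ.2, ?_⟩
  rw [stabSpaceEquiv_apply, stabSpaceEquiv_apply, LinearIsometryEquiv.symm_apply_eq,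
    LinearMap.smul_apply, map_smul, ← pauliX_pauliXZ, LinearIsometryEquiv.apply_symm_apply]

theorem carries_stabSpaceEquiv_pauliZ (ha : ∀ k, bitSign (z k ⬝ᵥ a) = s k)
    (hb : ∀ k, bitSign (b ⬝ᵥ x k) = s' k) (hv : ∀ k, v ⬝ᵥ x k = 0) :
    Carries (stabSpaceEquiv ha hb) (pauliZ v) (sgn (bitSign (v ⬝ᵥ a)) • pauliZ v) := by
  refine fun ψ => ⟨pauliZ_mem_stabSpace hv ψ.2, ?_⟩
  rw [stabSpaceEquiv_apply, stabSpaceEquiv_apply, LinearIsometryEquiv.symm_apply_eq,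
    LinearMap.smul_apply, map_smul, ← pauliZ_pauliXZ, LinearIsometryEquiv.apply_symm_apply]

end StabSpace

section Carries

variable {E E' E'' : Type*} [NormedAddCommGroup E] [InnerProductSpace ℂ E]
  [NormedAddCommGroup E'] [InnerProductSpace ℂ E'] [NormedAddCommGroup E'']
  [InnerProductSpace ℂ E''] {W : Submodule ℂ E} {F : Submodule ℂ E'} {G : Submodule ℂ E''}

theorem Carries.trans {e : W ≃ₗᵢ[ℂ] F} {e' : F ≃ₗᵢ[ℂ] G} {T : E →ₗ[ℂ] E} {T' : E' →ₗ[ℂ] E'}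
    {T'' : E'' →ₗ[ℂ] E''} (h : Carries e T T') (h' : Carries e' T' T'') :
    Carries (e.trans e') T T'' := by
  intro ψ
  obtain ⟨hmem, heq⟩ := h ψ
  obtain ⟨_, heq'⟩ := h' (e ψ)
  refine ⟨hmem, ?_⟩
  rw [LinearIsometryEquiv.trans_apply, LinearIsometryEquiv.trans_apply, ← heq']
  congr 2
  exact Subtype.ext heq

theorem Carries.smul {e : W ≃ₗᵢ[ℂ] F} {T : E →ₗ[ℂ] E} {T' : E' →ₗ[ℂ] E'}
    (h : Carries e T T') (c : ℂ) : Carries e (c • T) (c • T') := by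
  intro ψ
  obtain ⟨hmem, heq⟩ := h ψ
  exact ⟨W.smul_mem c hmem,
    (congrArg Subtype.val (map_smul e c ⟨T ψ, hmem⟩)).trans (congrArg (c • ·) heq)⟩

theorem Carries.comp {e : W ≃ₗᵢ[ℂ] F} {T S : E →ₗ[ℂ] E} {T' S' : E' →ₗ[ℂ] E'}
    (h : Carries e T T') (h' : Carries e S S') : Carries e (T ∘ₗ S) (T' ∘ₗ S') := by
  intro ψ
  obtain ⟨hS, heqS⟩ := h' ψ
  obtain ⟨hT, heqT⟩ := h ⟨_, hS⟩
  exact ⟨hT, heqT.trans (congrArg T' heqS)⟩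

theorem Carries.id {e : W ≃ₗᵢ[ℂ] F} : Carries e LinearMap.id LinearMap.id :=
  fun ψ => ⟨ψ.2, rfl⟩

end Carries

section OrthogonalSum

variable {E κ : Type*} [NormedAddCommGroup E] [InnerProductSpace ℂ E]

theorem inner_eq_zero_of_eq_sgn_smul {T : E →ₗ[ℂ] E} (hT : ∀ ψ, ‖T ψ‖ = ‖ψ‖) {s t : ℤˣ}
    (hst : s ≠ t) {φ ψ : E} (hφ : T φ = sgn s • φ) (hψ : T ψ = sgn t • ψ) :
    inner ℂ φ ψ = 0 := by
  have h := (LinearMap.norm_map_iff_inner_map_map T).1 hT φ ψ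
  rw [hφ, hψ, inner_smul_left, inner_smul_right, ← mul_assoc] at h
  have hsgn : (starRingEnd ℂ) (sgn s) * sgn t = -1 := by
    rcases Int.units_eq_one_or s with rfl | rfl <;> rcases Int.units_eq_one_or t with rfl | rfl <;>
      simp at hst ⊢
  rw [hsgn, neg_one_mul] at h
  exact self_eq_neg.1 h.symm

theorem mem_iSup_joint_eigenspace (W : Submodule ℂ E) (T : κ → E →ₗ[ℂ] E)
    (hinv : ∀ k ψ, T k (T k ψ) = ψ) (hcomm : ∀ k k' ψ, T k (T k' ψ) = T k' (T k ψ))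
    (hW : ∀ k, ∀ ψ ∈ W, T k ψ ∈ W) (S : Finset κ) {ψ : E} (hψ : ψ ∈ W) :
    ψ ∈ ⨆ s : κ → ℤˣ, W ⊓ ⨅ k ∈ S, Module.End.eigenspace (T k) (sgn (s k)) := by
  classical
  induction S using Finset.induction_on with
  | empty => exact Submodule.mem_iSup_of_mem 1 (by simpa using hψ)
  | insert k S _ ih =>
    refine (iSup_le fun s => ?_ : (⨆ s : κ → ℤˣ, W ⊓ ⨅ k ∈ S, _) ≤ _) ih
    rintro φ ⟨hφ, hφS⟩
    simp only [SetLike.mem_coe, Submodule.mem_iInf, Module.End.mem_eigenspace_iff] at hφ hφS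
    have hproj : ∀ t : ℤˣ, φ + sgn t • T k φ ∈ ⨆ s : κ → ℤˣ, W ⊓
        ⨅ i ∈ insert k S, Module.End.eigenspace (T i) (sgn (s i)) := by
      intro t
      refine Submodule.mem_iSup_of_mem (Function.update s k t)
        ⟨W.add_mem hφ (W.smul_mem _ (hW k φ hφ)), ?_⟩
      simp only [SetLike.mem_coe, Submodule.mem_iInf, Module.End.mem_eigenspace_iff]
      intro k' hk'
      rcases eq_or_ne k' k with rfl | hne
      · rw [Function.update_self, map_add, map_smul, hinv, smul_add, smul_smul, sgn_mul_self,
          one_smul, add_comm]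
      · rw [Function.update_of_ne hne, map_add, map_smul, hcomm,
          hφS k' (Finset.mem_of_mem_insert_of_ne hk' hne), map_smul, smul_add, smul_comm]
    have hsplit : φ = (2⁻¹ : ℂ) • ((φ + sgn 1 • T k φ) + (φ + sgn (-1) • T k φ)) := by
      rw [sgn_one, sgn_neg_one]
      module
    rw [hsplit]
    exact Submodule.smul_mem _ _ (Submodule.add_mem _ (hproj 1) (hproj (-1)))

theorem isOrthogonalSum_of_involutions [Finite κ] (W : Submodule ℂ E) (T : κ → E →ₗ[ℂ] E)
    (hnorm : ∀ k ψ, ‖T k ψ‖ = ‖ψ‖)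
    (hinv : ∀ k ψ, T k (T k ψ) = ψ) (hcomm : ∀ k k' ψ, T k (T k' ψ) = T k' (T k ψ))
    (hW : ∀ k, ∀ ψ ∈ W, T k ψ ∈ W) :
    IsOrthogonalSum W fun s : κ → ℤˣ => W ⊓ ⨅ k, Module.End.eigenspace (T k) (sgn (s k)) := by
  classical
  have := Fintype.ofFinite κ
  constructor
  · intro s t hst φ ψ
    obtain ⟨k, hk⟩ := Function.ne_iff.1 hst
    have hφ := φ.2.2
    have hψ := ψ.2.2
    simp only [SetLike.mem_coe, Submodule.mem_iInf, Module.End.mem_eigenspace_iff] at hφ hψ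
    exact inner_eq_zero_of_eq_sgn_smul (hnorm k) hk (hφ k) (hψ k)
  · refine le_antisymm (iSup_le fun s => inf_le_left) fun ψ hψ => ?_
    simpa using mem_iSup_joint_eigenspace W T hinv hcomm hW Finset.univ hψ

theorem IsOrthogonalSum.comp_equiv {ι ι' : Type*} {W : Submodule ℂ E} {V : ι → Submodule ℂ E}
    (h : IsOrthogonalSum W V) (e : ι' ≃ ι) : IsOrthogonalSum W (fun a => V (e a)) :=
  ⟨h.1.comp e.injective, (e.iSup_comp (g := V)).trans h.2⟩

end OrthogonalSum

section GroundSpace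

variable {𝕜 E κ : Type*} [Fintype κ] [NormedAddCommGroup E]

theorem eq_of_sum_eq_card_smul [RCLike 𝕜] [InnerProductSpace 𝕜 E] {x : κ → E} {ψ : E}
    (hnorm : ∀ k, ‖x k‖ = ‖ψ‖) (hsum : ∑ k, x k = Fintype.card κ • ψ) (k : κ) : x k = ψ := by
  have hdist : ∀ k, ‖x k - ψ‖ ^ 2 = 2 * ‖ψ‖ ^ 2 - 2 * RCLike.re (inner 𝕜 (x k) ψ) := fun k => by
    rw [@norm_sub_sq 𝕜, hnorm]
    ring
  have hinner : ∑ k, RCLike.re (inner 𝕜 (x k) ψ) = Fintype.card κ * ‖ψ‖ ^ 2 := by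
    rw [← map_sum, ← sum_inner, hsum, ← Nat.cast_smul_eq_nsmul 𝕜, inner_smul_left,
      inner_self_eq_norm_sq_to_K, ← RCLike.ofReal_natCast, RCLike.conj_ofReal,
      ← RCLike.ofReal_pow, ← RCLike.ofReal_mul, RCLike.ofReal_re]
  have hzero : ∑ k, ‖x k - ψ‖ ^ 2 = 0 := by
    simp only [hdist, Finset.sum_sub_distrib, ← Finset.mul_sum, hinner, Finset.sum_const,
      Finset.card_univ, nsmul_eq_mul]
    ring
  have hk := (Finset.sum_eq_zero_iff_of_nonneg fun k _ => sq_nonneg ‖x k - ψ‖).1 hzero k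
    (Finset.mem_univ k)
  exact sub_eq_zero.1 (norm_eq_zero.1 (sq_eq_zero_iff.1 hk))

theorem groundEnergy_neg_sum [NormedSpace ℂ E] {T : κ → E →ₗ[ℂ] E} {ψ₀ : E}
    (hnorm : ∀ k ψ, ‖T k ψ‖ = ‖ψ‖) (h0 : ψ₀ ≠ 0) (hψ₀ : ∀ k, T k ψ₀ = ψ₀) :
    groundEnergy (-∑ k, T k) = -(Fintype.card κ : ℝ) := by
  refine IsLeast.csInf_eq ⟨?_, fun e he => ?_⟩
  · refine Module.End.hasEigenvalue_of_hasEigenvector (x := ψ₀) ⟨?_, h0⟩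
    rw [Module.End.mem_eigenspace_iff]
    simp [LinearMap.sum_apply, hψ₀, Nat.cast_smul_eq_nsmul]
  · obtain ⟨φ, hφ, hφ0⟩ := he.exists_hasEigenvector
    rw [Module.End.mem_eigenspace_iff] at hφ
    have hle : ‖(e : ℂ) • φ‖ ≤ Fintype.card κ * ‖φ‖ := by
      rw [← hφ, LinearMap.neg_apply, norm_neg, LinearMap.sum_apply]
      refine (norm_sum_le _ _).trans ?_
      simp [hnorm]
    rw [norm_smul, Complex.norm_real, Real.norm_eq_abs] at hle
    linarith [neg_abs_le e, le_of_mul_le_mul_right hle (norm_pos_iff.2 hφ0)]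

theorem mem_groundSpace_neg_sum_iff [InnerProductSpace ℂ E] {T : κ → E →ₗ[ℂ] E} {ψ₀ : E}
    (hnorm : ∀ k ψ, ‖T k ψ‖ = ‖ψ‖) (h0 : ψ₀ ≠ 0) (hψ₀ : ∀ k, T k ψ₀ = ψ₀) {ψ : E} :
    ψ ∈ groundSpace (-∑ k, T k) ↔ ∀ k, T k ψ = ψ := by
  rw [groundSpace, groundEnergy_neg_sum hnorm h0 hψ₀, Module.End.mem_eigenspace_iff]
  refine ⟨fun h => eq_of_sum_eq_card_smul (𝕜 := ℂ) (hnorm · ψ) ?_, fun h => ?_⟩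
  · simpa [LinearMap.sum_apply, Nat.cast_smul_eq_nsmul] using h
  · simp [LinearMap.sum_apply, h, Nat.cast_smul_eq_nsmul]

end GroundSpace

section CodeSpace

variable {V Y₀ : Type*} [AddCommGroup V] [Module (ZMod 2) V] [AddCommGroup Y₀]
  [Module (ZMod 2) Y₀]

/-- The functions supported on the coset `x₀ + D` and invariant under translation by `E`, that is,
the joint `+1` eigenspaces of Pauli operators seen in the computational basis. -/
def codeSpace (x₀ : V) (D E : Submodule (ZMod 2) V) : Submodule ℂ (EuclideanSpace ℂ V) where
  carrier := {g | (∀ x, g x ≠ 0 → x + x₀ ∈ D) ∧ ∀ e ∈ E, ∀ x, g (x + e) = g x}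
  zero_mem' := by simp
  add_mem' := by
    rintro f g ⟨hf, hf'⟩ ⟨hg, hg'⟩
    refine ⟨fun x hx => ?_, fun e he x => by simp [hf' e he, hg' e he]⟩
    by_cases h : f x = 0
    · exact hg x (by simpa [h] using hx)
    · exact hf x h
  smul_mem' := by
    rintro c g ⟨hg, hg'⟩
    exact ⟨fun x hx => hg x (right_ne_zero_of_mul hx), fun e he x => by simp [hg' e he]⟩

theorem card_filter_add_mem {G S : Type*} [AddGroup G] [Fintype G] [SetLike S G] (K : S)
    [DecidablePred (· ∈ K)] (g : G) : (Finset.univ.filter (· + g ∈ K)).card = Nat.card K := by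
  rw [Nat.card_eq_fintype_card, Fintype.card_subtype]
  exact Finset.card_equiv (Equiv.addRight g) (by simp)

variable (T : Y₀ →ₗ[ZMod 2] V) {x₀ : V} {Y : Submodule (ZMod 2) Y₀} {D E : Submodule (ZMod 2) V}

theorem mem_coset_iff_add_mem {x : V} {y₀ : Y₀} (hy₀ : y₀ ∈ Y) (hx : x₀ + T y₀ + x ∈ E) (y : Y₀) :
    y ∈ Y ∧ x₀ + T y + x ∈ E ↔ y + y₀ ∈ Y ⊓ E.comap T := by
  have hT : T (y + y₀) = (x₀ + T y + x) + (x₀ + T y₀ + x) := by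
    rw [map_add, ← ZModModule.add_add_add_cancel (T y) (x₀ + x) (T y₀)]
    abel
  rw [Submodule.mem_inf, Submodule.mem_comap, hT, Y.add_mem_iff_left hy₀, E.add_mem_iff_left hx]

theorem exists_mem_coset (hD : D = Y.map T ⊔ E) {x : V} (hx : x + x₀ ∈ D) :
    ∃ y ∈ Y, x₀ + T y + x ∈ E := by
  rw [hD, Submodule.mem_sup] at hx
  obtain ⟨_, ⟨y, hy, rfl⟩, e, he, heq⟩ := hx
  refine ⟨y, hy, ?_⟩
  rwa [add_right_comm, add_comm x₀, ← heq, add_right_comm, ZModModule.add_self, zero_add]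

open Classical in
theorem sum_norm_sq_comp_eq [Fintype V] [Fintype Y₀] (hD : D = Y.map T ⊔ E)
    {g : EuclideanSpace ℂ V} (hg : g ∈ codeSpace x₀ D E) :
    (Nat.card E : ℝ) * ∑ y with y ∈ Y, ‖g (x₀ + T y)‖ ^ 2 =
      Nat.card ↥(Y ⊓ E.comap T) * ∑ x, ‖g x‖ ^ 2 := by
  calc (Nat.card E : ℝ) * ∑ y with y ∈ Y, ‖g (x₀ + T y)‖ ^ 2
      = ∑ y with y ∈ Y, ∑ x with x₀ + T y + x ∈ E, ‖g x‖ ^ 2 := by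
        rw [Finset.mul_sum]
        refine Finset.sum_congr rfl fun y _ => ?_
        have hcoset : ∀ x, x₀ + T y + x ∈ E → ‖g x‖ ^ 2 = ‖g (x₀ + T y)‖ ^ 2 := fun x hx => by
          rw [← hg.2 _ hx (x₀ + T y), ← add_assoc, ZModModule.add_self, zero_add]
        rw [Finset.sum_congr rfl fun x hx => hcoset x (Finset.mem_filter.1 hx).2,
          Finset.sum_const, nsmul_eq_mul]
        simp only [add_comm (x₀ + T y)]
        rw [card_filter_add_mem E]
    _ = ∑ x, ∑ y with y ∈ Y ∧ x₀ + T y + x ∈ E, ‖g x‖ ^ 2 :=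
        Finset.sum_comm' (by simp)
    _ = Nat.card ↥(Y ⊓ E.comap T) * ∑ x, ‖g x‖ ^ 2 := by
        rw [Finset.mul_sum]
        refine Finset.sum_congr rfl fun x _ => ?_
        rw [Finset.sum_const, nsmul_eq_mul]
        by_cases h0 : g x = 0
        · simp [h0]
        obtain ⟨y₀, hy₀, hx⟩ := exists_mem_coset T hD (hg.1 x h0)
        simp only [mem_coset_iff_add_mem T hy₀ hx]
        rw [card_filter_add_mem (Y ⊓ E.comap T)]

variable (x₀ Y D E)

/-- Pullback of functions along the affine map `y ↦ x₀ + T y`, restricted to `Y`. -/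
def codePullback : codeSpace x₀ D E →ₗ[ℂ] codeSpace (0 : Y₀) Y (Y ⊓ E.comap T) where
  toFun g := ⟨WithLp.toLp 2 ((Y : Set Y₀).indicator fun y => g.1 (x₀ + T y)), by
    refine ⟨fun y hy => ?_, fun e he y => ?_⟩
    · rw [add_zero]
      exact Set.mem_of_indicator_ne_zero (f := fun y => g.1 (x₀ + T y)) hy
    · have hye : y + e ∈ Y ↔ y ∈ Y := Y.add_mem_iff_left he.1
      have hg : g.1 (x₀ + T (y + e)) = g.1 (x₀ + T y) := by
        rw [map_add, ← add_assoc, g.2.2 (T e) he.2]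
      classical
      simp only [Set.indicator_apply, SetLike.mem_coe, hye, hg]⟩
  map_add' f g := by
    ext y
    exact congrFun (Set.indicator_add (Y : Set Y₀) (fun y => (f : EuclideanSpace ℂ V) (x₀ + T y))
      fun y => (g : EuclideanSpace ℂ V) (x₀ + T y)) y
  map_smul' c g := by
    ext y
    exact congrFun (Set.indicator_const_smul (Y : Set Y₀) c
      fun y => (g : EuclideanSpace ℂ V) (x₀ + T y)) y

theorem codePullback_apply (g : codeSpace x₀ D E) (y : Y₀) :
    (codePullback T x₀ Y D E g : EuclideanSpace ℂ Y₀) y =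
      (Y : Set Y₀).indicator (fun y => (g : EuclideanSpace ℂ V) (x₀ + T y)) y := rfl

variable {x₀ Y D E}

theorem card_mul_norm_sq_codePullback [Fintype V] [Fintype Y₀] (hD : D = Y.map T ⊔ E)
    (g : codeSpace x₀ D E) :
    Nat.card E * ‖codePullback T x₀ Y D E g‖ ^ 2 = Nat.card ↥(Y ⊓ E.comap T) * ‖g‖ ^ 2 := by
  classical
  rw [Submodule.coe_norm, Submodule.coe_norm, EuclideanSpace.norm_sq_eq, EuclideanSpace.norm_sq_eq,
    ← sum_norm_sq_comp_eq T hD g.2, Finset.sum_filter]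
  congr 1
  refine Finset.sum_congr rfl fun y _ => ?_
  rw [codePullback_apply, Set.indicator_apply]
  split_ifs with hy hy' hy' <;> simp_all

theorem codePullback_surjective [Finite Y₀] (hD : D = Y.map T ⊔ E) :
    Function.Surjective (codePullback T x₀ Y D E) := by
  classical
  have := Fintype.ofFinite Y₀
  intro h
  let f : EuclideanSpace ℂ V := WithLp.toLp 2 fun x =>
    ∑ y with y ∈ Y ∧ x₀ + T y + x ∈ E, (h : EuclideanSpace ℂ Y₀) y
  have hf : f ∈ codeSpace x₀ D E := by
    refine ⟨fun x hx => ?_, fun e he x => ?_⟩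
    · obtain ⟨y, hy, -⟩ := Finset.exists_ne_zero_of_sum_ne_zero hx
      obtain ⟨hyY, hyE⟩ := (Finset.mem_filter.1 hy).2
      have hsum : x + x₀ = T y + (x₀ + T y + x) := by
        rw [add_right_comm, add_comm (T y), add_add_cancel_of_zmod_two, add_comm]
      rw [hsum, hD]
      exact Submodule.add_mem_sup ⟨y, hyY, rfl⟩ hyE
    · simp only [f, ← add_assoc, E.add_mem_iff_left he]
  refine ⟨(Nat.card ↥(Y ⊓ E.comap T) : ℂ)⁻¹ • ⟨f, hf⟩, ?_⟩
  ext y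
  rw [map_smul, Submodule.coe_smul, PiLp.smul_apply, codePullback_apply, smul_eq_mul]
  by_cases hy : y ∈ Y
  · have hyE : x₀ + T y + (x₀ + T y) ∈ E := by
      rw [ZModModule.add_self]
      exact E.zero_mem
    have hconst : ∀ y', y' + y ∈ Y ⊓ E.comap T →
        (h : EuclideanSpace ℂ Y₀) y' = (h : EuclideanSpace ℂ Y₀) y := fun y' hy' => by
      rw [← h.2.2 _ hy' y, add_comm, add_add_cancel_of_zmod_two]
    rw [Set.indicator_of_mem (by exact hy)]
    simp only [f, mem_coset_iff_add_mem T hy hyE]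
    rw [Finset.sum_congr rfl fun y' hy' => hconst y' (Finset.mem_filter.1 hy').2,
      Finset.sum_const, card_filter_add_mem (Y ⊓ E.comap T), nsmul_eq_mul]
    exact inv_mul_cancel_left₀ (Nat.cast_ne_zero.2 Nat.card_pos.ne') _
  · rw [Set.indicator_of_notMem (by exact hy), mul_zero]
    by_contra h0
    exact hy (by simpa using h.2.1 y (Ne.symm h0))

theorem exists_codeSpace_equiv [Fintype V] [Fintype Y₀] (hD : D = Y.map T ⊔ E) :
    ∃ (e : codeSpace x₀ D E ≃ₗᵢ[ℂ] codeSpace (0 : Y₀) Y (Y ⊓ E.comap T)) (c : ℂ),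
      ∀ g, e g = c • codePullback T x₀ Y D E g := by
  have hE : (0 : ℝ) < Nat.card E := Nat.cast_pos.2 Nat.card_pos
  have hK : (0 : ℝ) < Nat.card ↥(Y ⊓ E.comap T) := Nat.cast_pos.2 Nat.card_pos
  let c : ℝ := √(Nat.card E / Nat.card ↥(Y ⊓ E.comap T))
  have hc : (c : ℂ) ≠ 0 := Complex.ofReal_ne_zero.2 (Real.sqrt_pos.2 (div_pos hE hK)).ne'
  let f : codeSpace x₀ D E →ₗᵢ[ℂ] codeSpace (0 : Y₀) Y (Y ⊓ E.comap T) :=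
    { toLinearMap := (c : ℂ) • codePullback T x₀ Y D E
      norm_map' := fun g => by
        rw [← sq_eq_sq₀ (norm_nonneg _) (norm_nonneg _), LinearMap.smul_apply, norm_smul, mul_pow,
          Complex.norm_real, Real.norm_eq_abs, sq_abs, Real.sq_sqrt (div_pos hE hK).le,
          div_mul_eq_mul_div, card_mul_norm_sq_codePullback T hD, mul_div_cancel_left₀ _ hK.ne'] }
  have hf : Function.Surjective f := fun h => by
    obtain ⟨g, hg⟩ := codePullback_surjective T hD ((c : ℂ)⁻¹ • h)
    exact ⟨g, by rw [← smul_inv_smul₀ hc h, ← hg]; rfl⟩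
  exact ⟨LinearIsometryEquiv.ofSurjective f hf, c, fun g => rfl⟩

/-- The translations that leave a function invariant. -/
def translationInvariants (g : V → ℂ) : Submodule (ZMod 2) V where
  carrier := {e | ∀ x, g (x + e) = g x}
  zero_mem' := by simp
  add_mem' := by
    intro e f he hf x
    rw [← add_assoc, hf, he]
  smul_mem' := by
    intro t e he x
    rcases zmod_two_eq_zero_or_one t with rfl | rfl
    · simp
    · simpa using he x

theorem mem_translationInvariants {g : V → ℂ} {e : V} :
    e ∈ translationInvariants g ↔ ∀ x, g (x + e) = g x := Iff.rfl

theorem mem_codeSpace_iff_le {g : EuclideanSpace ℂ V} :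
    g ∈ codeSpace x₀ D E ↔ (∀ x, g x ≠ 0 → x + x₀ ∈ D) ∧ E ≤ translationInvariants g := Iff.rfl

end CodeSpace

section PauliCodeSpace

variable {Q : Type*} [Fintype Q] [DecidableEq Q]

theorem stabSpace_one_eq_codeSpace {κ κ' : Type*} (z : κ → Bits Q) (x : κ' → Bits Q) :
    stabSpace z 1 x 1 =
      codeSpace 0 (symmetries z) (Submodule.span (ZMod 2) (Set.range x)) := by
  ext ψ
  rw [mem_stabSpace, mem_codeSpace_iff_le, Submodule.span_le]
  refine and_congr ?_ ?_
  · simp only [Pi.one_apply, pauliZ_eq_smul_iff]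
    refine ⟨fun h y hy k => ?_, fun h k y hy => ?_⟩
    · rw [add_zero, dotProduct_comm]
      exact bitSign_bijective.1 (h k y hy)
    · rw [dotProduct_comm, ← add_zero y, h y hy k, bitSign_zero]
  · rw [Set.range_subset_iff]
    refine forall_congr' fun k => ?_
    rw [pauliX_eq_smul_iff, SetLike.mem_coe, mem_translationInvariants]
    simp

variable {x₀ v : Bits Q} {D E : Submodule (ZMod 2) (Bits Q)} {ψ : Hilb Q}

theorem pauliX_mem_codeSpace (hv : v ∈ D) (hψ : ψ ∈ codeSpace x₀ D E) :
    pauliX v ψ ∈ codeSpace x₀ D E := by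
  refine ⟨fun x hx => ?_, fun e he x => ?_⟩
  · rw [pauliX_apply] at hx
    rw [← D.add_mem_iff_left hv, add_right_comm]
    exact hψ.1 _ hx
  · rw [pauliX_apply, pauliX_apply, add_right_comm, hψ.2 e he]

theorem pauliZ_mem_codeSpace (hv : ∀ x ∈ E, v ⬝ᵥ x = 0) (hψ : ψ ∈ codeSpace x₀ D E) :
    pauliZ v ψ ∈ codeSpace x₀ D E := by
  refine ⟨fun x hx => hψ.1 x (right_ne_zero_of_mul hx), fun e he x => ?_⟩
  rw [pauliZ_apply, pauliZ_apply, dotProduct_add, hv e he, add_zero, hψ.2 e he]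

end PauliCodeSpace

section Tensor

variable {Q : Type*} [Fintype Q] [DecidableEq Q]

/-- The tensor square of the Hilbert space in the computational basis. -/
def tensorFun (Q : Type*) [Fintype Q] [DecidableEq Q] :
    Hilb Q ⊗[ℂ] Hilb Q ≃ₗᵢ[ℂ] EuclideanSpace ℂ (Bits Q × Bits Q) :=
  ((EuclideanSpace.basisFun (Bits Q) ℂ).tensorProduct (EuclideanSpace.basisFun (Bits Q) ℂ)).repr

theorem tensorFun_tmul (φ ψ : Hilb Q) (y : Bits Q × Bits Q) :
    tensorFun Q (φ ⊗ₜ ψ) y = φ y.1 * ψ y.2 := by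
  rw [tensorFun, OrthonormalBasis.tensorProduct_repr_tmul_apply']
  simp [mul_comm]

theorem tensorFun_map_pauliX (a b : Bits Q) (ψ : Hilb Q ⊗[ℂ] Hilb Q) (y : Bits Q × Bits Q) :
    tensorFun Q (TensorProduct.map (pauliX a) (pauliX b) ψ) y = tensorFun Q ψ (y + (a, b)) := by
  induction ψ using TensorProduct.induction_on with
  | zero => simp
  | tmul u v => rw [TensorProduct.map_tmul, tensorFun_tmul, tensorFun_tmul]; rfl
  | add u v hu hv => simp only [map_add, PiLp.add_apply, hu, hv]

theorem tensorFun_map_pauliZ (a b : Bits Q) (ψ : Hilb Q ⊗[ℂ] Hilb Q) (y : Bits Q × Bits Q) :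
    tensorFun Q (TensorProduct.map (pauliZ a) (pauliZ b) ψ) y =
      sgn (bitSign (a ⬝ᵥ y.1 + b ⬝ᵥ y.2)) * tensorFun Q ψ y := by
  induction ψ using TensorProduct.induction_on with
  | zero => simp
  | tmul u v =>
    rw [TensorProduct.map_tmul, tensorFun_tmul, tensorFun_tmul, pauliZ_apply_eq_sgn,
      pauliZ_apply_eq_sgn, bitSign_add, sgn_mul]
    ring
  | add u v hu hv => simp only [map_add, PiLp.add_apply, hu, hv, mul_add]

variable {Y S : Submodule (ZMod 2) (Bits Q)}

open Classical in
/-- The sum over the translations in `S`, followed by restriction to `Y`: a multiple of the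
orthogonal projection onto `codeSpace 0 Y S` when `S ≤ Y`. -/
def codeSum (Y S : Submodule (ZMod 2) (Bits Q)) : Hilb Q →ₗ[ℂ] Hilb Q where
  toFun ψ := WithLp.toLp 2 fun x => if x ∈ Y then ∑ a : S, ψ (x + a) else 0
  map_add' φ ψ := by
    ext x
    by_cases hx : x ∈ Y <;> simp [hx, Finset.sum_add_distrib]
  map_smul' c ψ := by
    ext x
    by_cases hx : x ∈ Y <;> simp [hx, Finset.mul_sum]

open Classical in
theorem codeSum_apply (ψ : Hilb Q) (x : Bits Q) :
    codeSum Y S ψ x = if x ∈ Y then ∑ a : S, ψ (x + a) else 0 := rfl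

theorem codeSum_mem (hSY : S ≤ Y) (ψ : Hilb Q) : codeSum Y S ψ ∈ codeSpace 0 Y S := by
  classical
  refine ⟨fun x hx => ?_, fun e he x => ?_⟩
  · by_contra h
    rw [add_zero] at h
    exact hx (by rw [codeSum_apply, if_neg h])
  · rw [codeSum_apply, codeSum_apply, Y.add_mem_iff_left (hSY he)]
    congr 1
    exact Fintype.sum_equiv (Equiv.addLeft (⟨e, he⟩ : S)) _ _ fun a => by simp [add_assoc]

open Classical in
theorem tensorFun_map_codeSum (ψ : Hilb Q ⊗[ℂ] Hilb Q) (y : Bits Q × Bits Q) :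
    tensorFun Q (TensorProduct.map (codeSum Y S) (codeSum Y S) ψ) y =
      if y ∈ Y.prod Y then
        ∑ a : S, ∑ b : S, tensorFun Q ψ (y + ((a : Bits Q), (b : Bits Q)))
      else 0 := by
  induction ψ using TensorProduct.induction_on with
  | zero => simp
  | tmul u v =>
    simp only [TensorProduct.map_tmul, tensorFun_tmul, codeSum_apply, Submodule.mem_prod,
      Prod.fst_add, Prod.snd_add]
    by_cases h1 : y.1 ∈ Y <;> by_cases h2 : y.2 ∈ Y <;> simp [h1, h2, Finset.sum_mul_sum]
  | add u v hu hv =>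
    simp only [map_add, PiLp.add_apply, hu, hv, Finset.sum_add_distrib]
    split_ifs <;> simp

theorem map_codeSum_of_tensorFun_mem {ψ : Hilb Q ⊗[ℂ] Hilb Q}
    (hψ : tensorFun Q ψ ∈ codeSpace 0 (Y.prod Y) (S.prod S)) :
    TensorProduct.map (codeSum Y S) (codeSum Y S) ψ = ((Nat.card S : ℂ) * Nat.card S) • ψ := by
  classical
  apply (tensorFun Q).injective
  ext y
  rw [tensorFun_map_codeSum, map_smul, PiLp.smul_apply, smul_eq_mul]
  split_ifs with hy
  · have hinv : ∀ a b : S, tensorFun Q ψ (y + ((a : Bits Q), (b : Bits Q))) = tensorFun Q ψ y :=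
      fun a b => hψ.2 _ ⟨a.2, b.2⟩ y
    simp [hinv, mul_assoc]
  · by_contra h0
    exact hy (by simpa using hψ.1 y (right_ne_zero_of_mul (Ne.symm h0)))

theorem map_mem_range_mapIncl {k M : Type*} [CommSemiring k] [AddCommMonoid M] [Module k M]
    {W : Submodule k M} {p : M →ₗ[k] M} (hp : ∀ v, p v ∈ W) (ψ : M ⊗[k] M) :
    TensorProduct.map p p ψ ∈ LinearMap.range (TensorProduct.mapIncl W W) := by
  refine ⟨TensorProduct.map (p.codRestrict W hp) (p.codRestrict W hp) ψ, ?_⟩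
  rw [TensorProduct.mapIncl, ← LinearMap.comp_apply, ← TensorProduct.map_comp]
  rfl

theorem mem_range_mapIncl_codeSpace_iff (hSY : S ≤ Y) (ψ : Hilb Q ⊗[ℂ] Hilb Q) :
    ψ ∈ LinearMap.range (TensorProduct.mapIncl (codeSpace (0 : Bits Q) Y S) (codeSpace 0 Y S)) ↔
      tensorFun Q ψ ∈ codeSpace 0 (Y.prod Y) (S.prod S) := by
  constructor
  · rintro ⟨t, rfl⟩
    induction t using TensorProduct.induction_on with
    | zero => simp
    | tmul u v =>
      rw [TensorProduct.mapIncl, TensorProduct.map_tmul]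
      refine ⟨fun y hy => ?_, fun e he y => ?_⟩
      · rw [tensorFun_tmul] at hy
        exact ⟨by simpa using u.2.1 _ (left_ne_zero_of_mul hy),
          by simpa using v.2.1 _ (right_ne_zero_of_mul hy)⟩
      · rw [tensorFun_tmul, tensorFun_tmul]
        exact congrArg₂ _ (u.2.2 _ he.1 _) (v.2.2 _ he.2 _)
    | add u v hu hv =>
      rw [map_add, map_add]
      exact Submodule.add_mem _ hu hv
  · intro hψ
    have hmem := map_mem_range_mapIncl (codeSum_mem hSY) ψ
    rw [map_codeSum_of_tensorFun_mem hψ] at hmem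
    have hcard : (Nat.card S : ℂ) ≠ 0 := Nat.cast_ne_zero.2 Nat.card_pos.ne'
    exact (Submodule.smul_mem_iff _ (mul_ne_zero hcard hcard)).1 hmem

section TwoCopies

variable {N : Type*} [Fintype N] [DecidableEq N] {F : Submodule ℂ (Hilb Q ⊗[ℂ] Hilb Q)}
  {T : Bits Q × Bits Q →ₗ[ZMod 2] Bits N} {x₀ : Bits N} {D E : Submodule (ZMod 2) (Bits N)}
  {Y S : Submodule (ZMod 2) (Bits Q × Bits Q)} {e : codeSpace x₀ D E ≃ₗᵢ[ℂ] F} {c : ℂ}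

theorem exists_codeSpace_equiv_tensor (hF : ∀ ψ, ψ ∈ F ↔ tensorFun Q ψ ∈ codeSpace 0 Y S)
    (hD : D = Y.map T ⊔ E) (hS : Y ⊓ E.comap T = S) :
    ∃ (e : codeSpace x₀ D E ≃ₗᵢ[ℂ] F) (c : ℂ),
      ∀ g, tensorFun Q (e g) = c • codePullback T x₀ Y D E g := by
  subst hS
  obtain ⟨e, c, he⟩ := exists_codeSpace_equiv T hD
  have hmap : F.map ((tensorFun Q).toLinearEquiv : _ →ₗ[ℂ] _) =
      codeSpace 0 Y (Y ⊓ E.comap T) := by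
    ext g
    exact ⟨by rintro ⟨ψ, hψ, rfl⟩; exact (hF ψ).1 hψ,
      fun hg => ⟨(tensorFun Q).symm g, (hF _).2 (by simpa using hg), by simp⟩⟩
  obtain ⟨τ, hτ⟩ : ∃ τ : F ≃ₗᵢ[ℂ] codeSpace (0 : Bits Q × Bits Q) Y (Y ⊓ E.comap T),
      ∀ ψ, (τ ψ : EuclideanSpace ℂ (Bits Q × Bits Q)) = tensorFun Q ψ :=
    ⟨((tensorFun Q).submoduleMap F).trans (LinearIsometryEquiv.ofEq _ _ hmap), fun _ => rfl⟩
  refine ⟨e.trans τ.symm, c, fun g => ?_⟩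
  rw [← hτ, LinearIsometryEquiv.trans_apply, τ.apply_symm_apply, he, Submodule.coe_smul]

theorem carries_pauliX_of_codePullback (he : ∀ g, tensorFun Q (e g) = c • codePullback T x₀ Y D E g)
    (hD : D = Y.map T ⊔ E) {y : Bits Q × Bits Q} (hy : y ∈ Y) :
    Carries e (pauliX (T y)) (TensorProduct.map (pauliX y.1) (pauliX y.2)) := by
  classical
  intro g
  have hTy : T y ∈ D := hD ▸ Submodule.mem_sup_left ⟨y, hy, rfl⟩
  refine ⟨pauliX_mem_codeSpace hTy g.2, (tensorFun Q).injective ?_⟩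
  ext w
  have hwy : w + y ∈ Y ↔ w ∈ Y := Y.add_mem_iff_left hy
  rw [tensorFun_map_pauliX, he, he, PiLp.smul_apply, PiLp.smul_apply, codePullback_apply,
    codePullback_apply, Set.indicator_apply, Set.indicator_apply]
  simp only [Prod.mk.eta, SetLike.mem_coe, hwy, pauliX_apply, map_add, add_assoc]

theorem carries_pauliZ_of_codePullback (he : ∀ g, tensorFun Q (e g) = c • codePullback T x₀ Y D E g)
    {v : Bits N} {b b' : Bits Q} (hv : ∀ x ∈ E, v ⬝ᵥ x = 0)
    (hvT : ∀ y ∈ Y, v ⬝ᵥ T y = b ⬝ᵥ y.1 + b' ⬝ᵥ y.2) :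
    Carries e (pauliZ v) (sgn (bitSign (v ⬝ᵥ x₀)) • TensorProduct.map (pauliZ b) (pauliZ b')) := by
  classical
  intro g
  refine ⟨pauliZ_mem_codeSpace hv g.2, (tensorFun Q).injective ?_⟩
  ext w
  rw [LinearMap.smul_apply, map_smul, PiLp.smul_apply, tensorFun_map_pauliZ, he, he,
    PiLp.smul_apply, PiLp.smul_apply, codePullback_apply, codePullback_apply, Set.indicator_apply,
    Set.indicator_apply]
  split_ifs with hw
  · rw [pauliZ_apply_eq_sgn, dotProduct_add, hvT w hw, bitSign_add, sgn_mul]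
    simp only [smul_eq_mul]
    ring
  · simp

end TwoCopies

end Tensor

section Layers

variable {Q Q' : Type*} {K : ℕ}

/-- The restriction to an odd layer. -/
def oddPart (j : Fin (K + 2)) : Bits (Stack Q Q' K) →ₗ[ZMod 2] Bits Q where
  toFun x q := x (Sum.inl (j, q))
  map_add' _ _ := rfl
  map_smul' _ _ := rfl

/-- The restriction to an even layer. -/
def evenPart (j : Fin (K + 1)) : Bits (Stack Q Q' K) →ₗ[ZMod 2] Bits Q' where
  toFun x q := x (Sum.inr (j, q))
  map_add' _ _ := rfl
  map_smul' _ _ := rfl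

/-- `onOdd` as a linear map. -/
def onOddₗ (j : Fin (K + 2)) : Bits Q →ₗ[ZMod 2] Bits (Stack Q Q' K) where
  toFun := onOdd j
  map_add' a b := by
    ext (p | p)
    · simp only [onOdd, Sum.elim_inl, Pi.add_apply]; split_ifs <;> simp
    · simp [onOdd]
  map_smul' t a := by
    ext (p | p)
    · simp [onOdd]
    · simp [onOdd]

/-- `onEven` as a linear map. -/
def onEvenₗ (j : Fin (K + 1)) : Bits Q' →ₗ[ZMod 2] Bits (Stack Q Q' K) where
  toFun := onEven j
  map_add' a b := by
    ext (p | p)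
    · simp [onEven]
    · simp only [onEven, Sum.elim_inr, Pi.add_apply]; split_ifs <;> simp
  map_smul' t a := by
    ext (p | p)
    · simp [onEven]
    · simp [onEven]

theorem onOddₗ_apply (j : Fin (K + 2)) (a : Bits Q) :
    (onOddₗ j a : Bits (Stack Q Q' K)) = onOdd j a := rfl

theorem onEvenₗ_apply (j : Fin (K + 1)) (a : Bits Q') :
    (onEvenₗ j a : Bits (Stack Q Q' K)) = onEven j a := rfl

@[simp] theorem oddPart_onOdd (i j : Fin (K + 2)) (a : Bits Q) :
    oddPart i (onOdd j a : Bits (Stack Q Q' K)) = if i = j then a else 0 := by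
  ext q
  simp only [oddPart, onOdd, LinearMap.coe_mk, AddHom.coe_mk, Sum.elim_inl]
  split_ifs <;> simp

@[simp] theorem evenPart_onOdd (i : Fin (K + 1)) (j : Fin (K + 2)) (a : Bits Q) :
    evenPart i (onOdd j a : Bits (Stack Q Q' K)) = 0 := rfl

@[simp] theorem oddPart_onEven (i : Fin (K + 2)) (j : Fin (K + 1)) (a : Bits Q') :
    oddPart i (onEven j a : Bits (Stack Q Q' K)) = 0 := rfl

@[simp] theorem evenPart_onEven (i j : Fin (K + 1)) (a : Bits Q') :
    evenPart i (onEven j a : Bits (Stack Q Q' K)) = if i = j then a else 0 := by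
  ext q
  simp only [evenPart, onEven, LinearMap.coe_mk, AddHom.coe_mk, Sum.elim_inr]
  split_ifs <;> simp

theorem stack_ext {x y : Bits (Stack Q Q' K)} (h1 : ∀ j, oddPart j x = oddPart j y)
    (h2 : ∀ j, evenPart j x = evenPart j y) : x = y := by
  ext (⟨j, q⟩ | ⟨j, q⟩)
  · exact congrFun (h1 j) q
  · exact congrFun (h2 j) q

theorem stack_eq_sum (x : Bits (Stack Q Q' K)) :
    x = ∑ j, onOddₗ j (oddPart j x) + ∑ j, onEvenₗ j (evenPart j x) := by
  refine stack_ext (fun j => ?_) fun j => ?_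
  · simp [map_sum, onOddₗ_apply, onEvenₗ_apply]
  · simp [map_sum, onOddₗ_apply, onEvenₗ_apply]

theorem odd_layer_cases (i : Fin (K + 2)) :
    i = 0 ∨ i = Fin.last (K + 1) ∨ ∃ j : Fin K, i = j.succ.castSucc := by
  induction i using Fin.cases with
  | zero => exact Or.inl rfl
  | succ i =>
    induction i using Fin.lastCases with
    | last => exact Or.inr (Or.inl (Fin.succ_last _))
    | cast j => exact Or.inr (Or.inr ⟨j, Fin.succ_castSucc j⟩)

/-- The Pauli products whose restrictions to the layers belong to given groups. -/
def layerGroup (S : Submodule (ZMod 2) (Bits Q)) (S' : Submodule (ZMod 2) (Bits Q')) (K : ℕ) :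
    Submodule (ZMod 2) (Bits (Stack Q Q' K)) :=
  (⨅ j, S.comap (oddPart j)) ⊓ ⨅ j, S'.comap (evenPart j)

theorem mem_layerGroup {S : Submodule (ZMod 2) (Bits Q)} {S' : Submodule (ZMod 2) (Bits Q')}
    {x : Bits (Stack Q Q' K)} :
    x ∈ layerGroup S S' K ↔ (∀ j, oddPart j x ∈ S) ∧ ∀ j, evenPart j x ∈ S' := by
  simp [layerGroup, Submodule.mem_iInf]

theorem layerGroup_le {S : Submodule (ZMod 2) (Bits Q)} {S' : Submodule (ZMod 2) (Bits Q')}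
    {G : Submodule (ZMod 2) (Bits (Stack Q Q' K))} (hS : ∀ j, S ≤ G.comap (onOddₗ j))
    (hS' : ∀ j, S' ≤ G.comap (onEvenₗ j)) : layerGroup S S' K ≤ G := by
  intro x hx
  rw [mem_layerGroup] at hx
  rw [stack_eq_sum x]
  exact Submodule.add_mem _ (Submodule.sum_mem _ fun j _ => hS j (hx.1 j))
    (Submodule.sum_mem _ fun j _ => hS' j (hx.2 j))

/-- The placement of two Pauli products on the first and on the last layer. -/
def onEnds (Q Q' : Type*) (K : ℕ) : Bits Q × Bits Q →ₗ[ZMod 2] Bits (Stack Q Q' K) :=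
  LinearMap.coprod (onOddₗ 0) (onOddₗ (Fin.last (K + 1)))

theorem onEnds_apply (y : Bits Q × Bits Q) :
    onEnds Q Q' K y = onOdd 0 y.1 + onOdd (Fin.last (K + 1)) y.2 := rfl

theorem onEnds_left (a : Bits Q) : onEnds Q Q' K (a, 0) = onOdd 0 a := by
  simp [onEnds_apply, ← onOddₗ_apply]

theorem onEnds_right (a : Bits Q) : onEnds Q Q' K (0, a) = onOdd (Fin.last (K + 1)) a := by
  simp [onEnds_apply, ← onOddₗ_apply]

@[simp] theorem oddPart_zero_onEnds (y : Bits Q × Bits Q) :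
    oddPart 0 (onEnds Q Q' K y) = y.1 := by
  simp [onEnds_apply]

@[simp] theorem oddPart_last_onEnds (y : Bits Q × Bits Q) :
    oddPart (Fin.last (K + 1)) (onEnds Q Q' K y) = y.2 := by
  simp [onEnds_apply]

theorem oddPart_internal_onEnds (j : Fin K) (y : Bits Q × Bits Q) :
    oddPart j.succ.castSucc (onEnds Q Q' K y) = 0 := by
  have h1 : j.succ.castSucc ≠ 0 := by simp [Fin.ext_iff]
  have h2 : j.succ.castSucc ≠ Fin.last (K + 1) := (Fin.castSucc_lt_last _).ne
  simp only [onEnds_apply, map_add, oddPart_onOdd, if_neg h1, if_neg h2, add_zero]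

@[simp] theorem evenPart_onEnds (j : Fin (K + 1)) (y : Bits Q × Bits Q) :
    evenPart j (onEnds Q Q' K y) = 0 := by
  simp [onEnds_apply]

variable [Fintype Q] [Fintype Q']

@[simp] theorem onOdd_dotProduct (j : Fin (K + 2)) (b : Bits Q) (x : Bits (Stack Q Q' K)) :
    onOdd j b ⬝ᵥ x = b ⬝ᵥ oddPart j x := by
  simp [dotProduct, onOdd, oddPart, Fintype.sum_sum_type, Fintype.sum_prod_type]

@[simp] theorem onEven_dotProduct (j : Fin (K + 1)) (b : Bits Q') (x : Bits (Stack Q Q' K)) :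
    onEven j b ⬝ᵥ x = b ⬝ᵥ evenPart j x := by
  simp [dotProduct, onEven, evenPart, Fintype.sum_sum_type, Fintype.sum_prod_type]

@[simp] theorem dotProduct_onOdd (j : Fin (K + 2)) (b : Bits Q) (x : Bits (Stack Q Q' K)) :
    x ⬝ᵥ onOdd j b = oddPart j x ⬝ᵥ b := by
  rw [dotProduct_comm, onOdd_dotProduct, dotProduct_comm]

@[simp] theorem dotProduct_onEven (j : Fin (K + 1)) (b : Bits Q') (x : Bits (Stack Q Q' K)) :
    x ⬝ᵥ onEven j b = evenPart j x ⬝ᵥ b := by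
  rw [dotProduct_comm, onEven_dotProduct, dotProduct_comm]

end Layers

theorem mem_symmetries {Q ι : Type*} [Fintype Q] {T : ι → Bits Q} {b : Bits Q} :
    b ∈ symmetries T ↔ ∀ i, b ⬝ᵥ T i = 0 := Iff.rfl

theorem mem_span_range_iff_forall_symmetries {Q ι : Type*} [Fintype Q] {T : ι → Bits Q}
    {b : Bits Q} :
    b ∈ Submodule.span (ZMod 2) (Set.range T) ↔ ∀ y ∈ symmetries T, b ⬝ᵥ y = 0 := by
  simp only [mem_span_range_iff_dotProduct, mem_symmetries, dotProduct_comm (T _)]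

theorem IsNonlocalGenerators.span_sup_span_eq {Q ι : Type*} {n : ℕ}
    {S : Submodule (ZMod 2) (Bits Q)} {G : ι → Bits Q} {U : Fin n → Bits Q}
    (h : IsNonlocalGenerators S G U) (hG : ∀ k, G k ∈ S) :
    Submodule.span (ZMod 2) (Set.range G) ⊔ Submodule.span (ZMod 2) (Set.range U) = S :=
  le_antisymm (sup_le (Submodule.span_le.2 (Set.range_subset_iff.2 hG))
    (Submodule.span_le.2 (Set.range_subset_iff.2 h.mem))) h.maximal

namespace DualPair

variable {Q Q' A I ιr ιs ιρ ισ : Type*} [Fintype Q] [Fintype Q']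
variable (P : DualPair Q Q' A I ιr ιs ιρ ισ)

/-- The dual pair in which the two models change roles. So do Pauli `X` and Pauli `Z`, which makes
the transverse-field terms of the new model the `DZ` of the old one. -/
def swap : DualPair Q' Q I A ιρ ισ ιr ιs where
  OZ := P.DX
  OX := P.DZ
  DZ := P.OX
  DX := P.OZ
  dual i α := by rw [dotProduct_comm, ← P.dual, dotProduct_comm]
  GZ := P.ΓX
  GX := P.ΓZ
  ΓX := P.GZ
  ΓZ := P.GX
  GZ_mem := P.ΓX_mem
  GX_mem := P.ΓZ_mem
  ΓX_mem := P.GZ_mem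
  ΓZ_mem := P.GX_mem

theorem symX_le_symmetries_GZ : P.symX ≤ symmetries P.GZ :=
  fun _ ha r => ha.2 ⟨_, P.GZ_mem r⟩

theorem span_GX_le_symX : Submodule.span (ZMod 2) (Set.range P.GX) ≤ P.symX :=
  Submodule.span_le.2 (Set.range_subset_iff.2 P.GX_mem)

theorem span_ΓX_le_dualSymX : Submodule.span (ZMod 2) (Set.range P.ΓX) ≤ P.dualSymX :=
  Submodule.span_le.2 (Set.range_subset_iff.2 P.ΓX_mem)

/-- The pairs of `X`-type symmetries of the model that are equal up to local symmetries. -/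
def ficGroup : Submodule (ZMod 2) (Bits Q × Bits Q) :=
  P.symX.comap (LinearMap.fst _ _ _) ⊓ P.symX.comap (LinearMap.snd _ _ _) ⊓
    (Submodule.span (ZMod 2) (Set.range P.GX)).comap
      (LinearMap.fst (ZMod 2) (Bits Q) (Bits Q) + LinearMap.snd (ZMod 2) (Bits Q) (Bits Q))

theorem mem_ficGroup {y : Bits Q × Bits Q} : y ∈ P.ficGroup ↔
    (y.1 ∈ P.symX ∧ y.2 ∈ P.symX) ∧
      y.1 + y.2 ∈ Submodule.span (ZMod 2) (Set.range P.GX) := Iff.rfl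

/-- The pairs of `X`-type operators that commute with the local symmetries `GZ`. -/
def gaugePairs : Submodule (ZMod 2) (Bits Q × Bits Q) :=
  (symmetries P.GZ).prod (symmetries P.GZ)

section DualTerms

variable [Fintype A]

/-- Products of the Ising terms. -/
def prodOZ : (A → ZMod 2) →ₗ[ZMod 2] Bits Q := Fintype.linearCombination (ZMod 2) P.OZ

/-- Products of the duals of the Ising terms. -/
def prodDZ : (A → ZMod 2) →ₗ[ZMod 2] Bits Q' := Fintype.linearCombination (ZMod 2) P.DZ

end DualTerms

variable [Fintype I]

/-- Products of the transverse-field terms. -/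
def prodOX : (I → ZMod 2) →ₗ[ZMod 2] Bits Q := Fintype.linearCombination (ZMod 2) P.OX

/-- Products of the duals of the transverse-field terms. -/
def prodDX : (I → ZMod 2) →ₗ[ZMod 2] Bits Q' := Fintype.linearCombination (ZMod 2) P.DX

theorem prodOX_apply (u : I → ZMod 2) : P.prodOX u = ∑ i, u i • P.OX i := rfl

theorem prodDX_apply (u : I → ZMod 2) : P.prodDX u = ∑ i, u i • P.DX i := rfl

theorem dotProduct_prodDX (α : A) (u : I → ZMod 2) :
    P.DZ α ⬝ᵥ P.prodDX u = P.OZ α ⬝ᵥ P.prodOX u := by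
  simp [prodDX_apply, prodOX_apply, dotProduct_sum, dotProduct_smul, P.dual]

theorem prodOX_dotProduct_of_mem_symZ {b : Bits Q} (hb : b ∈ P.symZ) (u : I → ZMod 2) :
    P.prodOX u ⬝ᵥ b = 0 := by
  rw [prodOX_apply, sum_dotProduct]
  exact Finset.sum_eq_zero fun i _ => by
    rw [smul_dotProduct, dotProduct_comm, mem_symmetries.1 hb i, smul_zero]

theorem dotProduct_prodDX_of_mem_dualSymZ {b : Bits Q'} (hb : b ∈ P.dualSymZ) (u : I → ZMod 2) :
    b ⬝ᵥ P.prodDX u = 0 := by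
  rw [prodDX_apply, dotProduct_sum]
  exact Finset.sum_eq_zero fun i _ => by rw [dotProduct_smul, hb.1 i, smul_zero]

theorem prodOX_mem_symmetries_GZ (u : I → ZMod 2) : P.prodOX u ∈ symmetries P.GZ :=
  fun r => P.prodOX_dotProduct_of_mem_symZ (P.GZ_mem r) u

theorem exists_prodOX_eq {x : Bits Q} (h : ∀ b ∈ P.symZ, x ⬝ᵥ b = 0) : ∃ u, P.prodOX u = x := by
  have hx : x ∈ Submodule.span (ZMod 2) (Set.range P.OX) :=
    mem_span_range_iff_forall_symmetries.2 h
  rwa [← Fintype.range_linearCombination] at hx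

theorem exists_prodOX_eq_of_mem_symX {a : Bits Q} (ha : a ∈ P.symX) : ∃ u, P.prodOX u = a :=
  P.exists_prodOX_eq fun b hb => ha.2 ⟨b, hb⟩

theorem prodOX_mem_symX_iff (u : I → ZMod 2) : P.prodOX u ∈ P.symX ↔ P.prodDX u ∈ P.dualSymX := by
  have hdual : ∀ α, P.prodOX u ⬝ᵥ P.OZ α = P.prodDX u ⬝ᵥ P.DZ α := fun α => by
    rw [dotProduct_comm, ← P.dotProduct_prodDX, dotProduct_comm]
  exact ⟨fun h α => (hdual α).symm.trans (h.1 α), fun h =>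
    ⟨fun α => (hdual α).trans (h α), fun b => P.prodOX_dotProduct_of_mem_symZ b.2 u⟩⟩

theorem exists_add_prodDX_mem_dualSymX {y : Bits Q'} (h : ∀ b ∈ P.dualSymZ, b ⬝ᵥ y = 0) :
    ∃ u, y + P.prodDX u ∈ P.dualSymX := by
  have hy : y ∈ Submodule.span (ZMod 2)
      (Set.range (Sum.elim P.DX (Subtype.val : P.dualSymX → Bits Q'))) :=
    mem_span_range_iff_forall_symmetries.2 fun a ha => by
      rw [dotProduct_comm]
      exact h a ⟨fun i => ha (Sum.inl i), fun s => ha (Sum.inr s)⟩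
  rw [Set.Sum.elim_range, Submodule.span_union, Subtype.range_coe_subtype, Submodule.mem_sup] at hy
  obtain ⟨d, hd, s, hs, rfl⟩ := hy
  rw [← Fintype.range_linearCombination] at hd
  obtain ⟨u, rfl⟩ := hd
  refine ⟨u, ?_⟩
  change P.prodDX u + s + P.prodDX u ∈ _
  rw [add_comm (P.prodDX u), add_add_cancel_of_zmod_two]
  exact Submodule.span_le.2 (fun _ h => h) hs

/-! ### The stabilizer group -/

/-- Products of the suspensions `OX ΔX OX`. -/
def suspMap (K : ℕ) : (Fin (K + 1) → I → ZMod 2) →ₗ[ZMod 2] Bits (Stack Q Q' K) :=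
  ∑ j, (onOddₗ j.castSucc ∘ₗ P.prodOX + onEvenₗ j ∘ₗ P.prodDX + onOddₗ j.succ ∘ₗ P.prodOX) ∘ₗ
    LinearMap.proj j

variable {K : ℕ}

theorem suspMap_apply (u : Fin (K + 1) → I → ZMod 2) :
    P.suspMap K u = ∑ j, (onOdd j.castSucc (P.prodOX (u j)) + onEven j (P.prodDX (u j)) +
      onOdd j.succ (P.prodOX (u j))) := by
  simp [suspMap, LinearMap.sum_apply, onOddₗ_apply, onEvenₗ_apply]

theorem evenPart_suspMap (u : Fin (K + 1) → I → ZMod 2) (j : Fin (K + 1)) :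
    evenPart j (P.suspMap K u) = P.prodDX (u j) := by
  simp [suspMap_apply, map_sum]

theorem oddPart_zero_suspMap (u : Fin (K + 1) → I → ZMod 2) :
    oddPart 0 (P.suspMap K u) = P.prodOX (u 0) := by
  have hcast : ∀ j : Fin (K + 1), (0 : Fin (K + 2)) = j.castSucc ↔ 0 = j := fun j => by
    simp [Fin.ext_iff]
  have hsucc : ∀ j : Fin (K + 1), (0 : Fin (K + 2)) ≠ j.succ := fun j => (Fin.succ_ne_zero j).symm
  simp [suspMap_apply, map_sum, hcast, hsucc]

theorem oddPart_last_suspMap (u : Fin (K + 1) → I → ZMod 2) :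
    oddPart (Fin.last (K + 1)) (P.suspMap K u) = P.prodOX (u (Fin.last K)) := by
  have hcast : ∀ j : Fin (K + 1), Fin.last (K + 1) ≠ j.castSucc :=
    fun j => (Fin.castSucc_lt_last j).ne'
  have hsucc : ∀ j : Fin (K + 1), Fin.last (K + 1) = j.succ ↔ Fin.last K = j := fun j => by
    rw [← Fin.succ_last, Fin.succ_inj]
  simp [suspMap_apply, map_sum, hcast, hsucc]

theorem oddPart_internal_suspMap (u : Fin (K + 1) → I → ZMod 2) (j : Fin K) :
    oddPart j.succ.castSucc (P.suspMap K u) =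
      P.prodOX (u j.castSucc) + P.prodOX (u j.succ) := by
  have hcast : ∀ i : Fin (K + 1), j.succ.castSucc = i.castSucc ↔ j.succ = i :=
    fun i => Fin.castSucc_inj
  have hsucc : ∀ i : Fin (K + 1), j.succ.castSucc = i.succ ↔ j.castSucc = i := fun i => by
    rw [← Fin.succ_castSucc, Fin.succ_inj]
  simp only [suspMap_apply, map_sum, map_add, oddPart_onOdd, oddPart_onEven, add_zero,
    Finset.sum_add_distrib, hcast, hsucc, Finset.sum_ite_eq, Finset.mem_univ, if_true,
    Finset.sum_const_zero]
  rw [add_comm]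

theorem suspMap_single (j : Fin (K + 1)) (i : I) [DecidableEq I] :
    P.suspMap K (Pi.single j (Pi.single i 1)) = P.suspX K i j := by
  rw [suspMap_apply, Finset.sum_eq_single j]
  · simp [suspX, prodOX, prodDX]
  · intro j' _ hj'
    simp [Pi.single_eq_of_ne hj', ← onOddₗ_apply, ← onEvenₗ_apply]
  · simp

/-- The group generated by the suspensions `OX ΔX OX`, by `GX` on the odd layers, and by a group
on the even layers. -/
def suspGroup (K : ℕ) (Γ : Submodule (ZMod 2) (Bits Q')) :
    Submodule (ZMod 2) (Bits (Stack Q Q' K)) :=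
  LinearMap.range (P.suspMap K) ⊔ layerGroup (Submodule.span (ZMod 2) (Set.range P.GX)) Γ K

variable {Γ Γ' : Submodule (ZMod 2) (Bits Q')}

theorem mem_suspGroup {x : Bits (Stack Q Q' K)} :
    x ∈ P.suspGroup K Γ ↔ ∃ u,
      x + P.suspMap K u ∈ layerGroup (Submodule.span (ZMod 2) (Set.range P.GX)) Γ K := by
  rw [suspGroup, Submodule.mem_sup]
  constructor
  · rintro ⟨_, ⟨u, rfl⟩, y, hy, rfl⟩
    exact ⟨u, by rwa [add_comm (P.suspMap K u), add_add_cancel_of_zmod_two]⟩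
  · rintro ⟨u, hu⟩
    exact ⟨_, ⟨u, rfl⟩, _, hu, by rw [add_comm, add_add_cancel_of_zmod_two]⟩

theorem suspGroup_mono (h : Γ ≤ Γ') : P.suspGroup K Γ ≤ P.suspGroup K Γ' :=
  sup_le_sup_left (inf_le_inf_left _ (iInf_mono fun _ => Submodule.comap_mono h)) _

theorem onOdd_mem_suspGroup {a : Bits Q} (j : Fin (K + 2))
    (ha : a ∈ Submodule.span (ZMod 2) (Set.range P.GX)) : onOdd j a ∈ P.suspGroup K Γ := by
  refine Submodule.mem_sup_right (mem_layerGroup.2 ⟨fun i => ?_, fun _ => by simp⟩)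
  rw [oddPart_onOdd]
  split_ifs
  exacts [ha, Submodule.zero_mem _]

theorem onEven_mem_suspGroup {a : Bits Q'} (j : Fin (K + 1)) (ha : a ∈ Γ) :
    onEven j a ∈ P.suspGroup K Γ := by
  refine Submodule.mem_sup_right (mem_layerGroup.2 ⟨fun _ => by simp, fun i => ?_⟩)
  rw [evenPart_onEven]
  split_ifs
  exacts [ha, Submodule.zero_mem _]

theorem suspX_mem_suspGroup (i : I) (j : Fin (K + 1)) : P.suspX K i j ∈ P.suspGroup K Γ := by
  classical
  exact Submodule.mem_sup_left ⟨_, P.suspMap_single j i⟩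

theorem suspGroup_le {G : Submodule (ZMod 2) (Bits (Stack Q Q' K))}
    (hsusp : ∀ i j, P.suspX K i j ∈ G) (hGX : ∀ s j, onOdd j (P.GX s) ∈ G)
    (hΓ : ∀ j, ∀ a ∈ Γ, onEven j a ∈ G) : P.suspGroup K Γ ≤ G := by
  classical
  refine sup_le ?_ (layerGroup_le (fun j => ?_) hΓ)
  · rintro _ ⟨u, rfl⟩
    have hu : u = ∑ j, ∑ i, u j i • Pi.single j (Pi.single i 1) := by
      ext j' i'
      simp [Finset.sum_apply, Pi.single_apply, Finset.sum_ite_eq, ite_apply]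
    rw [hu]
    simp only [map_sum, map_smul, suspMap_single]
    exact Submodule.sum_mem _ fun j _ => Submodule.sum_mem _ fun i _ =>
      Submodule.smul_mem _ _ (hsusp i j)
  · rw [Submodule.span_le, Set.range_subset_iff]
    exact fun s => hGX s j

-- The product of all the suspensions of one string of terms is the string on both ends: on the
-- internal odd layers the two contributions cancel.
theorem onEnds_prodOX_mem_suspGroup {u : I → ZMod 2} (hu : P.prodDX u ∈ Γ) :
    onEnds Q Q' K (P.prodOX u, P.prodOX u) ∈ P.suspGroup K Γ := by
  refine (mem_suspGroup P).2 ⟨fun _ => u, mem_layerGroup.2 ⟨fun i => ?_, fun i => ?_⟩⟩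
  · have hcancel : oddPart i (onEnds Q Q' K (P.prodOX u, P.prodOX u)) =
        oddPart i (P.suspMap K fun _ => u) := by
      rcases odd_layer_cases i with rfl | rfl | ⟨j, rfl⟩
      · rw [oddPart_zero_onEnds, oddPart_zero_suspMap]
      · rw [oddPart_last_onEnds, oddPart_last_suspMap]
      · rw [oddPart_internal_onEnds, oddPart_internal_suspMap, ZModModule.add_self]
    rw [map_add, hcancel, ZModModule.add_self]
    exact Submodule.zero_mem _
  · rwa [map_add, evenPart_onEnds, evenPart_suspMap, zero_add]

theorem exists_of_onEnds_mem_suspGroup {y : Bits Q × Bits Q}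
    (hy : onEnds Q Q' K y ∈ P.suspGroup K Γ) :
    ∃ u v, P.prodDX u ∈ Γ ∧ P.prodDX v ∈ Γ ∧
      y.1 + P.prodOX u ∈ Submodule.span (ZMod 2) (Set.range P.GX) ∧
      y.2 + P.prodOX v ∈ Submodule.span (ZMod 2) (Set.range P.GX) ∧
      P.prodOX u + P.prodOX v ∈ Submodule.span (ZMod 2) (Set.range P.GX) := by
  obtain ⟨u, hu⟩ := (mem_suspGroup P).1 hy
  simp only [mem_layerGroup, map_add, evenPart_onEnds, evenPart_suspMap, zero_add] at hu
  obtain ⟨hodd, heven⟩ := hu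
  have hfirst := hodd 0
  have hlast := hodd (Fin.last (K + 1))
  rw [oddPart_zero_onEnds, oddPart_zero_suspMap] at hfirst
  rw [oddPart_last_onEnds, oddPart_last_suspMap] at hlast
  have hconst : ∀ j : Fin (K + 1), P.prodOX (u 0) + P.prodOX (u j) ∈
      Submodule.span (ZMod 2) (Set.range P.GX) := by
    intro j
    induction j using Fin.induction with
    | zero => rw [ZModModule.add_self]; exact Submodule.zero_mem _
    | succ j ih =>
      have hj := hodd j.succ.castSucc
      rw [oddPart_internal_onEnds, oddPart_internal_suspMap, zero_add] at hj
      simpa only [← add_assoc, add_add_cancel_of_zmod_two] using Submodule.add_mem _ ih hj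
  exact ⟨u 0, u (Fin.last K), heven _, heven _, hfirst, hlast, hconst _⟩

theorem gaugePairs_inf_comap_suspGroup_dualSymX :
    P.gaugePairs ⊓ (P.suspGroup K P.dualSymX).comap (onEnds Q Q' K) = P.ficGroup := by
  ext y
  rw [Submodule.mem_inf, mem_ficGroup]
  constructor
  · rintro ⟨-, hy⟩
    obtain ⟨u, v, hu, hv, hyu, hyv, huv⟩ := P.exists_of_onEnds_mem_suspGroup hy
    refine ⟨⟨?_, ?_⟩, ?_⟩
    · exact (Submodule.add_mem_iff_left _ ((P.prodOX_mem_symX_iff u).2 hu)).1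
        (P.span_GX_le_symX hyu)
    · exact (Submodule.add_mem_iff_left _ ((P.prodOX_mem_symX_iff v).2 hv)).1
        (P.span_GX_le_symX hyv)
    · refine (Submodule.add_mem_iff_left _ huv).1 ?_
      rw [add_add_add_comm]
      exact Submodule.add_mem _ hyu hyv
  · rintro ⟨⟨hy₁, hy₂⟩, hy⟩
    refine ⟨⟨P.symX_le_symmetries_GZ hy₁, P.symX_le_symmetries_GZ hy₂⟩, ?_⟩
    obtain ⟨u, hu⟩ := P.exists_prodOX_eq_of_mem_symX hy₁
    have hends : onEnds Q Q' K (y.1, y.1) ∈ P.suspGroup K P.dualSymX :=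
      hu ▸ P.onEnds_prodOX_mem_suspGroup ((P.prodOX_mem_symX_iff u).1 (hu ▸ hy₁))
    have hlast : onEnds Q Q' K (0, y.1 + y.2) ∈ P.suspGroup K P.dualSymX :=
      onEnds_right (Q' := Q') (K := K) (y.1 + y.2) ▸ P.onOdd_mem_suspGroup _ hy
    have hsum : y = (y.1, y.1) + (0, y.1 + y.2) := by
      ext1
      · simp
      · rw [Prod.snd_add, ← add_assoc, ZModModule.add_self, zero_add]
    rw [Submodule.mem_comap, hsum, map_add]
    exact Submodule.add_mem _ hends hlast

theorem gaugePairs_inf_comap_suspGroup_span_ΓX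
    (hX : ∀ u, P.prodDX u ∈ Submodule.span (ZMod 2) (Set.range P.ΓX) →
      P.prodOX u ∈ Submodule.span (ZMod 2) (Set.range P.GX)) :
    P.gaugePairs ⊓ (P.suspGroup K (Submodule.span (ZMod 2) (Set.range P.ΓX))).comap
      (onEnds Q Q' K) =
      (Submodule.span (ZMod 2) (Set.range P.GX)).prod
        (Submodule.span (ZMod 2) (Set.range P.GX)) := by
  ext y
  rw [Submodule.mem_inf, Submodule.mem_prod]
  constructor
  · rintro ⟨-, hy⟩
    obtain ⟨u, v, hu, hv, hyu, hyv, -⟩ := P.exists_of_onEnds_mem_suspGroup hy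
    exact ⟨(Submodule.add_mem_iff_left _ (hX u hu)).1 hyu,
      (Submodule.add_mem_iff_left _ (hX v hv)).1 hyv⟩
  · rintro ⟨hy₁, hy₂⟩
    exact ⟨⟨P.symX_le_symmetries_GZ (P.span_GX_le_symX hy₁),
      P.symX_le_symmetries_GZ (P.span_GX_le_symX hy₂)⟩,
      Submodule.add_mem _ (P.onOdd_mem_suspGroup _ hy₁) (P.onOdd_mem_suspGroup _ hy₂)⟩

end DualPair

/-! ### Locality -/

theorem map_mem_of_mem_span_image {R V W ι : Type*} [Semiring R] [AddCommMonoid V] [Module R V]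
    [AddCommMonoid W] [Module R W] {F : ι → V} {J : Set ι} {v : V}
    (hv : v ∈ Submodule.span R (F '' J)) (f : V →ₗ[R] W) {S : Submodule R W}
    (hS : ∀ i ∈ J, f (F i) ∈ S) : f v ∈ S :=
  (Submodule.span_le (p := S.comap f)).2 (Set.image_subset_iff.2 hS) hv

theorem exists_sum_smul_eq_of_mem_span_image {R V ι : Type*} [Ring R] [AddCommGroup V] [Module R V]
    [Fintype ι] {T : ι → V} {J : Set ι} {a : V} (ha : a ∈ Submodule.span R (T '' J)) :
    ∃ w : ι → R, ∑ i, w i • T i = a ∧ ∀ i, w i ≠ 0 → i ∈ J ∧ T i ≠ 0 := by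
  have himage : T '' J \ {0} = T '' {i | i ∈ J ∧ T i ≠ 0} := by
    ext v
    simp only [Set.mem_sdiff, Set.mem_image, Set.mem_singleton_iff, Set.mem_ofPred_eq]
    grind
  rw [← Submodule.span_sdiff_singleton_zero, himage,
    Finsupp.mem_span_image_iff_linearCombination] at ha
  obtain ⟨w, hw, rfl⟩ := ha
  refine ⟨w, ?_, fun i hi => hw (Finsupp.mem_support_iff.2 hi)⟩
  rw [Finsupp.linearCombination_apply, w.sum_fintype _ (by simp)]

section Locality

variable {M Q Q' I : Type*} [PseudoMetricSpace M]

theorem PauliVec.supp_mk_zero (a : Bits Q) : PauliVec.supp (a, 0) = GI.supp a := by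
  simp [PauliVec.supp, GI.supp]

theorem PauliVec.supp_swap (v : PauliVec Q) : PauliVec.supp v.swap = PauliVec.supp v :=
  Set.union_comm _ _

theorem LocallyGenerated.swap {pos : Q → M} {c : ℝ} {ι : Type*} {F : ι → PauliVec Q}
    {v : PauliVec Q} (h : LocallyGenerated pos c F v) :
    LocallyGenerated pos c (fun i => (F i).swap) v.swap := by
  obtain ⟨U, hvU, hU, hv⟩ := h
  refine ⟨U, by rwa [PauliVec.supp_swap], by rwa [PauliVec.supp_swap],
    map_mem_of_mem_span_image hv
      (LinearEquiv.prodComm (ZMod 2) (Bits Q) (Bits Q)).toLinearMap fun i hi => ?_⟩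
  exact Submodule.subset_span ⟨i, by rwa [Set.mem_ofPred_eq, PauliVec.supp_swap], rfl⟩

theorem IsCSLO.swap [Fintype Q] {pos : Q → M} {R c : ℝ} {ι : Type*} {F : ι → PauliVec Q}
    (h : IsCSLO pos R c F) : IsCSLO pos R c (fun i => (F i).swap) := fun v hv hcomm => by
  refine (h v.swap (by rwa [PauliVec.supp_swap]) fun i => ?_).swap
  rw [PauliVec.Commutes, add_comm, dotProduct_comm, dotProduct_comm v.swap.2]
  exact hcomm i

theorem diam_supp_sum_smul_le [Finite Q] [Finite Q'] [Fintype I] {pos : Q → M} {pos' : Q' → M}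
    {ℓ : ℝ} (hℓ : 0 ≤ ℓ) {T : I → Bits Q} {T' : I → Bits Q'}
    (hT : ∀ i, Metric.diam (pos '' supp (T i) ∪ pos' '' supp (T' i)) ≤ ℓ) {U : Set Q}
    {w : I → ZMod 2} (hw : ∀ i, w i ≠ 0 → supp (T i) ⊆ U ∧ T i ≠ 0) :
    Metric.diam (pos' '' supp (∑ i, w i • T' i)) ≤ Metric.diam (pos '' U) + 2 * ℓ := by
  have hbounded : ∀ s : Set Q, Bornology.IsBounded (pos '' s) :=
    fun s => (s.toFinite.image pos).isBounded
  have hbounded' : ∀ s : Set Q', Bornology.IsBounded (pos' '' s) :=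
    fun s => (s.toFinite.image pos').isBounded
  have hnear : ∀ q' ∈ supp (∑ i, w i • T' i), ∃ q ∈ U, dist (pos' q') (pos q) ≤ ℓ := by
    intro q' hq'
    obtain ⟨i, -, hi⟩ : ∃ i ∈ Finset.univ, (w i • T' i) q' ≠ 0 := by
      refine Finset.exists_ne_zero_of_sum_ne_zero ?_
      simpa [supp, Finset.sum_apply] using hq'
    obtain ⟨hiU, hTi⟩ := hw i (left_ne_zero_of_mul hi)
    obtain ⟨q, hq⟩ := Function.ne_iff.1 hTi
    exact ⟨q, hiU hq, (Metric.dist_le_diam_of_mem ((hbounded _).union (hbounded' _))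
      (Or.inr ⟨q', right_ne_zero_of_mul hi, rfl⟩) (Or.inl ⟨q, hq, rfl⟩)).trans (hT i)⟩
  refine Metric.diam_le_of_forall_dist_le (by positivity) ?_
  rintro _ ⟨q₁', hq₁', rfl⟩ _ ⟨q₂', hq₂', rfl⟩
  obtain ⟨q₁, hq₁, hdist₁⟩ := hnear q₁' hq₁'
  obtain ⟨q₂, hq₂, hdist₂⟩ := hnear q₂' hq₂'
  have hdiam := Metric.dist_le_diam_of_mem (hbounded U) ⟨q₁, hq₁, rfl⟩ ⟨q₂, hq₂, rfl⟩
  have htriangle := dist_triangle4 (pos' q₁') (pos q₁) (pos q₂) (pos' q₂')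
  rw [dist_comm (pos q₂)] at htriangle
  linarith

end Locality

namespace DualPair

variable {Q Q' A I ιr ιs ιρ ισ : Type*} [Fintype Q] [Fintype Q']
variable {P : DualPair Q Q' A I ιr ιs ιρ ισ}
variable {M : Type*} [PseudoMetricSpace M] {pos : Q → M} {pos' : Q' → M} {ℓ c R : ℝ}

theorem IsLocal.swap (hP : P.IsLocal pos pos' ℓ c R) : P.swap.IsLocal pos' pos ℓ c R where
  nonneg_ℓ := hP.nonneg_ℓ
  nonneg_c := hP.nonneg_c
  scale := hP.scale
  diam_Z i := by rw [Set.union_comm]; exact hP.diam_X i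
  diam_X α := by rw [Set.union_comm]; exact hP.diam_Z α
  diam_GZ := hP.diam_ΓX
  diam_GX := hP.diam_ΓZ
  diam_ΓX := hP.diam_GZ
  diam_ΓZ := hP.diam_GX
  cslo := by convert hP.dual_cslo.swap using 2 with k; cases k <;> rfl
  local_symX b hb hdiam := (hP.local_dualSymZ b hb hdiam).swap
  dual_cslo := by convert hP.cslo.swap using 2 with k; cases k <;> rfl
  local_dualSymZ a ha hdiam := (hP.local_symX a ha hdiam).swap

theorem IsLocal.exists_mem_span_OX (hP : P.IsLocal pos pos' ℓ c R) {a : Bits Q}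
    (ha : a ∈ symmetries P.GZ) (hdiam : Metric.diam (pos '' supp a) ≤ R) :
    ∃ U, Metric.diam (pos '' U) ≤ Metric.diam (pos '' supp a) + c ∧
      a ∈ Submodule.span (ZMod 2) (P.OX '' {i | supp (P.OX i) ⊆ U}) := by
  obtain ⟨U, -, hU, ha'⟩ := hP.cslo (a, 0) (by rwa [PauliVec.supp_mk_zero]) (by
    rintro (i | r)
    · simp [PauliVec.Commutes]
    · simpa [PauliVec.Commutes, dotProduct_comm] using ha r)
  rw [PauliVec.supp_mk_zero] at hU
  refine ⟨U, hU, map_mem_of_mem_span_image ha' (LinearMap.fst _ _ _) ?_⟩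
  rintro (i | r) hi
  · refine Submodule.subset_span ⟨i, ?_, rfl⟩
    rwa [Set.mem_ofPred_eq, Sum.elim_inl, PauliVec.supp_mk_zero] at hi
  · exact Submodule.zero_mem _

theorem IsLocal.mem_span_ΓX (hP : P.IsLocal pos pos' ℓ c R) {a : Bits Q'} (ha : a ∈ P.dualSymX)
    (hdiam : Metric.diam (pos' '' supp a) ≤ R) :
    a ∈ Submodule.span (ZMod 2) (Set.range P.ΓX) := by
  obtain ⟨U, -, -, ha'⟩ := hP.dual_cslo (a, 0) (by rwa [PauliVec.supp_mk_zero]) (by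
    rintro (α | ρ)
    · simpa [PauliVec.Commutes, dotProduct_comm] using ha α
    · simp [PauliVec.Commutes])
  refine map_mem_of_mem_span_image ha' (LinearMap.fst _ _ _) ?_
  rintro (α | ρ) -
  · exact Submodule.zero_mem _
  · exact Submodule.subset_span ⟨ρ, rfl⟩

theorem IsLocal.exists_prodOX_eq [Fintype I] (hP : P.IsLocal pos pos' ℓ c R) {a : Bits Q}
    (ha : a ∈ Submodule.span (ZMod 2) (Set.range P.GX)) :
    ∃ w, P.prodOX w = a ∧ P.prodDX w ∈ Submodule.span (ZMod 2) (Set.range P.ΓX) := by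
  suffices h : Submodule.span (ZMod 2) (Set.range P.GX) ≤
      ((Submodule.span (ZMod 2) (Set.range P.ΓX)).comap P.prodDX).map P.prodOX by
    obtain ⟨w, hw, hw'⟩ := h ha
    exact ⟨w, hw', hw⟩
  refine Submodule.span_le.2 (Set.range_subset_iff.2 fun s => ?_)
  have hscale := hP.scale
  have hℓ := hP.nonneg_ℓ
  have hc := hP.nonneg_c
  have hdiam := hP.diam_GX s
  obtain ⟨U, hU, hGX⟩ :=
    hP.exists_mem_span_OX (P.symX_le_symmetries_GZ (P.GX_mem s)) (by linarith)
  obtain ⟨w, hw, hwU⟩ := exists_sum_smul_eq_of_mem_span_image hGX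
  have hdual : P.prodDX w ∈ P.dualSymX := (P.prodOX_mem_symX_iff w).1 (by
    rw [prodOX_apply, hw]
    exact P.GX_mem s)
  refine ⟨w, hP.mem_span_ΓX hdual ?_, hw⟩
  have := diam_supp_sum_smul_le hℓ hP.diam_X hwU
  rw [prodDX_apply]
  linarith

theorem sum_smul_eq_sum_filter {V ι : Type*} [AddCommGroup V] [Module (ZMod 2) V] [Fintype ι]
    (T : ι → V) (w : ι → ZMod 2) :
    ∑ i, w i • T i = ∑ i ∈ Finset.univ.filter (fun i => w i ≠ 0), T i := by
  rw [Finset.sum_filter]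
  refine Finset.sum_congr rfl fun i _ => ?_
  rcases zmod_two_eq_zero_or_one (w i) with h | h <;> simp [h]

-- Dividing `P.prodOX u` by its local part leaves a product of the `UX k` whose dual is locally
-- trivial, hence an empty product.
theorem IsLocal.prodOX_mem_span_GX [Fintype I] (hP : P.IsLocal pos pos' ℓ c R) {n : ℕ}
    {UX : Fin n → Bits Q} (hUX : IsNonlocalGenerators P.symX P.GX UX)
    (h : ∀ N : Finset (Fin n), N.Nonempty → ∀ J, ¬ P.ChargeRelation UX N J) {u : I → ZMod 2}
    (hu : P.prodDX u ∈ Submodule.span (ZMod 2) (Set.range P.ΓX)) :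
    P.prodOX u ∈ Submodule.span (ZMod 2) (Set.range P.GX) := by
  obtain ⟨g, hg, v, hv, hgv⟩ := Submodule.mem_sup.1
    (hUX.maximal ((P.prodOX_mem_symX_iff u).2 (P.span_ΓX_le_dualSymX hu)))
  obtain ⟨w, rfl, hw⟩ := hP.exists_prodOX_eq hg
  rw [← Fintype.range_linearCombination] at hv
  obtain ⟨k, rfl⟩ := hv
  have hk : Fintype.linearCombination (ZMod 2) UX k = P.prodOX (w + u) := by
    rw [map_add, ← hgv, ← add_assoc, ZModModule.add_self, zero_add]
  have hwu : P.prodDX (w + u) ∈ Submodule.span (ZMod 2) (Set.range P.ΓX) := by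
    rw [map_add]
    exact Submodule.add_mem _ hw hu
  rw [Fintype.linearCombination_apply, prodOX_apply, sum_smul_eq_sum_filter,
    sum_smul_eq_sum_filter] at hk
  rw [prodDX_apply, sum_smul_eq_sum_filter] at hwu
  have hempty := Finset.not_nonempty_iff_eq_empty.1 fun hne => h _ hne _ ⟨hk, hwu⟩
  rw [← hgv, Fintype.linearCombination_apply, sum_smul_eq_sum_filter, hempty, Finset.sum_empty,
    add_zero]
  exact hg

theorem IsLocal.prodDZ_mem_span_ΓZ [Fintype A] (hP : P.IsLocal pos pos' ℓ c R) {n : ℕ}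
    {ΩZ : Fin n → Bits Q'} (hΩZ : IsNonlocalGenerators P.dualSymZ P.ΓZ ΩZ)
    (h : ∀ N : Finset (Fin n), N.Nonempty → ∀ S, ¬ P.BoundaryRelation ΩZ N S) {u : A → ZMod 2}
    (hu : P.prodOZ u ∈ Submodule.span (ZMod 2) (Set.range P.GZ)) :
    P.prodDZ u ∈ Submodule.span (ZMod 2) (Set.range P.ΓZ) :=
  hP.swap.prodOX_mem_span_GX hΩZ h hu

end DualPair

theorem sum_castSucc_add_succ {K : ℕ} {V : Type*} [AddCommGroup V] [Module (ZMod 2) V]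
    (f : Fin (K + 1) → V) : ∑ j : Fin K, (f j.castSucc + f j.succ) = f 0 + f (Fin.last K) := by
  induction K with
  | zero => simp [ZModModule.add_self]
  | succ K ih =>
    rw [Fin.sum_univ_castSucc]
    have := ih fun j => f j.castSucc
    simp only [Fin.succ_castSucc, Fin.castSucc_zero, Fin.succ_last] at this ⊢
    rw [this, add_assoc, ← add_assoc (f (Fin.last K).castSucc), ZModModule.add_self, zero_add]

theorem mem_of_castSucc_add_succ_mem {K : ℕ} {R V : Type*} [Ring R] [AddCommGroup V] [Module R V]
    {S : Submodule R V} {f : Fin (K + 1) → V}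
    (hf : ∀ j : Fin K, f j.castSucc + f j.succ ∈ S) {l : Fin (K + 1)} (hl : f l ∈ S)
    (j : Fin (K + 1)) : f j ∈ S := by
  have hzero : ∀ j, f j ∈ S ↔ f 0 ∈ S := by
    intro j
    induction j using Fin.induction with
    | zero => rfl
    | succ j ih =>
      rw [← ih]
      exact ⟨fun h => (Submodule.add_mem_iff_left _ h).1 (hf j),
        fun h => (Submodule.add_mem_iff_right _ h).1 (hf j)⟩
  exact (hzero j).2 ((hzero l).1 hl)

theorem sum_odd_layers {K : ℕ} {G : Type*} [AddCommMonoid G] (f : Fin (K + 2) → G) :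
    ∑ j, f j = f 0 + ∑ j : Fin K, f j.succ.castSucc + f (Fin.last (K + 1)) := by
  rw [Fin.sum_univ_castSucc, Fin.sum_univ_succ]
  rfl

theorem IsNonlocalGenerators.dotProduct_eq_zero {N ι : Type*} [Fintype N] {n : ℕ}
    {S : Submodule (ZMod 2) (Bits N)} {G : ι → Bits N} {U : Fin n → Bits N}
    (h : IsNonlocalGenerators S G U) {x : Bits N} (hG : x ∈ symmetries G)
    (hU : x ∈ symmetries U) {b : Bits N} (hb : b ∈ S) : b ⬝ᵥ x = 0 := by
  have hb' := h.maximal hb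
  rw [← Submodule.span_union, ← Set.Sum.elim_range] at hb'
  exact mem_span_range_iff_forall_symmetries.1 hb' x (Sum.rec hG hU)

namespace DualPair

variable {Q Q' A I ιr ιs ιρ ισ : Type*} [Fintype Q] [Fintype Q']
variable (P : DualPair Q Q' A I ιr ιs ιρ ισ)

/-! ### Bulk terms and sector labels -/

/-- The exponent vectors of the `Z`-type bulk terms. -/
def bulkZ (K : ℕ) : (A × Fin K) ⊕ (ιr × Fin (K + 2)) ⊕ (ισ × Fin (K + 1)) → Bits (Stack Q Q' K) :=
  Sum.elim (fun p => P.suspZ K p.1 p.2)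
    (Sum.elim (fun p => onOdd p.2 (P.GZ p.1)) (fun p => onEven p.2 (P.ΓZ p.1)))

/-- The exponent vectors of the `X`-type bulk terms. -/
def bulkX (K : ℕ) :
    (I × Fin (K + 1)) ⊕ (ιs × Fin (K + 2)) ⊕ (ιρ × Fin (K + 1)) → Bits (Stack Q Q' K) :=
  Sum.elim (fun p => P.suspX K p.1 p.2)
    (Sum.elim (fun p => onOdd p.2 (P.GX p.1)) (fun p => onEven p.2 (P.ΓX p.1)))

/-- The exponent vectors of the `Z`-type bulk terms and of the `Z`-type operators whose eigenvalues
label the sectors. -/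
def sectorZ {nZ mZ : ℕ} (UZ : Fin nZ → Bits Q) (ΩZ : Fin mZ → Bits Q') (K : ℕ) (l : Fin (K + 1)) :
    ((A × Fin K) ⊕ (ιr × Fin (K + 2)) ⊕ (ισ × Fin (K + 1))) ⊕ (Fin mZ ⊕ (Fin K × Fin nZ)) →
      Bits (Stack Q Q' K) :=
  Sum.elim (P.bulkZ K) (Sum.elim (fun k => onEven l (ΩZ k))
    (fun p => onOdd p.1.succ.castSucc (UZ p.2)))

/-- The exponent vectors of the `X`-type bulk terms and of the `X`-type operators whose eigenvalues
label the sectors. -/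
def sectorX {mX : ℕ} (ΩX : Fin mX → Bits Q') (K : ℕ) :
    ((I × Fin (K + 1)) ⊕ (ιs × Fin (K + 2)) ⊕ (ιρ × Fin (K + 1))) ⊕ (Fin (K + 1) × Fin mX) →
      Bits (Stack Q Q' K) :=
  Sum.elim (P.bulkX K) (fun p => onEven p.1 (ΩX p.2))

variable {P} {K nZ mZ : ℕ} {UZ : Fin nZ → Bits Q} {ΩZ : Fin mZ → Bits Q'} {l : Fin (K + 1)}

theorem mem_symmetries_bulkZ {x : Bits (Stack Q Q' K)} :
    x ∈ symmetries (P.bulkZ K) ↔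
      (∀ α (j : Fin K), P.DZ α ⬝ᵥ evenPart j.castSucc x +
        P.OZ α ⬝ᵥ oddPart j.succ.castSucc x + P.DZ α ⬝ᵥ evenPart j.succ x = 0) ∧
      (∀ j, oddPart j x ∈ symmetries P.GZ) ∧ ∀ j, evenPart j x ∈ symmetries P.ΓZ := by
  rw [mem_symmetries, Sum.forall, Sum.forall, Prod.forall, Prod.forall, Prod.forall]
  refine and_congr ?_ (and_congr ?_ ?_)
  · refine forall₂_congr fun α j => ?_
    simp [bulkZ, suspZ, dotProduct_add, dotProduct_comm]
  · rw [forall_comm]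
    simp [bulkZ, mem_symmetries]
  · rw [forall_comm]
    simp [bulkZ, mem_symmetries]

theorem mem_symmetries_sectorZ {x : Bits (Stack Q Q' K)} :
    x ∈ symmetries (P.sectorZ UZ ΩZ K l) ↔ x ∈ symmetries (P.bulkZ K) ∧
      evenPart l x ∈ symmetries ΩZ ∧ ∀ j : Fin K, oddPart j.succ.castSucc x ∈ symmetries UZ := by
  rw [mem_symmetries, Sum.forall]
  refine and_congr ?_ (Sum.forall.trans (and_congr ?_ ?_))
  · simp [sectorZ, mem_symmetries]
  · simp [sectorZ, mem_symmetries]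
  · rw [Prod.forall]
    refine forall₂_congr fun j k => ?_
    simp only [sectorZ, Sum.elim_inr, dotProduct_onOdd]

/-! ### Boundary terms -/

variable (P) (K) in
/-- The exponent vector of the Ising boundary term on the first two layers. -/
def firstZVec (α : A) : Bits (Stack Q Q' K) := onOdd 0 (P.OZ α) + onEven 0 (P.DZ α)

variable (P) (K) in
/-- The exponent vector of the Ising boundary term on the last two layers. -/
def lastZVec (α : A) : Bits (Stack Q Q' K) :=
  onEven (Fin.last K) (P.DZ α) + onOdd (Fin.last (K + 1)) (P.OZ α)

theorem firstZVec_dotProduct (α : A) (x : Bits (Stack Q Q' K)) :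
    P.firstZVec K α ⬝ᵥ x = P.OZ α ⬝ᵥ oddPart 0 x + P.DZ α ⬝ᵥ evenPart 0 x := by
  rw [firstZVec, add_dotProduct, onOdd_dotProduct, onEven_dotProduct]

theorem lastZVec_dotProduct (α : A) (x : Bits (Stack Q Q' K)) :
    P.lastZVec K α ⬝ᵥ x = P.OZ α ⬝ᵥ oddPart (Fin.last (K + 1)) x +
      P.DZ α ⬝ᵥ evenPart (Fin.last K) x := by
  rw [lastZVec, add_dotProduct, onOdd_dotProduct, onEven_dotProduct, add_comm]

theorem firstZVec_dotProduct_onEnds (y : Bits Q × Bits Q) (α : A) :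
    P.firstZVec K α ⬝ᵥ onEnds Q Q' K y = P.OZ α ⬝ᵥ y.1 := by
  simp [firstZVec_dotProduct]

theorem lastZVec_dotProduct_onEnds (y : Bits Q × Bits Q) (α : A) :
    P.lastZVec K α ⬝ᵥ onEnds Q Q' K y = P.OZ α ⬝ᵥ y.2 := by
  simp [lastZVec_dotProduct]

theorem onEnds_mem_symmetries_sectorZ {y : Bits Q × Bits Q} (hy : y ∈ P.gaugePairs) :
    onEnds Q Q' K y ∈ symmetries (P.sectorZ UZ ΩZ K l) := by
  refine mem_symmetries_sectorZ.2 ⟨mem_symmetries_bulkZ.2 ⟨fun α j => ?_, fun i => ?_, fun j => ?_⟩,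
    ?_, fun j => ?_⟩
  · rw [evenPart_onEnds, evenPart_onEnds, oddPart_internal_onEnds]
    simp
  · rcases odd_layer_cases i with rfl | rfl | ⟨j, rfl⟩
    · rw [oddPart_zero_onEnds]; exact hy.1
    · rw [oddPart_last_onEnds]; exact hy.2
    · rw [oddPart_internal_onEnds]; exact Submodule.zero_mem _
  · rw [evenPart_onEnds]; exact Submodule.zero_mem _
  · rw [evenPart_onEnds]; exact Submodule.zero_mem _
  · rw [oddPart_internal_onEnds]; exact Submodule.zero_mem _

-- The product of the Ising boundary terms at both ends and of all the suspensions of one index is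
-- the product of that Ising term over the odd layers.
theorem firstZVec_dotProduct_add_lastZVec_dotProduct {x : Bits (Stack Q Q' K)}
    (hx : x ∈ symmetries (P.bulkZ K)) (α : A) :
    P.firstZVec K α ⬝ᵥ x + P.lastZVec K α ⬝ᵥ x = P.OZ α ⬝ᵥ ∑ j, oddPart j x := by
  have hinternal : ∑ j : Fin K, P.OZ α ⬝ᵥ oddPart j.succ.castSucc x =
      P.DZ α ⬝ᵥ evenPart 0 x + P.DZ α ⬝ᵥ evenPart (Fin.last K) x := by
    rw [← sum_castSucc_add_succ (fun j => P.DZ α ⬝ᵥ evenPart j x)]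
    refine Finset.sum_congr rfl fun j _ => eq_of_add_eq_zero_of_zmod_two ?_
    rw [← (mem_symmetries_bulkZ.1 hx).1 α j]
    abel
  rw [dotProduct_sum, sum_odd_layers (fun j => P.OZ α ⬝ᵥ oddPart j x), hinternal,
    firstZVec_dotProduct, lastZVec_dotProduct]
  abel

theorem exists_mem_symmetries_GZ_dotProduct_eq [Fintype A]
    (hZ : ∀ u, P.prodOZ u ∈ Submodule.span (ZMod 2) (Set.range P.GZ) →
      P.prodDZ u ∈ Submodule.span (ZMod 2) (Set.range P.ΓZ))
    {y : Bits Q'} (hy : y ∈ symmetries P.ΓZ) :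
    ∃ a ∈ symmetries P.GZ, ∀ α, P.OZ α ⬝ᵥ a = P.DZ α ⬝ᵥ y := by
  have hDZ : ∀ u, P.prodOZ u ∈ Submodule.span (ZMod 2) (Set.range P.GZ) →
      P.prodDZ u ⬝ᵥ y = 0 := fun u hu =>
    mem_span_range_iff_forall_symmetries.1 (hZ u hu) y hy
  obtain ⟨a, ha⟩ := exists_dotProduct_eq P.OZ (fun α => P.DZ α ⬝ᵥ y) fun w hw => by
    rw [Finsupp.linearCombination_apply, w.sum_fintype _ (by simp)] at hw ⊢
    have := hDZ w (by rw [prodOZ, Fintype.linearCombination_apply, hw]; exact Submodule.zero_mem _)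
    simpa [prodDZ, Fintype.linearCombination_apply, sum_dotProduct, smul_dotProduct] using this
  have hOZ : ∀ u, P.prodOZ u ⬝ᵥ a = P.prodDZ u ⬝ᵥ y := fun u => by
    simp [prodOZ, prodDZ, Fintype.linearCombination_apply, sum_dotProduct, smul_dotProduct, ha]
  obtain ⟨a', ha', ha'G⟩ := exists_dotProduct_eq_on_of_inf
    (E := LinearMap.range P.prodOZ) (L := Submodule.span (ZMod 2) (Set.range P.GZ)) (w := a) (by
      rintro _ ⟨⟨u, rfl⟩, hu⟩
      rw [dotProduct_comm, hOZ, hDZ u hu])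
  refine ⟨a', fun r => ha'G _ (Submodule.subset_span ⟨r, rfl⟩), fun α => ?_⟩
  rw [dotProduct_comm, ha' _ (Fintype.range_linearCombination (ZMod 2) P.OZ ▸
    Submodule.subset_span ⟨α, rfl⟩), dotProduct_comm, ha]

theorem exists_add_onEnds_dotProduct_eq_zero [Fintype A]
    (hZ : ∀ u, P.prodOZ u ∈ Submodule.span (ZMod 2) (Set.range P.GZ) →
      P.prodDZ u ∈ Submodule.span (ZMod 2) (Set.range P.ΓZ))
    {x : Bits (Stack Q Q' K)} (hx : x ∈ symmetries (P.bulkZ K)) :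
    ∃ y ∈ P.gaugePairs, ∀ α, P.firstZVec K α ⬝ᵥ (x + onEnds Q Q' K y) = 0 ∧
      P.lastZVec K α ⬝ᵥ (x + onEnds Q Q' K y) = 0 := by
  obtain ⟨-, hodd, heven⟩ := mem_symmetries_bulkZ.1 hx
  obtain ⟨a, ha, ha'⟩ := exists_mem_symmetries_GZ_dotProduct_eq hZ (heven 0)
  obtain ⟨b, hb, hb'⟩ := exists_mem_symmetries_GZ_dotProduct_eq hZ (heven (Fin.last K))
  refine ⟨(oddPart 0 x + a, oddPart (Fin.last (K + 1)) x + b),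
    ⟨Submodule.add_mem _ (hodd _) ha, Submodule.add_mem _ (hodd _) hb⟩, fun α => ⟨?_, ?_⟩⟩
  · rw [dotProduct_add, firstZVec_dotProduct_onEnds, firstZVec_dotProduct, dotProduct_add, ha',
      ZModModule.add_self]
  · rw [dotProduct_add, lastZVec_dotProduct_onEnds, lastZVec_dotProduct, dotProduct_add, hb',
      ZModModule.add_self]

/-! ### Stabilizer groups of the bulk and of the sectors -/

variable [Fintype I]

theorem span_range_bulkX :
    Submodule.span (ZMod 2) (Set.range (P.bulkX K)) =
      P.suspGroup K (Submodule.span (ZMod 2) (Set.range P.ΓX)) := by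
  refine le_antisymm ?_ (P.suspGroup_le (fun i j => ?_) (fun s j => ?_) fun j => ?_)
  · rw [Submodule.span_le, Set.range_subset_iff]
    rintro (⟨i, j⟩ | ⟨s, j⟩ | ⟨ρ, j⟩)
    · exact P.suspX_mem_suspGroup i j
    · exact P.onOdd_mem_suspGroup j (Submodule.subset_span ⟨s, rfl⟩)
    · exact P.onEven_mem_suspGroup j (Submodule.subset_span ⟨ρ, rfl⟩)
  · exact Submodule.subset_span ⟨Sum.inl (i, j), rfl⟩
  · exact Submodule.subset_span ⟨Sum.inr (Sum.inl (s, j)), rfl⟩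
  · have h : Submodule.span (ZMod 2) (Set.range P.ΓX) ≤
        (Submodule.span (ZMod 2) (Set.range (P.bulkX K))).comap (onEvenₗ j) := by
      rw [Submodule.span_le, Set.range_subset_iff]
      exact fun ρ => Submodule.subset_span ⟨Sum.inr (Sum.inr (ρ, j)), rfl⟩
    exact fun a ha => h ha

theorem span_range_sectorX {mX : ℕ} {ΩX : Fin mX → Bits Q'}
    (hΩX : IsNonlocalGenerators P.dualSymX P.ΓX ΩX) :
    Submodule.span (ZMod 2) (Set.range (P.sectorX ΩX K)) = P.suspGroup K P.dualSymX := by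
  refine le_antisymm ?_ (P.suspGroup_le (fun i j => ?_) (fun s j => ?_) fun j => ?_)
  · rw [Submodule.span_le, Set.range_subset_iff]
    rintro ((⟨i, j⟩ | ⟨s, j⟩ | ⟨ρ, j⟩) | ⟨j, k⟩)
    · exact P.suspX_mem_suspGroup i j
    · exact P.onOdd_mem_suspGroup j (Submodule.subset_span ⟨s, rfl⟩)
    · exact P.onEven_mem_suspGroup j (P.ΓX_mem ρ)
    · exact P.onEven_mem_suspGroup j (hΩX.mem k)
  · exact Submodule.subset_span ⟨Sum.inl (Sum.inl (i, j)), rfl⟩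
  · exact Submodule.subset_span ⟨Sum.inl (Sum.inr (Sum.inl (s, j))), rfl⟩
  · have h : P.dualSymX ≤
        (Submodule.span (ZMod 2) (Set.range (P.sectorX ΩX K))).comap (onEvenₗ j) := by
      rw [← hΩX.span_sup_span_eq P.ΓX_mem]
      refine sup_le ?_ ?_
      · rw [Submodule.span_le, Set.range_subset_iff]
        exact fun ρ => Submodule.subset_span ⟨Sum.inl (Sum.inr (Sum.inr (ρ, j))), rfl⟩
      · rw [Submodule.span_le, Set.range_subset_iff]
        exact fun k => Submodule.subset_span ⟨Sum.inr (j, k), rfl⟩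
    exact fun a ha => h ha

theorem bulkX_mem_suspGroup (k) : P.bulkX K k ∈ P.suspGroup K P.dualSymX :=
  P.suspGroup_mono P.span_ΓX_le_dualSymX
    (span_range_bulkX (P := P) ▸ Submodule.subset_span ⟨k, rfl⟩)

theorem sectorX_mem_suspGroup {mX : ℕ} {ΩX : Fin mX → Bits Q'}
    (hΩX : IsNonlocalGenerators P.dualSymX P.ΓX ΩX) (k) :
    P.sectorX ΩX K k ∈ P.suspGroup K P.dualSymX :=
  span_range_sectorX (P := P) hΩX ▸ Submodule.subset_span ⟨k, rfl⟩

theorem exists_oddPart_suspMap (u : Fin (K + 1) → I → ZMod 2) (i : Fin (K + 2)) :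
    ∃ v, oddPart i (P.suspMap K u) = P.prodOX v := by
  rcases odd_layer_cases i with rfl | rfl | ⟨j, rfl⟩
  · exact ⟨_, P.oddPart_zero_suspMap u⟩
  · exact ⟨_, P.oddPart_last_suspMap u⟩
  · exact ⟨_, by rw [P.oddPart_internal_suspMap, ← map_add]⟩

theorem suspMap_mem_symmetries_sectorZ (hUZ : ∀ k, UZ k ∈ P.symZ) (hΩZ : ∀ k, ΩZ k ∈ P.dualSymZ)
    (u : Fin (K + 1) → I → ZMod 2) : P.suspMap K u ∈ symmetries (P.sectorZ UZ ΩZ K l) := by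
  refine mem_symmetries_sectorZ.2 ⟨mem_symmetries_bulkZ.2 ⟨fun α j => ?_, fun i r => ?_,
    fun j σ => ?_⟩, fun k => ?_, fun j k => ?_⟩
  · rw [evenPart_suspMap, evenPart_suspMap, oddPart_internal_suspMap, dotProduct_prodDX,
      dotProduct_prodDX, dotProduct_add, ← add_assoc, ZModModule.add_self, zero_add,
      ZModModule.add_self]
  · obtain ⟨v, hv⟩ := P.exists_oddPart_suspMap u i
    rw [hv]
    exact P.prodOX_dotProduct_of_mem_symZ (P.GZ_mem r) v
  · rw [evenPart_suspMap, dotProduct_comm]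
    exact P.dotProduct_prodDX_of_mem_dualSymZ (P.ΓZ_mem σ) _
  · rw [evenPart_suspMap, dotProduct_comm]
    exact P.dotProduct_prodDX_of_mem_dualSymZ (hΩZ k) _
  · obtain ⟨v, hv⟩ := P.exists_oddPart_suspMap u j.succ.castSucc
    rw [hv]
    exact P.prodOX_dotProduct_of_mem_symZ (hUZ k) v

theorem suspGroup_dualSymX_le (hUZ : ∀ k, UZ k ∈ P.symZ) (hΩZ : ∀ k, ΩZ k ∈ P.dualSymZ) :
    P.suspGroup K P.dualSymX ≤ symmetries (P.sectorZ UZ ΩZ K l) := by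
  refine sup_le ?_ fun x hx => ?_
  · rintro _ ⟨u, rfl⟩
    exact suspMap_mem_symmetries_sectorZ hUZ hΩZ u
  obtain ⟨hodd, heven⟩ := mem_layerGroup.1 hx
  have hsym : ∀ j, oddPart j x ∈ P.symX := fun j => P.span_GX_le_symX (hodd j)
  refine mem_symmetries_sectorZ.2 ⟨mem_symmetries_bulkZ.2 ⟨fun α j => ?_,
    fun i => P.symX_le_symmetries_GZ (hsym i), fun j σ => ?_⟩, fun k => ?_,
    fun j k => (hsym _).2 ⟨_, hUZ k⟩⟩
  · rw [dotProduct_comm, heven, dotProduct_comm, (hsym _).1, dotProduct_comm, heven]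
    simp
  · rw [dotProduct_comm]
    exact (P.ΓZ_mem σ).2 ⟨_, heven j⟩
  · rw [dotProduct_comm]
    exact (hΩZ k).2 ⟨_, heven l⟩

-- The commutation with the labels on the odd layers lets one find `u` up to a layer-independent
-- shift, the commutation with the labels on layer `l` fixes the shift, and the commutation with the
-- suspensions carries the result from layer `l` to the other even layers.
theorem exists_evenPart_add_prodDX_mem_dualSymX (hUZ : IsNonlocalGenerators P.symZ P.GZ UZ)
    (hΩZ : IsNonlocalGenerators P.dualSymZ P.ΓZ ΩZ) {x : Bits (Stack Q Q' K)}
    (hx : x ∈ symmetries (P.sectorZ UZ ΩZ K l)) :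
    ∃ u : Fin (K + 1) → I → ZMod 2,
      (∀ j : Fin K, P.prodOX (u j.castSucc) + P.prodOX (u j.succ) = oddPart j.succ.castSucc x) ∧
        ∀ j, evenPart j x + P.prodDX (u j) ∈ P.dualSymX := by
  obtain ⟨hbulk, hl, hint⟩ := mem_symmetries_sectorZ.1 hx
  obtain ⟨hsusp, hodd, heven⟩ := mem_symmetries_bulkZ.1 hbulk
  have hinternal : ∀ j : Fin K, ∃ v, P.prodOX v = oddPart j.succ.castSucc x := fun j =>
    P.exists_prodOX_eq fun b hb => by
      rw [dotProduct_comm]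
      exact hUZ.dotProduct_eq_zero (hodd _) (hint j) hb
  choose v hv using hinternal
  obtain ⟨w, hw⟩ : ∃ w : Fin (K + 1) → I → ZMod 2, ∀ j : Fin K, w j.succ = w j.castSucc + v j :=
    ⟨Fin.induction 0 fun j a => a + v j, fun j => Fin.induction_succ _ _ _⟩
  obtain ⟨shift, hshift⟩ := P.exists_add_prodDX_mem_dualSymX (y := evenPart l x + P.prodDX (w l))
    fun b hb => by
      rw [dotProduct_add, hΩZ.dotProduct_eq_zero (heven l) hl hb,
        P.dotProduct_prodDX_of_mem_dualSymZ hb, add_zero]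
  have hstep : ∀ j : Fin K, w j.castSucc + shift + (w j.succ + shift) = v j := fun j => by
    rw [add_add_add_comm, ZModModule.add_self, add_zero, hw, ← add_assoc, ZModModule.add_self,
      zero_add]
  refine ⟨fun j => w j + shift, fun j => by rw [← map_add, hstep, hv],
    mem_of_castSucc_add_succ_mem (fun j α => ?_) (by rwa [map_add, ← add_assoc])⟩
  rw [add_add_add_comm, ← map_add, hstep, dotProduct_comm, dotProduct_add, dotProduct_add,
    dotProduct_prodDX, hv, add_right_comm]
  exact hsusp α j

theorem symmetries_sectorZ (hUZ : IsNonlocalGenerators P.symZ P.GZ UZ)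
    (hΩZ : IsNonlocalGenerators P.dualSymZ P.ΓZ ΩZ) :
    symmetries (P.sectorZ UZ ΩZ K l) =
      P.gaugePairs.map (onEnds Q Q' K) ⊔ P.suspGroup K P.dualSymX := by
  refine le_antisymm (fun x hx => ?_) (sup_le ?_ (suspGroup_dualSymX_le hUZ.mem hΩZ.mem))
  swap
  · rintro _ ⟨y, hy, rfl⟩
    exact onEnds_mem_symmetries_sectorZ hy
  obtain ⟨u, hinternal, heven⟩ := exists_evenPart_add_prodDX_mem_dualSymX hUZ hΩZ hx
  have hodd := (mem_symmetries_bulkZ.1 (mem_symmetries_sectorZ.1 hx).1).2.1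
  let y : Bits Q × Bits Q := (oddPart 0 x + P.prodOX (u 0),
    oddPart (Fin.last (K + 1)) x + P.prodOX (u (Fin.last K)))
  have hy : y ∈ P.gaugePairs :=
    ⟨Submodule.add_mem _ (hodd _) (P.prodOX_mem_symmetries_GZ _),
      Submodule.add_mem _ (hodd _) (P.prodOX_mem_symmetries_GZ _)⟩
  rw [← add_add_cancel_of_zmod_two x (onEnds Q Q' K y), add_comm _ (onEnds Q Q' K y)]
  refine Submodule.add_mem_sup ⟨y, hy, rfl⟩ (P.mem_suspGroup.2 ⟨u, mem_layerGroup.2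
    ⟨fun i => ?_, fun j => ?_⟩⟩)
  · suffices oddPart i (x + onEnds Q Q' K y + P.suspMap K u) = 0 from
      this ▸ Submodule.zero_mem _
    rw [map_add, map_add]
    rcases odd_layer_cases i with rfl | rfl | ⟨j, rfl⟩
    · rw [oddPart_zero_onEnds, oddPart_zero_suspMap, add_right_comm, ZModModule.add_self]
    · rw [oddPart_last_onEnds, oddPart_last_suspMap, add_right_comm, ZModModule.add_self]
    · rw [oddPart_internal_onEnds, oddPart_internal_suspMap, add_zero, hinternal,
        ZModModule.add_self]
  · rw [map_add, map_add, evenPart_onEnds, add_zero, evenPart_suspMap]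
    exact heven j

theorem ZVec_dotProduct_of_mem_suspGroup {x : Bits (Stack Q Q' K)}
    (hx : x ∈ P.suspGroup K P.dualSymX) (α : A) :
    P.firstZVec K α ⬝ᵥ x = 0 ∧ P.lastZVec K α ⬝ᵥ x = 0 := by
  rw [firstZVec_dotProduct, lastZVec_dotProduct]
  obtain ⟨_, ⟨u, rfl⟩, z, hz, rfl⟩ := Submodule.mem_sup.1 hx
  rw [mem_layerGroup] at hz
  have hodd : ∀ j, P.OZ α ⬝ᵥ oddPart j z = 0 := fun j => by
    rw [dotProduct_comm]; exact (P.span_GX_le_symX (hz.1 j)).1 α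
  have heven : ∀ j, P.DZ α ⬝ᵥ evenPart j z = 0 := fun j => by
    rw [dotProduct_comm]; exact hz.2 j α
  simp only [map_add, oddPart_zero_suspMap, oddPart_last_suspMap, evenPart_suspMap,
    dotProduct_add, hodd, heven, dotProduct_prodDX, add_zero, ZModModule.add_self, and_self]

end DualPair

section StabSpace

variable {Q κ κ' : Type*} [Fintype Q] [DecidableEq Q] {z : κ → Bits Q} {s : κ → ℤˣ}
  {x : κ' → Bits Q} {s' : κ' → ℤˣ}

theorem exists_mem_stabSpace_pauliX_eq (hzx : ∀ k k', z k ⬝ᵥ x k' = 0)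
    (h : stabSpace z s x s' ≠ ⊥) {v : Bits Q} (hv : ∀ k, z k ⬝ᵥ v = 0)
    (hvx : v ∉ Submodule.span (ZMod 2) (Set.range x)) (u : ℤˣ) :
    ∃ ψ ∈ stabSpace z s x s', ψ ≠ 0 ∧ pauliX v ψ = sgn u • ψ := by
  obtain ⟨⟨a, ha⟩, ⟨b, hb⟩⟩ := exists_signs_of_stabSpace_ne_bot h
  obtain ⟨b', hb', hb'v⟩ : ∃ b', (∀ k, x k ⬝ᵥ b' = 0) ∧ v ⬝ᵥ b' = 1 := by
    rw [mem_span_range_iff_dotProduct] at hvx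
    push Not at hvx
    obtain ⟨b', hb', hne⟩ := hvx
    exact ⟨b', hb', (zmod_two_eq_zero_or_one _).resolve_left hne⟩
  obtain ⟨w, hw, hwv⟩ : ∃ w, (∀ k, bitSign (w ⬝ᵥ x k) = s' k) ∧ bitSign (w ⬝ᵥ v) = u := by
    by_cases hu : bitSign (b ⬝ᵥ v) = u
    · exact ⟨b, hb, hu⟩
    · refine ⟨b + b', fun k => ?_, ?_⟩
      · rw [add_dotProduct, dotProduct_comm b', hb', add_zero, hb]
      · rw [add_dotProduct, dotProduct_comm b', hb'v, bitSign_add, bitSign_one, mul_neg_one]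
        exact (Int.units_ne_iff_eq_neg.1 (Ne.symm hu)).symm
  have hne : stabSpace z s (Sum.elim x fun _ : Unit => v) (Sum.elim s' fun _ => u) ≠ ⊥ := by
    refine stabSpace_ne_bot (a := a) (b := w) ?_ ha (Sum.forall.2 ⟨hw, fun _ => hwv⟩)
    exact fun k => Sum.forall.2 ⟨hzx k, fun _ => hv k⟩
  obtain ⟨ψ, hψ, h0⟩ := Submodule.exists_mem_ne_zero_of_ne_bot hne
  obtain ⟨hz, hx⟩ := mem_stabSpace.1 hψ
  exact ⟨ψ, mem_stabSpace.2 ⟨hz, fun k => hx (Sum.inl k)⟩, h0, hx (Sum.inr ())⟩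

theorem isOrthogonalSum_stabSpace {μ μ' : Type*} [Finite μ] [Finite μ'] {u : μ → Bits Q}
    {v : μ' → Bits Q} (hux : ∀ k k', u k ⬝ᵥ x k' = 0) (hzv : ∀ k k', z k ⬝ᵥ v k' = 0)
    (huv : ∀ k k', u k ⬝ᵥ v k' = 0) :
    IsOrthogonalSum (stabSpace z s x s') fun t : μ ⊕ μ' → ℤˣ =>
      stabSpace (Sum.elim z u) (Sum.elim s fun k => t (Sum.inl k))
        (Sum.elim x v) (Sum.elim s' fun k => t (Sum.inr k)) := by
  have hXZ : ∀ k k' ψ, pauliX (v k') (pauliZ (u k) ψ) = pauliZ (u k) (pauliX (v k') ψ) :=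
    fun k k' ψ => by rw [pauliX_pauliZ, huv, bitSign_zero, sgn_one, one_smul]
  convert isOrthogonalSum_of_involutions (stabSpace z s x s')
    (Sum.elim (fun k => pauliZ (u k)) (fun k => pauliX (v k)))
    (Sum.forall.2 ⟨fun _ => norm_pauliZ _, fun _ => norm_pauliX _⟩)
    (Sum.forall.2 ⟨fun _ => pauliZ_pauliZ _, fun _ => pauliX_pauliX _⟩)
    (Sum.forall.2
      ⟨fun k => Sum.forall.2 ⟨fun _ => pauliZ_comm _ _, fun k' ψ => (hXZ k k' ψ).symm⟩,
        fun k' => Sum.forall.2 ⟨fun k => hXZ k k', fun _ => pauliX_comm _ _⟩⟩)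
    (Sum.forall.2 ⟨fun k _ hψ => pauliZ_mem_stabSpace (hux k) hψ,
      fun k' _ hψ => pauliX_mem_stabSpace (hzv · k') hψ⟩) using 2 with t
  ext ψ
  simp only [Submodule.mem_inf, mem_stabSpace, Submodule.mem_iInf, Module.End.mem_eigenspace_iff,
    Sum.forall, Sum.elim_inl, Sum.elim_inr]
  exact and_and_and_comm

end StabSpace

namespace DualPair

variable {Q Q' A I ιr ιs ιρ ισ : Type*} [Fintype Q] [Fintype Q']
variable {P : DualPair Q Q' A I ιr ιs ιρ ισ} {K : ℕ}

/-! ### Signs in the sectors -/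

section Signs

variable {nZ mX mZ : ℕ} {UZ : Fin nZ → Bits Q} {ΩX : Fin mX → Bits Q'}
  {ΩZ : Fin mZ → Bits Q'} {l : Fin (K + 1)}

/-- The eigenvalues in a sector of the `Z`-type operators `DualPair.sectorZ`. -/
def labelZ (A ιr ισ : Type*) (t : SectorLabel K nZ mX mZ) :
    ((A × Fin K) ⊕ (ιr × Fin (K + 2)) ⊕ (ισ × Fin (K + 1))) ⊕ (Fin mZ ⊕ (Fin K × Fin nZ)) → ℤˣ :=
  Sum.elim 1 (Sum.elim t.dualZ fun p => t.origZ p.1 p.2)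

/-- The eigenvalues in a sector of the `X`-type operators `DualPair.sectorX`. -/
def labelX (I ιs ιρ : Type*) (t : SectorLabel K nZ mX mZ) :
    ((I × Fin (K + 1)) ⊕ (ιs × Fin (K + 2)) ⊕ (ιρ × Fin (K + 1))) ⊕ (Fin (K + 1) × Fin mX) → ℤˣ :=
  Sum.elim 1 fun p => t.dualX p.1 p.2

theorem labelZ_trivial : labelZ A ιr ισ (SectorLabel.trivial K nZ mX mZ) = 1 := by
  funext k
  rcases k with k | k | k <;> rfl

theorem labelX_trivial : labelX I ιs ιρ (SectorLabel.trivial K nZ mX mZ) = 1 := by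
  funext k
  rcases k with k | k <;> rfl

theorem mem_symmetries_bulkZ_of_bitSign_eq {t : SectorLabel K nZ mX mZ} {x : Bits (Stack Q Q' K)}
    (hx : ∀ k, bitSign (P.sectorZ UZ ΩZ K l k ⬝ᵥ x) = labelZ A ιr ισ t k) :
    x ∈ symmetries (P.bulkZ K) := fun k => by
  rw [dotProduct_comm]
  exact bitSign_bijective.1 ((hx (Sum.inl k)).trans bitSign_zero.symm)

-- The two Ising boundary terms of each index differ on `x` by the product of that term over the
-- odd layers; acting with the product of the odd parts on the first layer removes the difference.
theorem exists_bitSign_sectorZ_eq {t : SectorLabel K nZ mX mZ} {x : Bits (Stack Q Q' K)}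
    (hx : ∀ k, bitSign (P.sectorZ UZ ΩZ K l k ⬝ᵥ x) = labelZ A ιr ισ t k) :
    ∃ a, (∀ k, bitSign (P.sectorZ UZ ΩZ K l k ⬝ᵥ a) = labelZ A ιr ισ t k) ∧
      ∀ α, P.firstZVec K α ⬝ᵥ a = P.lastZVec K α ⬝ᵥ a := by
  have hbulk := mem_symmetries_bulkZ_of_bitSign_eq hx
  have hsum : ∑ j, oddPart j x ∈ symmetries P.GZ :=
    Submodule.sum_mem _ fun j _ => (mem_symmetries_bulkZ.1 hbulk).2.1 j
  have hodd : (∑ j, oddPart j x, 0) ∈ P.gaugePairs := ⟨hsum, Submodule.zero_mem _⟩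
  refine ⟨x + onEnds Q Q' K (∑ j, oddPart j x, 0), fun k => ?_,
    fun α => eq_of_add_eq_zero_of_zmod_two ?_⟩
  · have hsymm := onEnds_mem_symmetries_sectorZ (UZ := UZ) (ΩZ := ΩZ) (l := l) hodd k
    rw [dotProduct_comm] at hsymm
    rw [dotProduct_add, hsymm, add_zero, hx]
  · rw [dotProduct_add, dotProduct_add, firstZVec_dotProduct_onEnds, lastZVec_dotProduct_onEnds,
      dotProduct_zero, add_zero, add_right_comm,
      firstZVec_dotProduct_add_lastZVec_dotProduct hbulk, ZModModule.add_self]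

theorem sectorZ_dotProduct_sectorX [Finite I] (hUZ : IsNonlocalGenerators P.symZ P.GZ UZ)
    (hΩX : IsNonlocalGenerators P.dualSymX P.ΓX ΩX)
    (hΩZ : IsNonlocalGenerators P.dualSymZ P.ΓZ ΩZ) (k k') :
    P.sectorZ UZ ΩZ K l k ⬝ᵥ P.sectorX ΩX K k' = 0 := by
  have := Fintype.ofFinite I
  rw [dotProduct_comm]
  exact suspGroup_dualSymX_le hUZ.mem hΩZ.mem (sectorX_mem_suspGroup hΩX k') k

theorem bulkZ_dotProduct_bulkX [Finite I] (k k') : P.bulkZ K k ⬝ᵥ P.bulkX K k' = 0 := by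
  have := Fintype.ofFinite I
  rw [dotProduct_comm]
  exact suspGroup_dualSymX_le (P := P) (UZ := Fin.elim0) (ΩZ := Fin.elim0) (l := 0)
    Fin.rec0 Fin.rec0 (bulkX_mem_suspGroup k') (Sum.inl k)

-- A product of transverse-field terms on the last layer lies in the sector's `X`-group only if it
-- is a product of local symmetries, on which all sectors have sign `+1`; so trivial signs on that
-- layer are compatible with any signs of the sector.
theorem exists_bitSign_sectorX_eq [Finite I]
    (hΩX : IsNonlocalGenerators P.dualSymX P.ΓX ΩX) {t : SectorLabel K nZ mX mZ}
    {w : Bits (Stack Q Q' K)}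
    (hw : ∀ k, bitSign (w ⬝ᵥ P.sectorX ΩX K k) = labelX I ιs ιρ t k) :
    ∃ b, (∀ k, bitSign (b ⬝ᵥ P.sectorX ΩX K k) = labelX I ιs ιρ t k) ∧
      ∀ i, b ⬝ᵥ onOdd (Fin.last (K + 1)) (P.OX i) = 0 := by
  classical
  have := Fintype.ofFinite I
  obtain ⟨b, hb, hlast⟩ := exists_dotProduct_eq_on_of_inf (E := P.suspGroup K P.dualSymX)
    (L := LinearMap.range (onOddₗ (Fin.last (K + 1)) ∘ₗ P.prodOX)) (w := w) (by
      rintro _ ⟨hE, ⟨u, rfl⟩⟩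
      have hfic : ((0, P.prodOX u) : Bits Q × Bits Q) ∈ P.ficGroup := by
        rw [← P.gaugePairs_inf_comap_suspGroup_dualSymX (K := K)]
        refine ⟨⟨Submodule.zero_mem _, P.prodOX_mem_symmetries_GZ u⟩, ?_⟩
        rw [SetLike.mem_coe, Submodule.mem_comap, onEnds_right]
        exact hE
      have hGX : P.prodOX u ∈ Submodule.span (ZMod 2) (Set.range P.GX) := by
        simpa using (P.mem_ficGroup.1 hfic).2
      rw [LinearMap.comp_apply, onOddₗ_apply, dotProduct_onOdd, dotProduct_comm]
      refine dotProduct_eq_zero_of_mem_span hGX (Set.forall_mem_range.2 fun s => ?_)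
      rw [dotProduct_comm, ← dotProduct_onOdd]
      exact bitSign_bijective.1 (hw (Sum.inl (Sum.inr (Sum.inl (s, Fin.last (K + 1)))))))
  refine ⟨b, fun k => ?_, fun i => hlast _ ⟨Pi.single i 1, ?_⟩⟩
  · rw [hb _ (sectorX_mem_suspGroup hΩX k), hw]
  · simp [prodOX, onOddₗ_apply]

end Signs

/-! ### Two copies of the model -/

section TwoCopies

theorem ficGroup_eq_sup_span {n : ℕ} {UX : Fin n → Bits Q}
    (hUX : IsNonlocalGenerators P.symX P.GX UX) :
    P.ficGroup = (Submodule.span (ZMod 2) (Set.range P.GX)).prod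
        (Submodule.span (ZMod 2) (Set.range P.GX)) ⊔
      Submodule.span (ZMod 2) (Set.range fun k => (UX k, UX k)) := by
  refine le_antisymm (fun y hy => ?_) (sup_le (fun y hy => ?_) ?_)
  · obtain ⟨⟨hy₁, -⟩, hy₁₂⟩ := P.mem_ficGroup.1 hy
    rw [← hUX.span_sup_span_eq P.GX_mem] at hy₁
    obtain ⟨g, hg, u, hu, hgu⟩ := Submodule.mem_sup.1 hy₁
    let diag : Bits Q →ₗ[ZMod 2] Bits Q × Bits Q := LinearMap.prod LinearMap.id LinearMap.id
    have hdiag : diag u ∈ Submodule.span (ZMod 2) (Set.range fun k => (UX k, UX k)) := by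
      rw [show (fun k => (UX k, UX k)) = diag ∘ UX from rfl, Set.range_comp, Submodule.span_image]
      exact Submodule.mem_map_of_mem hu
    have hy : y = (g, g + (y.1 + y.2)) + diag u := by
      refine Prod.ext hgu.symm ?_
      change y.2 = g + (y.1 + y.2) + u
      rw [add_right_comm, hgu, ← add_assoc, ZModModule.add_self, zero_add]
    rw [hy]
    exact Submodule.add_mem_sup ⟨hg, Submodule.add_mem _ hg hy₁₂⟩ hdiag
  · exact P.mem_ficGroup.2 ⟨⟨P.span_GX_le_symX hy.1, P.span_GX_le_symX hy.2⟩,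
      Submodule.add_mem _ hy.1 hy.2⟩
  · rw [Submodule.span_le, Set.range_subset_iff]
    refine fun k => P.mem_ficGroup.2 ⟨⟨hUX.mem k, hUX.mem k⟩, ?_⟩
    rw [ZModModule.add_self]
    exact Submodule.zero_mem _

theorem OX_mem_symmetries_GZ (i : I) : P.OX i ∈ symmetries P.GZ := fun r => by
  rw [dotProduct_comm]
  exact P.GZ_mem r i

variable [DecidableEq Q]

theorem gaugeSpace_eq_stabSpace : P.gaugeSpace = stabSpace P.GZ 1 P.GX 1 := by
  simp [gaugeSpace, stabSpace]

theorem mem_twoCopies_iff {ψ : Hilb Q ⊗[ℂ] Hilb Q} :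
    ψ ∈ P.twoCopies ↔ tensorFun Q ψ ∈ codeSpace 0 P.gaugePairs
      ((Submodule.span (ZMod 2) (Set.range P.GX)).prod
        (Submodule.span (ZMod 2) (Set.range P.GX))) := by
  rw [twoCopies, gaugeSpace_eq_stabSpace, stabSpace_one_eq_codeSpace,
    mem_range_mapIncl_codeSpace_iff (P.span_GX_le_symX.trans P.symX_le_symmetries_GZ)]
  rfl

theorem map_pauliX_eq_self_iff (y : Bits Q × Bits Q) {ψ : Hilb Q ⊗[ℂ] Hilb Q} :
    TensorProduct.map (pauliX y.1) (pauliX y.2) ψ = ψ ↔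
      y ∈ translationInvariants (tensorFun Q ψ) := by
  rw [mem_translationInvariants, ← (tensorFun Q).injective.eq_iff, PiLp.ext_iff]
  simp only [tensorFun_map_pauliX]

theorem mem_ficSpace_iff {n : ℕ} {UX : Fin n → Bits Q}
    (hUX : IsNonlocalGenerators P.symX P.GX UX) {ψ : Hilb Q ⊗[ℂ] Hilb Q} :
    ψ ∈ P.ficSpace UX ↔ tensorFun Q ψ ∈ codeSpace 0 P.gaugePairs P.ficGroup := by
  rw [ficGroup_eq_sup_span hUX, mem_codeSpace_iff_le, sup_le_iff, Submodule.span_le,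
    Set.range_subset_iff, ← and_assoc, ← mem_codeSpace_iff_le, ← mem_twoCopies_iff]
  simp only [ficSpace, Submodule.mem_inf, Submodule.mem_iInf, Module.End.mem_eigenspace_iff,
    one_smul, SetLike.mem_coe, ← map_pauliX_eq_self_iff]

variable [DecidableEq Q']

theorem isTwoCopies_codeSpace [Fintype I] {F : Submodule ℂ (Hilb Q ⊗[ℂ] Hilb Q)}
    {S : Submodule (ZMod 2) (Bits Q × Bits Q)}
    (hF : ∀ ψ, ψ ∈ F ↔ tensorFun Q ψ ∈ codeSpace 0 P.gaugePairs S)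
    {x₀ : Bits (Stack Q Q' K)} {D E : Submodule (ZMod 2) (Bits (Stack Q Q' K))}
    (hD : D = P.gaugePairs.map (onEnds Q Q' K) ⊔ E)
    (hS : P.gaugePairs ⊓ E.comap (onEnds Q Q' K) = S)
    (hE : E ≤ P.suspGroup K P.dualSymX)
    (hx₀ : ∀ α, P.firstZVec K α ⬝ᵥ x₀ = 0 ∧ P.lastZVec K α ⬝ᵥ x₀ = 0) :
    P.IsTwoCopies K (codeSpace x₀ D E) F 1 1 1 1 := by
  obtain ⟨e, c, he⟩ := exists_codeSpace_equiv_tensor (x₀ := x₀) hF hD hS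
  have hZ (α : A) {x} (hx : x ∈ E) := ZVec_dotProduct_of_mem_suspGroup (hE hx) α
  refine ⟨e, fun i => ?_, fun i => ?_, fun α => ?_, fun α => ?_⟩
  · simpa [firstX, onEnds_left] using carries_pauliX_of_codePullback he hD
      (y := (P.OX i, 0)) ⟨OX_mem_symmetries_GZ i, Submodule.zero_mem _⟩
  · simpa [lastX, onEnds_right] using carries_pauliX_of_codePullback he hD
      (y := (0, P.OX i)) ⟨Submodule.zero_mem _, OX_mem_symmetries_GZ i⟩
  · have h := carries_pauliZ_of_codePullback he (v := P.firstZVec K α) (b := P.OZ α) (b' := 0)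
      (fun x hx => (hZ α hx).1)
      (fun y _ => by rw [firstZVec_dotProduct_onEnds, zero_dotProduct, add_zero])
    rwa [(hx₀ α).1, bitSign_zero, pauliZ_zero] at h
  · have h := carries_pauliZ_of_codePullback he (v := P.lastZVec K α) (b := 0) (b' := P.OZ α)
      (fun x hx => (hZ α hx).2)
      (fun y _ => by rw [lastZVec_dotProduct_onEnds, zero_dotProduct, zero_add])
    rwa [(hx₀ α).2, bitSign_zero, pauliZ_zero] at h

theorem IsTwoCopies.of_stabSpace_one {κ κ' : Type*} {z : κ → Bits (Stack Q Q' K)} {s : κ → ℤˣ}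
    {x : κ' → Bits (Stack Q Q' K)} {s' : κ' → ℤˣ} {F : Submodule ℂ (Hilb Q ⊗[ℂ] Hilb Q)}
    (h : P.IsTwoCopies K (stabSpace z 1 x 1) F 1 1 1 1)
    {a b : Bits (Stack Q Q' K)} (ha : ∀ k, bitSign (z k ⬝ᵥ a) = s k)
    (hb : ∀ k, bitSign (b ⬝ᵥ x k) = s' k)
    (hfirstX : ∀ i k, z k ⬝ᵥ onOdd 0 (P.OX i) = 0)
    (hlastX : ∀ i k, z k ⬝ᵥ onOdd (Fin.last (K + 1)) (P.OX i) = 0)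
    (hfirstZ : ∀ α k, P.firstZVec K α ⬝ᵥ x k = 0) (hlastZ : ∀ α k, P.lastZVec K α ⬝ᵥ x k = 0) :
    P.IsTwoCopies K (stabSpace z s x s') F (fun i => bitSign (b ⬝ᵥ onOdd 0 (P.OX i)))
      (fun i => bitSign (b ⬝ᵥ onOdd (Fin.last (K + 1)) (P.OX i)))
      (fun α => bitSign (P.firstZVec K α ⬝ᵥ a)) (fun α => bitSign (P.lastZVec K α ⬝ᵥ a)) := by
  obtain ⟨e, hX, hX', hZ, hZ'⟩ := h
  simp only [Pi.one_apply, sgn_one, one_smul] at hX hX' hZ hZ'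
  exact ⟨(stabSpaceEquiv ha hb).trans e,
    fun i => (carries_stabSpaceEquiv_pauliX ha hb (hfirstX i)).trans ((hX i).smul _),
    fun i => (carries_stabSpaceEquiv_pauliX ha hb (hlastX i)).trans ((hX' i).smul _),
    fun α => (carries_stabSpaceEquiv_pauliZ ha hb (hfirstZ α)).trans ((hZ α).smul _),
    fun α => (carries_stabSpaceEquiv_pauliZ ha hb (hlastZ α)).trans ((hZ' α).smul _)⟩

end TwoCopies

/-! ### The boundary space and its sectors -/

section Sectors

variable [DecidableEq Q] [DecidableEq Q'] [Fintype A] [Fintype I] [Fintype ιr] [Fintype ιs]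
  [Fintype ιρ] [Fintype ισ] {nZ nX mX mZ : ℕ} {UZ : Fin nZ → Bits Q} {UX : Fin nX → Bits Q}
  {ΩX : Fin mX → Bits Q'} {ΩZ : Fin mZ → Bits Q'} {l : Fin (K + 1)}

theorem bdrySpace_eq_stabSpace :
    P.bdrySpace K = stabSpace (P.bulkZ K) 1 (P.bulkX K) 1 := by
  obtain ⟨ψ₀, hψ₀, h0⟩ := Submodule.exists_mem_ne_zero_of_ne_bot
    (stabSpace_one_ne_bot (bulkZ_dotProduct_bulkX (P := P) (K := K)))
  let T := Sum.elim (fun k => pauliZ (P.bulkZ K k)) (fun k => pauliX (P.bulkX K k))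
  have hT : P.bulkHamiltonian K = -∑ k, T k := by
    simp only [T, Fintype.sum_sum_type, Sum.elim_inl, Sum.elim_inr, bulkHamiltonian, bulkZ, bulkX,
      Fintype.sum_prod_type]
    abel
  have hmem (ψ) : ψ ∈ stabSpace (P.bulkZ K) 1 (P.bulkX K) 1 ↔ ∀ k, T k ψ = ψ := by
    rw [mem_stabSpace, Sum.forall]
    simp [T]
  have hnorm : ∀ k ψ, ‖T k ψ‖ = ‖ψ‖ :=
    Sum.forall.2 ⟨fun _ => norm_pauliZ _, fun _ => norm_pauliX _⟩
  ext ψ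
  rw [hmem, bdrySpace, hT, mem_groundSpace_neg_sum_iff hnorm h0 ((hmem ψ₀).1 hψ₀)]

theorem bdrySpace_eq_codeSpace :
    P.bdrySpace K = codeSpace 0 (symmetries (P.bulkZ K))
      (P.suspGroup K (Submodule.span (ZMod 2) (Set.range P.ΓX))) := by
  rw [bdrySpace_eq_stabSpace, stabSpace_one_eq_codeSpace, span_range_bulkX]

theorem sector_eq_stabSpace (t : SectorLabel K nZ mX mZ) :
    P.sector UZ ΩX ΩZ K l t =
      stabSpace (P.sectorZ UZ ΩZ K l) (labelZ A ιr ισ t) (P.sectorX ΩX K) (labelX I ιs ιρ t) := by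
  ext ψ
  rw [sector, bdrySpace_eq_stabSpace]
  simp only [Submodule.mem_inf, mem_stabSpace, Submodule.mem_iInf, Module.End.mem_eigenspace_iff,
    sectorZ, sectorX, labelZ, labelX]
  constructor
  · rintro ⟨⟨⟨⟨hZ, hX⟩, hdualZ⟩, horigZ⟩, hdualX⟩
    exact ⟨Sum.forall.2 ⟨hZ, Sum.forall.2 ⟨hdualZ, fun p => horigZ p.1 p.2⟩⟩,
      Sum.forall.2 ⟨hX, fun p => hdualX p.1 p.2⟩⟩
  · rintro ⟨hZ, hX⟩
    exact ⟨⟨⟨⟨fun k => hZ (Sum.inl k), fun k => hX (Sum.inl k)⟩, fun k => hZ (Sum.inr (Sum.inl k))⟩,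
      fun j k => hZ (Sum.inr (Sum.inr (j, k)))⟩, fun j k => hX (Sum.inr (j, k))⟩

theorem sector_trivial_eq_stabSpace :
    P.sector UZ ΩX ΩZ K l (SectorLabel.trivial K nZ mX mZ) =
      stabSpace (P.sectorZ UZ ΩZ K l) 1 (P.sectorX ΩX K) 1 := by
  rw [sector_eq_stabSpace, labelZ_trivial, labelX_trivial]

theorem sector_trivial_ne_bot (hUZ : IsNonlocalGenerators P.symZ P.GZ UZ)
    (hΩX : IsNonlocalGenerators P.dualSymX P.ΓX ΩX)
    (hΩZ : IsNonlocalGenerators P.dualSymZ P.ΓZ ΩZ) :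
    P.sector UZ ΩX ΩZ K l (SectorLabel.trivial K nZ mX mZ) ≠ ⊥ := by
  rw [sector_trivial_eq_stabSpace]
  exact stabSpace_one_ne_bot (sectorZ_dotProduct_sectorX hUZ hΩX hΩZ)

theorem isTwoCopies_sector_trivial (hUZ : IsNonlocalGenerators P.symZ P.GZ UZ)
    (hUX : IsNonlocalGenerators P.symX P.GX UX)
    (hΩX : IsNonlocalGenerators P.dualSymX P.ΓX ΩX)
    (hΩZ : IsNonlocalGenerators P.dualSymZ P.ΓZ ΩZ) :
    P.IsTwoCopies K (P.sector UZ ΩX ΩZ K l (SectorLabel.trivial K nZ mX mZ))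
      (P.ficSpace UX) 1 1 1 1 := by
  rw [sector_trivial_eq_stabSpace, stabSpace_one_eq_codeSpace, span_range_sectorX hΩX]
  exact isTwoCopies_codeSpace (fun _ => mem_ficSpace_iff hUX) (symmetries_sectorZ hUZ hΩZ)
    P.gaugePairs_inf_comap_suspGroup_dualSymX le_rfl (by simp)

theorem isOrthogonalSum_sector (hUZ : IsNonlocalGenerators P.symZ P.GZ UZ)
    (hΩX : IsNonlocalGenerators P.dualSymX P.ΓX ΩX)
    (hΩZ : IsNonlocalGenerators P.dualSymZ P.ΓZ ΩZ) :
    IsOrthogonalSum (P.bdrySpace K) (P.sector UZ ΩX ΩZ K l) := by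
  have hzx := sectorZ_dotProduct_sectorX (l := l) (K := K) hUZ hΩX hΩZ
  have hux (k k') := hzx (Sum.inr k) (Sum.inl k')
  have hzv (k k') := hzx (Sum.inl k) (Sum.inr k')
  have huv (k k') := hzx (Sum.inr k) (Sum.inr k')
  let e : SectorLabel K nZ mX mZ ≃ ((Fin mZ ⊕ (Fin K × Fin nZ)) ⊕ (Fin (K + 1) × Fin mX) → ℤˣ) :=
    { toFun := fun t => Sum.elim (Sum.elim t.dualZ fun p => t.origZ p.1 p.2)
        fun p => t.dualX p.1 p.2
      invFun := fun s => ⟨fun k => s (Sum.inl (Sum.inl k)), fun j k => s (Sum.inl (Sum.inr (j, k))),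
        fun j k => s (Sum.inr (j, k))⟩
      left_inv := fun _ => rfl
      right_inv := fun s => by
        funext k
        rcases k with (k | k) | k <;> rfl }
  rw [bdrySpace_eq_stabSpace, funext sector_eq_stabSpace]
  exact (isOrthogonalSum_stabSpace hux hzv huv).comp_equiv e

theorem exists_isTwoCopies_sector (hUZ : IsNonlocalGenerators P.symZ P.GZ UZ)
    (hUX : IsNonlocalGenerators P.symX P.GX UX)
    (hΩX : IsNonlocalGenerators P.dualSymX P.ΓX ΩX)
    (hΩZ : IsNonlocalGenerators P.dualSymZ P.ΓZ ΩZ) (t : SectorLabel K nZ mX mZ)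
    (ht : P.sector UZ ΩX ΩZ K l t ≠ ⊥) :
    ∃ (ε : I → ℤˣ) (η : A → ℤˣ),
      P.IsTwoCopies K (P.sector UZ ΩX ΩZ K l t) (P.ficSpace UX) ε 1 η η := by
  rw [sector_eq_stabSpace] at ht ⊢
  obtain ⟨⟨x, hx⟩, ⟨w, hw⟩⟩ := exists_signs_of_stabSpace_ne_bot ht
  obtain ⟨a, ha, hZ⟩ := exists_bitSign_sectorZ_eq hx
  obtain ⟨b, hb, hX⟩ := exists_bitSign_sectorX_eq hΩX hw
  have htriv := isTwoCopies_sector_trivial (P := P) (K := K) (l := l) hUZ hUX hΩX hΩZ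
  rw [sector_trivial_eq_stabSpace] at htriv
  have hZX (α : A) (k) := ZVec_dotProduct_of_mem_suspGroup (sectorX_mem_suspGroup (K := K) hΩX k) α
  have h := htriv.of_stabSpace_one ha hb
    (fun i k => by
      rw [← onEnds_left, dotProduct_comm]
      exact onEnds_mem_symmetries_sectorZ ⟨OX_mem_symmetries_GZ i, Submodule.zero_mem _⟩ k)
    (fun i k => by
      rw [← onEnds_right, dotProduct_comm]
      exact onEnds_mem_symmetries_sectorZ ⟨Submodule.zero_mem _, OX_mem_symmetries_GZ i⟩ k)
    (fun α k => (hZX α k).1) (fun α k => (hZX α k).2)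
  simp only [hX, hZ] at h
  exact ⟨_, _, h⟩

end Sectors

end DualPair

section CosetDecomposition

variable {V : Type*} [AddCommGroup V] [Module (ZMod 2) V] {D D₀ E N : Submodule (ZMod 2) V}

theorem exists_coset_representatives [Finite V] (N D₀ : Submodule (ZMod 2) V) :
    ∃ (n : ℕ) (x : Fin n → V), (∀ a, x a ∈ N) ∧ (∀ a b, x a + x b ∈ D₀ → a = b) ∧
      ∀ y ∈ N ⊔ D₀, ∃ a, y + x a ∈ D₀ := by
  have hmk {y z : V} : y + z ∈ D₀ ↔ D₀.mkQ y = D₀.mkQ z := by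
    rw [← ZModModule.sub_eq_add]
    exact (Submodule.Quotient.eq D₀).symm
  have : Finite (V ⧸ D₀) := Finite.of_surjective _ D₀.mkQ_surjective
  choose x hxN hx using fun q : N.map D₀.mkQ => q.2
  let e := Finite.equivFin (N.map D₀.mkQ)
  refine ⟨_, x ∘ e.symm, fun a => hxN _, fun a b hab => ?_, fun y hy => ?_⟩
  · rw [hmk, Function.comp_apply, Function.comp_apply, hx, hx] at hab
    exact e.symm.injective (Subtype.ext hab)
  · have hmem : D₀.mkQ y ∈ N.map D₀.mkQ := by
      simpa [Submodule.map_sup] using Submodule.mem_map_of_mem (f := D₀.mkQ) hy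
    refine ⟨e ⟨_, hmem⟩, ?_⟩
    rw [hmk, Function.comp_apply, e.symm_apply_apply, hx]

theorem codeSpace_le_codeSpace {x x' : V} (hD : D₀ ≤ D) (hx : x + x' ∈ D) :
    codeSpace x D₀ E ≤ codeSpace x' D E := fun f hf => by
  refine ⟨fun y hy => ?_, hf.2⟩
  rw [← add_add_cancel_of_zmod_two y x, add_assoc]
  exact D.add_mem (hD (hf.1 y hy)) hx

theorem indicator_mem_codeSpace (hE : E ≤ D₀) (x : V) {g : EuclideanSpace ℂ V}
    (hg : E ≤ translationInvariants g) :
    WithLp.toLp 2 ({y | y + x ∈ D₀}.indicator g) ∈ codeSpace x D₀ E := by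
  refine ⟨fun y hy => Set.mem_of_indicator_ne_zero (s := {y | y + x ∈ D₀}) (f := g) hy,
    fun e he y => ?_⟩
  have hiff : y + e + x ∈ D₀ ↔ y + x ∈ D₀ := by
    rw [add_right_comm, D₀.add_mem_iff_left (hE he)]
  classical
  change Set.indicator _ _ _ = Set.indicator _ _ _
  simp only [Set.indicator_apply, Set.mem_ofPred_eq, hiff, hg he y]

variable [Fintype V]

theorem inner_eq_zero_of_mem_codeSpace {x x' : V} (hx : x + x' ∉ D) {f g : EuclideanSpace ℂ V}
    (hf : f ∈ codeSpace x D E) (hg : g ∈ codeSpace x' D E) : inner ℂ f g = 0 := by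
  rw [PiLp.inner_apply]
  refine Finset.sum_eq_zero fun y _ => ?_
  by_cases hfy : f y = 0
  · rw [hfy, inner_zero_left]
  by_cases hgy : g y = 0
  · rw [hgy, inner_zero_right]
  have hsum := D.add_mem (hf.1 y hfy) (hg.1 y hgy)
  rw [add_add_add_comm, ZModModule.add_self, zero_add] at hsum
  exact absurd hsum hx

theorem exists_isOrthogonalSum_codeSpace (hED : E ≤ D₀) (hD : N ⊔ D₀ = D) :
    ∃ (n : ℕ) (x : Fin n → V), (∀ a, x a ∈ N) ∧
      IsOrthogonalSum (codeSpace 0 D E) fun a => codeSpace (x a) D₀ E := by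
  obtain ⟨n, x, hxN, hinj, hex⟩ := exists_coset_representatives N D₀
  refine ⟨n, x, hxN, fun a b hab f g => inner_eq_zero_of_mem_codeSpace (mt (hinj a b) hab) f.2 g.2,
    le_antisymm (iSup_le fun a => codeSpace_le_codeSpace (hD ▸ le_sup_right) ?_) fun g hg => ?_⟩
  · rw [add_zero]
    exact hD ▸ Submodule.mem_sup_left (hxN a)
  · have hsum : g = ∑ a, WithLp.toLp 2 ({y | y + x a ∈ D₀}.indicator g) := by
      ext y
      rw [WithLp.ofLp_sum, Finset.sum_apply]
      by_cases hy : g y = 0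
      · rw [hy]
        exact (Finset.sum_eq_zero fun a _ => Set.indicator_apply_eq_zero.2 fun _ => hy).symm
      have hyD := hg.1 y hy
      rw [add_zero, ← hD] at hyD
      obtain ⟨a, ha⟩ := hex y hyD
      rw [Finset.sum_eq_single a]
      · exact (Set.indicator_of_mem (s := {y | y + x a ∈ D₀}) ha g).symm
      · refine fun b _ hb => Set.indicator_of_notMem (fun hyb => hb (hinj b a ?_)) g
        have hba := D₀.add_mem hyb ha
        rwa [add_add_add_comm, ZModModule.add_self, zero_add] at hba
      · exact fun h => absurd (Finset.mem_univ a) h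
    rw [hsum]
    exact Submodule.sum_mem _ fun a _ =>
      Submodule.mem_iSup_of_mem a (indicator_mem_codeSpace hED (x a) hg.2)

end CosetDecomposition

section CarriesSum

theorem Carries.eqOn_iff {E E' : Type*} [NormedAddCommGroup E] [InnerProductSpace ℂ E]
    [NormedAddCommGroup E'] [InnerProductSpace ℂ E'] {W : Submodule ℂ E} {F : Submodule ℂ E'}
    {e : W ≃ₗᵢ[ℂ] F} {T S : E →ₗ[ℂ] E} {T' S' : E' →ₗ[ℂ] E'} (hT : Carries e T T')
    (hS : Carries e S S') : Set.EqOn T S W ↔ Set.EqOn T' S' F := by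
  have hiff (ψ : W) : T ψ = S ψ ↔ T' (e ψ) = S' (e ψ) := by
    obtain ⟨hTmem, hTeq⟩ := hT ψ
    obtain ⟨hSmem, hSeq⟩ := hS ψ
    rw [← hTeq, ← hSeq, SetLike.coe_eq_coe, e.injective.eq_iff, Subtype.mk_eq_mk]
  constructor
  · intro h φ hφ
    obtain ⟨ψ, hψ⟩ := e.surjective ⟨φ, hφ⟩
    have := (hiff ψ).1 (h ψ.2)
    rwa [hψ] at this
  · exact fun h ψ hψ => (hiff ⟨ψ, hψ⟩).2 (h (e ⟨ψ, hψ⟩).2)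

theorem Carries.finset_sum {E E' V V' B : Type*} [NormedAddCommGroup E] [InnerProductSpace ℂ E]
    [NormedAddCommGroup E'] [InnerProductSpace ℂ E'] [AddCommMonoid V] [AddCommMonoid V']
    {W : Submodule ℂ E} {F : Submodule ℂ E'} {e : W ≃ₗᵢ[ℂ] F} {f : V → E →ₗ[ℂ] E}
    {g : V' → E' →ₗ[ℂ] E'} (f_zero : f 0 = LinearMap.id) (f_add : ∀ a b, f (a + b) = f a ∘ₗ f b)
    (g_zero : g 0 = LinearMap.id) (g_add : ∀ a b, g (a + b) = g a ∘ₗ g b)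
    {v : B → V} {w : B → V'} {η : B → ℤˣ} (h : ∀ α, Carries e (f (v α)) (sgn (η α) • g (w α)))
    (S : Finset B) :
    Carries e (f (∑ α ∈ S, v α)) (sgn (∏ α ∈ S, η α) • g (∑ α ∈ S, w α)) := by
  classical
  induction S using Finset.induction_on with
  | empty =>
    rw [Finset.sum_empty, Finset.sum_empty, Finset.prod_empty, f_zero, g_zero, sgn_one, one_smul]
    exact Carries.id
  | insert α S hα ih =>
    rw [Finset.sum_insert hα, Finset.sum_insert hα, Finset.prod_insert hα, f_add, g_add, sgn_mul,
      mul_smul, ← LinearMap.comp_smul, ← LinearMap.smul_comp]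
    exact (h α).comp ih

variable {B N Q : Type*} [Fintype N] [DecidableEq N] [Fintype Q] [DecidableEq Q]
  {W : Submodule ℂ (Hilb N)} {F : Submodule ℂ (Hilb Q ⊗[ℂ] Hilb Q)} {e : W ≃ₗᵢ[ℂ] F}
  {v : B → Bits N} {w w' : B → Bits Q} {η : B → ℤˣ}

theorem Carries.pauliX_sum (h : ∀ α, Carries e (pauliX (v α))
      (sgn (η α) • TensorProduct.map (pauliX (w α)) (pauliX (w' α)))) (S : Finset B) :
    Carries e (pauliX (∑ α ∈ S, v α)) (sgn (∏ α ∈ S, η α) •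
      TensorProduct.map (pauliX (∑ α ∈ S, w α)) (pauliX (∑ α ∈ S, w' α))) := by
  have hsum := Carries.finset_sum (w := fun α => (w α, w' α))
    (g := fun b : Bits Q × Bits Q => TensorProduct.map (pauliX b.1) (pauliX b.2)) pauliX_zero
    pauliX_add (by simp) (fun a b => by
      rw [Prod.fst_add, Prod.snd_add, pauliX_add, pauliX_add, TensorProduct.map_comp]) h S
  simpa only [Prod.fst_sum, Prod.snd_sum] using hsum

theorem Carries.pauliZ_sum (h : ∀ α, Carries e (pauliZ (v α))
      (sgn (η α) • TensorProduct.map (pauliZ (w α)) (pauliZ (w' α)))) (S : Finset B) :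
    Carries e (pauliZ (∑ α ∈ S, v α)) (sgn (∏ α ∈ S, η α) •
      TensorProduct.map (pauliZ (∑ α ∈ S, w α)) (pauliZ (∑ α ∈ S, w' α))) := by
  have hsum := Carries.finset_sum (w := fun α => (w α, w' α))
    (g := fun b : Bits Q × Bits Q => TensorProduct.map (pauliZ b.1) (pauliZ b.2)) pauliZ_zero
    pauliZ_add (by simp) (fun a b => by
      rw [Prod.fst_add, Prod.snd_add, pauliZ_add, pauliZ_add, TensorProduct.map_comp]) h S
  simpa only [Prod.fst_sum, Prod.snd_sum] using hsum

end CarriesSum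

namespace DualPair

variable {Q Q' A I ιr ιs ιρ ισ : Type*} [Fintype Q] [Fintype Q']
  {P : DualPair Q Q' A I ιr ιs ιρ ισ} {K n : ℕ}

/-! ### The two relations -/

theorem ChargeRelation.exists_prodOX_eq [Fintype I] {U : Fin n → Bits Q} {N : Finset (Fin n)}
    {J : Finset I} (h : P.ChargeRelation U N J) :
    ∃ u, P.prodOX u = ∑ k ∈ N, U k ∧
      P.prodDX u ∈ Submodule.span (ZMod 2) (Set.range P.ΓX) := by
  classical
  refine ⟨fun i => if i ∈ J then 1 else 0, ?_, ?_⟩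
  · simp [prodOX_apply, h.1]
  · simpa [prodDX_apply] using h.2

theorem ChargeRelation.onEnds_mem_suspGroup [Fintype I] {U : Fin n → Bits Q} {N : Finset (Fin n)}
    {J : Finset I} (h : P.ChargeRelation U N J) :
    onEnds Q Q' K (∑ k ∈ N, U k, ∑ k ∈ N, U k) ∈
      P.suspGroup K (Submodule.span (ZMod 2) (Set.range P.ΓX)) := by
  obtain ⟨u, hu, hmem⟩ := h.exists_prodOX_eq
  rw [← hu]
  exact P.onEnds_prodOX_mem_suspGroup hmem

section BoundaryRelation

variable {Ω : Fin n → Bits Q'} {N : Finset (Fin n)} {S : Finset A} {x : Bits (Stack Q Q' K)}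

theorem BoundaryRelation.sum_OZ_dotProduct_oddPart (h : P.BoundaryRelation Ω N S)
    (hx : x ∈ symmetries (P.bulkZ K)) (j : Fin (K + 2)) :
    (∑ α ∈ S, P.OZ α) ⬝ᵥ oddPart j x = 0 :=
  mem_span_range_iff_forall_symmetries.1 h.2 _ ((mem_symmetries_bulkZ.1 hx).2.1 j)

-- Multiplying the suspended Ising terms with indices in `S` between two adjacent even layers, the
-- factors on the odd layer in between are trivial.
theorem BoundaryRelation.dotProduct_evenPart (h : P.BoundaryRelation Ω N S)
    (hx : x ∈ symmetries (P.bulkZ K)) (j j' : Fin (K + 1)) :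
    (∑ k ∈ N, Ω k) ⬝ᵥ evenPart j x = (∑ k ∈ N, Ω k) ⬝ᵥ evenPart j' x := by
  have hstep (j : Fin K) : (∑ k ∈ N, Ω k) ⬝ᵥ evenPart j.succ x =
      (∑ k ∈ N, Ω k) ⬝ᵥ evenPart j.castSucc x := by
    have hsusp : ∑ α ∈ S, (P.DZ α ⬝ᵥ evenPart j.castSucc x +
        P.OZ α ⬝ᵥ oddPart j.succ.castSucc x + P.DZ α ⬝ᵥ evenPart j.succ x) = 0 :=
      Finset.sum_eq_zero fun α _ => (mem_symmetries_bulkZ.1 hx).1 α j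
    rw [Finset.sum_add_distrib, Finset.sum_add_distrib, ← sum_dotProduct, ← sum_dotProduct,
      ← sum_dotProduct, h.sum_OZ_dotProduct_oddPart hx, add_zero, ← h.1, add_comm] at hsusp
    exact eq_of_add_eq_zero_of_zmod_two hsusp
  have hzero (j) : (∑ k ∈ N, Ω k) ⬝ᵥ evenPart j x = (∑ k ∈ N, Ω k) ⬝ᵥ evenPart 0 x := by
    induction j using Fin.induction with
    | zero => rfl
    | succ j ih => rw [hstep, ih]
  rw [hzero j, hzero j']

theorem BoundaryRelation.sum_firstZVec_dotProduct (h : P.BoundaryRelation Ω N S)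
    (hx : x ∈ symmetries (P.bulkZ K)) (l : Fin (K + 1)) :
    (∑ α ∈ S, P.firstZVec K α) ⬝ᵥ x = (∑ k ∈ N, Ω k) ⬝ᵥ evenPart l x := by
  rw [sum_dotProduct]
  simp only [firstZVec_dotProduct, Finset.sum_add_distrib]
  rw [← sum_dotProduct, ← sum_dotProduct, h.sum_OZ_dotProduct_oddPart hx, zero_add, ← h.1,
    h.dotProduct_evenPart hx]

theorem BoundaryRelation.sum_lastZVec_dotProduct (h : P.BoundaryRelation Ω N S)
    (hx : x ∈ symmetries (P.bulkZ K)) (l : Fin (K + 1)) :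
    (∑ α ∈ S, P.lastZVec K α) ⬝ᵥ x = (∑ k ∈ N, Ω k) ⬝ᵥ evenPart l x := by
  rw [sum_dotProduct]
  simp only [lastZVec_dotProduct, Finset.sum_add_distrib]
  rw [← sum_dotProduct, ← sum_dotProduct, h.sum_OZ_dotProduct_oddPart hx, zero_add, ← h.1,
    h.dotProduct_evenPart hx]

-- Every bulk term becomes an element of the span of `ΓZ` when its even layers are added up.
theorem mem_span_ΓZ_of_onEven_mem_span_bulkZ {b : Bits Q'} {l : Fin (K + 1)}
    (hb : (onEven l b : Bits (Stack Q Q' K)) ∈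
      Submodule.span (ZMod 2) (Set.range (P.bulkZ K))) :
    b ∈ Submodule.span (ZMod 2) (Set.range P.ΓZ) := by
  have hle : Submodule.span (ZMod 2) (Set.range (P.bulkZ K)) ≤
      (Submodule.span (ZMod 2) (Set.range P.ΓZ)).comap (∑ j, evenPart j) := by
    rw [Submodule.span_le]
    rintro _ ⟨⟨α, j⟩ | ⟨r, j⟩ | ⟨σ, j⟩, rfl⟩
    · simp [bulkZ, suspZ, Finset.sum_add_distrib, ZModModule.add_self]
    · simp [bulkZ]
    · have hσ : P.ΓZ σ ∈ Submodule.span (ZMod 2) (Set.range P.ΓZ) := Submodule.subset_span ⟨σ, rfl⟩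
      simpa [bulkZ] using hσ
  simpa using hle hb

theorem exists_mem_symmetries_bulkZ_bitSign_eq {G : Submodule (ZMod 2) (Bits Q')}
    (hΩ : IsNonlocalGenerators G P.ΓZ Ω) (hN : N.Nonempty) (l : Fin (K + 1)) (u : ℤˣ) :
    ∃ x ∈ symmetries (P.bulkZ K), bitSign ((∑ k ∈ N, Ω k) ⬝ᵥ evenPart l x) = u := by
  obtain ⟨x, hx, hne⟩ : ∃ x ∈ symmetries (P.bulkZ K), (∑ k ∈ N, Ω k) ⬝ᵥ evenPart l x ≠ 0 := by
    by_contra! h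
    refine hN.ne_empty (hΩ.indep N (mem_span_ΓZ_of_onEven_mem_span_bulkZ (l := l)
      (mem_span_range_iff_forall_symmetries.2 fun x hx => ?_)))
    rw [onEven_dotProduct]
    exact h x hx
  have hone := (zmod_two_eq_zero_or_one _).resolve_left hne
  rcases Int.units_eq_one_or u with rfl | rfl
  · exact ⟨0, Submodule.zero_mem _, by simp⟩
  · exact ⟨x, hx, by rw [hone, bitSign_one]⟩

end BoundaryRelation

end DualPair

namespace DualPair

variable {Q Q' A I ιr ιs ιρ ισ : Type*} [Fintype Q] [Fintype Q']
  {P : DualPair Q Q' A I ιr ιs ιρ ισ} {K n : ℕ}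

theorem onEnds_mem_symmetries_bulkZ {y : Bits Q × Bits Q} (hy : y ∈ P.gaugePairs) :
    onEnds Q Q' K y ∈ symmetries (P.bulkZ K) :=
  (mem_symmetries_sectorZ (UZ := Fin.elim0) (ΩZ := Fin.elim0) (l := 0).1
    (onEnds_mem_symmetries_sectorZ hy)).1

theorem suspGroup_span_ΓX_le_symmetries_bulkZ [Fintype I] :
    P.suspGroup K (Submodule.span (ZMod 2) (Set.range P.ΓX)) ≤ symmetries (P.bulkZ K) := by
  rw [← span_range_bulkX, Submodule.span_le]
  rintro _ ⟨k, rfl⟩ k'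
  rw [dotProduct_comm]
  exact bulkZ_dotProduct_bulkX k' k

theorem symmetries_bulkZ_eq_sup [Fintype A] [Fintype I]
    (hZ : ∀ u, P.prodOZ u ∈ Submodule.span (ZMod 2) (Set.range P.GZ) →
      P.prodDZ u ∈ Submodule.span (ZMod 2) (Set.range P.ΓZ)) :
    (symmetries (P.bulkZ K) ⊓ symmetries (Sum.elim (P.firstZVec K) (P.lastZVec K))) ⊔
      (P.gaugePairs.map (onEnds Q Q' K) ⊔
        P.suspGroup K (Submodule.span (ZMod 2) (Set.range P.ΓX))) = symmetries (P.bulkZ K) := by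
  refine le_antisymm (sup_le inf_le_left (sup_le ?_ suspGroup_span_ΓX_le_symmetries_bulkZ))
    fun x hx => ?_
  · rintro _ ⟨y, hy, rfl⟩
    exact onEnds_mem_symmetries_bulkZ hy
  · obtain ⟨y, hy, hxy⟩ := exists_add_onEnds_dotProduct_eq_zero hZ hx
    rw [← add_add_cancel_of_zmod_two x (onEnds Q Q' K y)]
    refine Submodule.add_mem_sup ⟨Submodule.add_mem _ hx (onEnds_mem_symmetries_bulkZ hy), ?_⟩
      (Submodule.mem_sup_left ⟨y, hy, rfl⟩)
    rintro (α | α)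
    · rw [dotProduct_comm]
      exact (hxy α).1
    · rw [dotProduct_comm]
      exact (hxy α).2

variable [DecidableEq Q]

section TwoCopies

theorem map_pauliZ_eq_self {φ : Hilb Q ⊗[ℂ] Hilb Q} (hφ : φ ∈ P.twoCopies) {b b' : Bits Q}
    (hb : b ∈ Submodule.span (ZMod 2) (Set.range P.GZ))
    (hb' : b' ∈ Submodule.span (ZMod 2) (Set.range P.GZ)) :
    TensorProduct.map (pauliZ b) (pauliZ b') φ = φ := by
  apply (tensorFun Q).injective
  ext y
  rw [tensorFun_map_pauliZ]
  by_cases hy : tensorFun Q φ y = 0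
  · rw [hy, mul_zero]
  · have hsymm := (mem_twoCopies_iff.1 hφ).1 y hy
    rw [add_zero] at hsymm
    rw [mem_span_range_iff_forall_symmetries.1 hb _ hsymm.1,
      mem_span_range_iff_forall_symmetries.1 hb' _ hsymm.2, add_zero, bitSign_zero, sgn_one,
      one_mul]

theorem tmul_mem_twoCopies {φ ψ : Hilb Q} (hφ : φ ∈ P.gaugeSpace) (hψ : ψ ∈ P.gaugeSpace) :
    φ ⊗ₜ[ℂ] ψ ∈ P.twoCopies :=
  ⟨(⟨φ, hφ⟩ : P.gaugeSpace) ⊗ₜ (⟨ψ, hψ⟩ : P.gaugeSpace), TensorProduct.map_tmul _ _ _ _⟩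

theorem exists_mem_gaugeSpace_pauliX_eq {UX : Fin n → Bits Q}
    (hUX : IsNonlocalGenerators P.symX P.GX UX)
    {N : Finset (Fin n)} (hN : N.Nonempty) (u : ℤˣ) :
    ∃ ψ ∈ P.gaugeSpace, ψ ≠ 0 ∧ pauliX (∑ k ∈ N, UX k) ψ = sgn u • ψ := by
  have hU : ∑ k ∈ N, UX k ∈ P.symX := Submodule.sum_mem _ fun k _ => hUX.mem k
  have hcomm {b} (hb : b ∈ P.symX) (r : ιr) : P.GZ r ⬝ᵥ b = 0 := by
    rw [dotProduct_comm]
    exact P.symX_le_symmetries_GZ hb r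
  have hGG (r s) := hcomm (P.GX_mem s) r
  rw [gaugeSpace_eq_stabSpace]
  exact exists_mem_stabSpace_pauliX_eq hGG (stabSpace_one_ne_bot hGG) (hcomm hU)
    (fun hmem => hN.ne_empty (hUX.indep N hmem)) u

theorem exists_mem_twoCopies_map_pauliX_ne {UX : Fin n → Bits Q}
    (hUX : IsNonlocalGenerators P.symX P.GX UX)
    {N : Finset (Fin n)} (hN : N.Nonempty) :
    ∃ φ ∈ P.twoCopies, TensorProduct.map (pauliX (∑ k ∈ N, UX k)) LinearMap.id φ ≠
      TensorProduct.map LinearMap.id (pauliX (∑ k ∈ N, UX k)) φ := by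
  obtain ⟨ψ, hψ, hψ₀, hψU⟩ := exists_mem_gaugeSpace_pauliX_eq hUX hN 1
  obtain ⟨φ, hφ, hφ₀, hφU⟩ := exists_mem_gaugeSpace_pauliX_eq hUX hN (-1)
  refine ⟨ψ ⊗ₜ φ, tmul_mem_twoCopies hψ hφ, fun heq => ?_⟩
  rw [TensorProduct.map_tmul, TensorProduct.map_tmul, hψU, hφU, LinearMap.id_apply,
    LinearMap.id_apply, ← TensorProduct.smul_tmul', TensorProduct.tmul_smul] at heq
  have hne : ψ ⊗ₜ[ℂ] φ ≠ 0 := by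
    rw [← norm_ne_zero_iff, TensorProduct.norm_tmul]
    exact mul_ne_zero (norm_ne_zero_iff.2 hψ₀) (norm_ne_zero_iff.2 hφ₀)
  exact absurd (sgn_injective (smul_left_injective ℂ hne heq)) (by decide)

variable [DecidableEq Q'] {W : Submodule ℂ (Hilb (Stack Q Q' K))}
  {F : Submodule ℂ (Hilb Q ⊗[ℂ] Hilb Q)} {ε ε' : I → ℤˣ} {η η' : A → ℤˣ}

theorem IsTwoCopies.pauliZ_sum_firstZVec (h : P.IsTwoCopies K W F ε ε' η η')
    (hF : F ≤ P.twoCopies) {S : Finset A}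
    (hS : ∑ α ∈ S, P.OZ α ∈ Submodule.span (ZMod 2) (Set.range P.GZ))
    {ψ : Hilb (Stack Q Q' K)} (hψ : ψ ∈ W) :
    pauliZ (∑ α ∈ S, P.firstZVec K α) ψ = sgn (∏ α ∈ S, η α) • ψ := by
  obtain ⟨e, -, -, hfirstZ, -⟩ := h
  have hsum := Carries.pauliZ_sum (e := e) (v := P.firstZVec K) (w := P.OZ) (w' := 0) (η := η)
    (fun α => by
      rw [Pi.zero_apply, pauliZ_zero]
      exact hfirstZ α) S
  refine (hsum.eqOn_iff (Carries.id.smul _)).2 (fun φ hφ => ?_) hψ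
  rw [LinearMap.smul_apply, map_pauliZ_eq_self (hF hφ) hS (by simp)]
  rfl

theorem IsTwoCopies.pauliZ_sum_lastZVec (h : P.IsTwoCopies K W F ε ε' η η')
    (hF : F ≤ P.twoCopies) {S : Finset A}
    (hS : ∑ α ∈ S, P.OZ α ∈ Submodule.span (ZMod 2) (Set.range P.GZ))
    {ψ : Hilb (Stack Q Q' K)} (hψ : ψ ∈ W) :
    pauliZ (∑ α ∈ S, P.lastZVec K α) ψ = sgn (∏ α ∈ S, η' α) • ψ := by
  obtain ⟨e, -, -, -, hlastZ⟩ := h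
  have hsum := Carries.pauliZ_sum (e := e) (v := P.lastZVec K) (w := 0) (w' := P.OZ) (η := η')
    (fun α => by
      rw [Pi.zero_apply, pauliZ_zero]
      exact hlastZ α) S
  refine (hsum.eqOn_iff (Carries.id.smul _)).2 (fun φ hφ => ?_) hψ
  rw [LinearMap.smul_apply, map_pauliZ_eq_self (hF hφ) (by simp) hS]
  rfl

end TwoCopies

variable [DecidableEq Q'] [Fintype A] [Fintype I] [Fintype ιr] [Fintype ιs] [Fintype ιρ]
  [Fintype ισ] {nZ nX mX mZ : ℕ} {UZ : Fin nZ → Bits Q} {UX : Fin nX → Bits Q}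
  {ΩX : Fin mX → Bits Q'} {ΩZ : Fin mZ → Bits Q'} {l : Fin (K + 1)}

theorem bdrySpace_ne_bot : P.bdrySpace K ≠ ⊥ := by
  rw [bdrySpace_eq_stabSpace]
  exact stabSpace_one_ne_bot bulkZ_dotProduct_bulkX

/-! ### Locked symmetry charges -/

theorem ChargeRelation.pauliX_eq {N : Finset (Fin nX)} {J : Finset I}
    (h : P.ChargeRelation UX N J) {ψ : Hilb (Stack Q Q' K)} (hψ : ψ ∈ P.bdrySpace K) :
    pauliX (onOdd 0 (∑ k ∈ N, UX k)) ψ =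
      pauliX (onOdd (Fin.last (K + 1)) (∑ k ∈ N, UX k)) ψ := by
  rw [bdrySpace_eq_codeSpace] at hψ
  ext x
  have hinv := hψ.2 _ h.onEnds_mem_suspGroup (x + onOdd 0 (∑ k ∈ N, UX k))
  rw [onEnds_apply, ← add_assoc, add_add_cancel_of_zmod_two] at hinv
  exact hinv.symm

theorem exists_mem_sector_pauliX_eq (hUZ : IsNonlocalGenerators P.symZ P.GZ UZ)
    (hUX : IsNonlocalGenerators P.symX P.GX UX)
    (hΩX : IsNonlocalGenerators P.dualSymX P.ΓX ΩX)
    (hΩZ : IsNonlocalGenerators P.dualSymZ P.ΓZ ΩZ) {N : Finset (Fin nX)} (hN : N.Nonempty)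
    {t : SectorLabel K nZ mX mZ} (ht : P.sector UZ ΩX ΩZ K l t ≠ ⊥) (u : ℤˣ) :
    ∃ ψ ∈ P.sector UZ ΩX ΩZ K l t, ψ ≠ 0 ∧
      pauliX (onOdd 0 (∑ k ∈ N, UX k)) ψ = sgn u • ψ := by
  have hU : ∑ k ∈ N, UX k ∈ P.symX := Submodule.sum_mem _ fun k _ => hUX.mem k
  have hpair : ((∑ k ∈ N, UX k, 0) : Bits Q × Bits Q) ∈ P.gaugePairs :=
    ⟨P.symX_le_symmetries_GZ hU, Submodule.zero_mem _⟩
  rw [sector_eq_stabSpace] at ht ⊢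
  refine exists_mem_stabSpace_pauliX_eq (sectorZ_dotProduct_sectorX hUZ hΩX hΩZ) ht
    (fun k => ?_) (fun hmem => ?_) u
  · rw [dotProduct_comm, ← onEnds_left]
    exact onEnds_mem_symmetries_sectorZ hpair k
  · rw [span_range_sectorX hΩX, ← onEnds_left] at hmem
    have hfic := (P.mem_ficGroup.1 (P.gaugePairs_inf_comap_suspGroup_dualSymX.le ⟨hpair, hmem⟩)).2
    rw [add_zero] at hfic
    exact hN.ne_empty (hUX.indep N hfic)

theorem ChargeRelation.smul_map_pauliX_eq {N : Finset (Fin nX)} {J : Finset I}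
    (h : P.ChargeRelation UX N J) {W : Submodule ℂ (Hilb (Stack Q Q' K))}
    {F : Submodule ℂ (Hilb Q ⊗[ℂ] Hilb Q)} {ε ε' : I → ℤˣ} {η η' : A → ℤˣ}
    (hW : P.IsTwoCopies K W F ε ε' η η') (hle : W ≤ P.bdrySpace K)
    {φ : Hilb Q ⊗[ℂ] Hilb Q} (hφ : φ ∈ F) :
    sgn (∏ i ∈ J, ε i) • TensorProduct.map (pauliX (∑ k ∈ N, UX k)) LinearMap.id φ =
      sgn (∏ i ∈ J, ε' i) • TensorProduct.map LinearMap.id (pauliX (∑ k ∈ N, UX k)) φ := by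
  obtain ⟨e, hfirstX, hlastX, -, -⟩ := hW
  have hfirst := Carries.pauliX_sum (e := e) (v := fun i => onOdd 0 (P.OX i))
    (w := P.OX) (w' := 0) (η := ε) (fun i => by
      rw [Pi.zero_apply, pauliX_zero]
      exact hfirstX i) J
  have hlast := Carries.pauliX_sum (e := e) (v := fun i => onOdd (Fin.last (K + 1)) (P.OX i))
    (w := 0) (w' := P.OX) (η := ε') (fun i => by
      rw [Pi.zero_apply, pauliX_zero]
      exact hlastX i) J
  simp only [← onOddₗ_apply, ← map_sum, ← h.1, Pi.zero_apply,
    Finset.sum_const_zero, pauliX_zero] at hfirst hlast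
  exact (hfirst.eqOn_iff hlast).1 (fun ψ hψ => h.pauliX_eq (hle hψ)) hφ

theorem ChargeRelation.anomalous (hUX : IsNonlocalGenerators P.symX P.GX UX)
    {N : Finset (Fin nX)} (hN : N.Nonempty) {J : Finset I} (h : P.ChargeRelation UX N J) :
    P.Anomalous K := by
  rintro ⟨D, W, ⟨-, hsup⟩, hW⟩
  obtain ⟨a⟩ : Nonempty (Fin D) := by
    by_contra hempty
    rw [not_nonempty_iff] at hempty
    exact bdrySpace_ne_bot (P := P) (K := K) (by rw [← hsup, iSup_of_empty])
  obtain ⟨φ, hφ, hne⟩ := exists_mem_twoCopies_map_pauliX_ne hUX hN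
  have heq := h.smul_map_pauliX_eq (hW a) (hsup ▸ le_iSup W a) hφ
  simp only [Pi.one_apply, Finset.prod_const_one, sgn_one, one_smul] at heq
  exact hne heq

/-! ### Locked boundary conditions -/

section BoundaryRelation

variable {N : Finset (Fin mZ)} {S : Finset A}

theorem mem_symmetries_bulkZ_of_mem_sector {t : SectorLabel K nZ mX mZ}
    {ψ : Hilb (Stack Q Q' K)} (hψ : ψ ∈ P.sector UZ ΩX ΩZ K l t) {x : Bits (Stack Q Q' K)}
    (hx : ψ x ≠ 0) : x ∈ symmetries (P.bulkZ K) := by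
  rw [sector_eq_stabSpace, mem_stabSpace] at hψ
  exact mem_symmetries_bulkZ_of_bitSign_eq fun k => pauliZ_eq_smul_iff.1 (hψ.1 k) x hx

theorem bitSign_sum_dotProduct_evenPart {t : SectorLabel K nZ mX mZ}
    {ψ : Hilb (Stack Q Q' K)} (hψ : ψ ∈ P.sector UZ ΩX ΩZ K l t) {x : Bits (Stack Q Q' K)}
    (hx : ψ x ≠ 0) (N : Finset (Fin mZ)) :
    bitSign ((∑ k ∈ N, ΩZ k) ⬝ᵥ evenPart l x) = ∏ k ∈ N, t.dualZ k := by
  rw [sector_eq_stabSpace, mem_stabSpace] at hψ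
  rw [sum_dotProduct, bitSign_sum]
  refine Finset.prod_congr rfl fun k _ => ?_
  rw [← onEven_dotProduct]
  exact pauliZ_eq_smul_iff.1 (hψ.1 (Sum.inr (Sum.inl k))) x hx

theorem BoundaryRelation.pauliZ_sum_firstZVec (h : P.BoundaryRelation ΩZ N S)
    {t : SectorLabel K nZ mX mZ} {ψ : Hilb (Stack Q Q' K)}
    (hψ : ψ ∈ P.sector UZ ΩX ΩZ K l t) :
    pauliZ (∑ α ∈ S, P.firstZVec K α) ψ = sgn (∏ k ∈ N, t.dualZ k) • ψ :=
  pauliZ_eq_smul_iff.2 fun x hx => by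
    rw [h.sum_firstZVec_dotProduct (mem_symmetries_bulkZ_of_mem_sector hψ hx) l,
      bitSign_sum_dotProduct_evenPart hψ hx]

theorem BoundaryRelation.pauliZ_sum_lastZVec (h : P.BoundaryRelation ΩZ N S)
    {t : SectorLabel K nZ mX mZ} {ψ : Hilb (Stack Q Q' K)}
    (hψ : ψ ∈ P.sector UZ ΩX ΩZ K l t) :
    pauliZ (∑ α ∈ S, P.lastZVec K α) ψ = sgn (∏ k ∈ N, t.dualZ k) • ψ :=
  pauliZ_eq_smul_iff.2 fun x hx => by
    rw [h.sum_lastZVec_dotProduct (mem_symmetries_bulkZ_of_mem_sector hψ hx) l,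
      bitSign_sum_dotProduct_evenPart hψ hx]

theorem BoundaryRelation.prod_eq (h : P.BoundaryRelation ΩZ N S)
    {t : SectorLabel K nZ mX mZ} (ht : P.sector UZ ΩX ΩZ K l t ≠ ⊥) {ε ε' : I → ℤˣ}
    {η η' : A → ℤˣ}
    (hW : P.IsTwoCopies K (P.sector UZ ΩX ΩZ K l t) (P.ficSpace UX) ε ε' η η') :
    ∏ α ∈ S, η α = ∏ k ∈ N, t.dualZ k ∧ ∏ α ∈ S, η' α = ∏ k ∈ N, t.dualZ k := by
  obtain ⟨ψ, hψ, hψ₀⟩ := Submodule.exists_mem_ne_zero_of_ne_bot ht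
  have hinj {u v : ℤˣ} (huv : sgn u • ψ = sgn v • ψ) : u = v :=
    sgn_injective (smul_left_injective ℂ hψ₀ huv)
  exact ⟨hinj <| (hW.pauliZ_sum_firstZVec inf_le_left h.2 hψ).symm.trans
      (h.pauliZ_sum_firstZVec hψ),
    hinj <| (hW.pauliZ_sum_lastZVec inf_le_left h.2 hψ).symm.trans (h.pauliZ_sum_lastZVec hψ)⟩

theorem exists_sector_ne_bot (hUZ : IsNonlocalGenerators P.symZ P.GZ UZ)
    (hΩX : IsNonlocalGenerators P.dualSymX P.ΓX ΩX)
    (hΩZ : IsNonlocalGenerators P.dualSymZ P.ΓZ ΩZ) (hN : N.Nonempty) (u : ℤˣ) :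
    ∃ t, P.sector UZ ΩX ΩZ K l t ≠ ⊥ ∧ ∏ k ∈ N, t.dualZ k = u := by
  obtain ⟨x, hx, rfl⟩ := exists_mem_symmetries_bulkZ_bitSign_eq (K := K) hΩZ hN l u
  refine ⟨⟨fun k => bitSign (ΩZ k ⬝ᵥ evenPart l x),
    fun j k => bitSign (UZ k ⬝ᵥ oddPart j.succ.castSucc x), 1⟩, ?_, ?_⟩
  · rw [sector_eq_stabSpace]
    refine stabSpace_ne_bot (sectorZ_dotProduct_sectorX hUZ hΩX hΩZ) (a := x) (b := 0) ?_ ?_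
    · rintro (k | _ | _)
      · have hk := hx k
        rw [dotProduct_comm] at hk
        exact (congrArg bitSign hk).trans bitSign_zero
      · exact congrArg bitSign (onEven_dotProduct _ _ _)
      · exact congrArg bitSign (onOdd_dotProduct _ _ _)
    · intro k
      rw [zero_dotProduct]
      rcases k with _ | _ <;> rfl
  · rw [sum_dotProduct, bitSign_sum]

theorem BoundaryRelation.anomalous (hUZ : IsNonlocalGenerators P.symZ P.GZ UZ)
    (hΩX : IsNonlocalGenerators P.dualSymX P.ΓX ΩX)
    (hΩZ : IsNonlocalGenerators P.dualSymZ P.ΓZ ΩZ) (hN : N.Nonempty)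
    (h : P.BoundaryRelation ΩZ N S) : P.Anomalous K := by
  rintro ⟨D, W, ⟨-, hsup⟩, hW⟩
  have hle : P.bdrySpace K ≤ Module.End.eigenspace (pauliZ (∑ α ∈ S, P.firstZVec K α)) 1 := by
    rw [← hsup]
    refine iSup_le fun a ψ hψ => Module.End.mem_eigenspace_iff.2 ?_
    simpa using (hW a).pauliZ_sum_firstZVec le_rfl h.2 hψ
  obtain ⟨t, ht, hu⟩ := exists_sector_ne_bot (K := K) (l := 0) hUZ hΩX hΩZ hN (-1)
  obtain ⟨ψ, hψ, hψ₀⟩ := Submodule.exists_mem_ne_zero_of_ne_bot ht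
  have hneg := h.pauliZ_sum_firstZVec hψ
  have hpos := hle ((isOrthogonalSum_sector hUZ hΩX hΩZ).2.le (Submodule.mem_iSup_of_mem t hψ))
  rw [Module.End.mem_eigenspace_iff, hneg, hu, ← sgn_one] at hpos
  exact absurd (sgn_injective (smul_left_injective ℂ hψ₀ hpos)) (by decide)

end BoundaryRelation

/-! ### Nonanomalous boundary theories -/

-- Moving gauge pairs into the end layers changes the values of the Ising boundary terms at will, so
-- every coset has a representative at which these values, hence the signs of its code space, are
-- trivial.
theorem not_anomalous
    (hX : ∀ u, P.prodDX u ∈ Submodule.span (ZMod 2) (Set.range P.ΓX) →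
      P.prodOX u ∈ Submodule.span (ZMod 2) (Set.range P.GX))
    (hZ : ∀ u, P.prodOZ u ∈ Submodule.span (ZMod 2) (Set.range P.GZ) →
      P.prodDZ u ∈ Submodule.span (ZMod 2) (Set.range P.ΓZ)) : ¬ P.Anomalous K := by
  rw [Anomalous, not_not]
  obtain ⟨n, x, hx, hsum⟩ :=
    exists_isOrthogonalSum_codeSpace le_sup_right (symmetries_bulkZ_eq_sup (K := K) hZ)
  refine ⟨n, _, by rwa [bdrySpace_eq_codeSpace], fun a => ?_⟩
  refine isTwoCopies_codeSpace (fun ψ => mem_twoCopies_iff) rfl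
    (P.gaugePairs_inf_comap_suspGroup_span_ΓX hX) (P.suspGroup_mono P.span_ΓX_le_dualSymX)
    fun α => ⟨?_, ?_⟩
  · rw [dotProduct_comm]
    exact (hx a).2 (Sum.inl α)
  · rw [dotProduct_comm]
    exact (hx a).2 (Sum.inr α)

end DualPair

end GI

end

theorem claim1 {M Q Q' A I ιr ιs ιρ ισ : Type*} [PseudoMetricSpace M]
    [Fintype Q] [DecidableEq Q] [Fintype Q'] [DecidableEq Q'] [Fintype A] [Fintype I]
    [Fintype ιr] [Fintype ιs] [Fintype ιρ] [Fintype ισ]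
    (P : GI.DualPair Q Q' A I ιr ιs ιρ ισ)
    (pos : Q → M) (pos' : Q' → M) (ℓ c R : ℝ) (hP : P.IsLocal pos pos' ℓ c R)
    {nZ nX mX mZ : ℕ}
    (UZ : Fin nZ → GI.Bits Q) (hUZ : GI.IsNonlocalGenerators P.symZ P.GZ UZ)
    (UX : Fin nX → GI.Bits Q) (hUX : GI.IsNonlocalGenerators P.symX P.GX UX)
    (ΩX : Fin mX → GI.Bits Q') (hΩX : GI.IsNonlocalGenerators P.dualSymX P.ΓX ΩX)
    (ΩZ : Fin mZ → GI.Bits Q') (hΩZ : GI.IsNonlocalGenerators P.dualSymZ P.ΓZ ΩZ)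
    (K : ℕ) (l : Fin (K + 1)) :
    -- the criterion
    (P.Anomalous K ↔
      (∃ N : Finset (Fin nX), N.Nonempty ∧ ∃ J, P.ChargeRelation UX N J) ∨
      (∃ N : Finset (Fin mZ), N.Nonempty ∧ ∃ S, P.BoundaryRelation ΩZ N S)) ∧
    -- the boundary space is the direct sum of the sectors
    GI.IsOrthogonalSum (P.bdrySpace K) (P.sector UZ ΩX ΩZ K l) ∧
    -- the sector with trivial label is a pair of copies with `U_k ⊗ U_k = 1`
    P.sector UZ ΩX ΩZ K l (GI.SectorLabel.trivial K nZ mX mZ) ≠ ⊥ ∧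
    P.IsTwoCopies K (P.sector UZ ΩX ΩZ K l (GI.SectorLabel.trivial K nZ mX mZ))
      (P.ficSpace UX) 1 1 1 1 ∧
    -- so is every other sector, up to signs; those of the Ising terms agree in the two copies
    (∀ t, P.sector UZ ΩX ΩZ K l t ≠ ⊥ → ∃ (ε : I → ℤˣ) (η : A → ℤˣ),
      P.IsTwoCopies K (P.sector UZ ΩX ΩZ K l t) (P.ficSpace UX) ε 1 η η) ∧
    -- under the first condition the charges of the two copies are locked in all sectors,
    -- while each copy has both values of the charge in each sector
    (∀ N : Finset (Fin nX), N.Nonempty → ∀ J, P.ChargeRelation UX N J →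
      (∀ ψ ∈ P.bdrySpace K, GI.pauliX (GI.onOdd 0 (∑ k ∈ N, UX k)) ψ =
        GI.pauliX (GI.onOdd (Fin.last (K + 1)) (∑ k ∈ N, UX k)) ψ) ∧
      ∀ t, P.sector UZ ΩX ΩZ K l t ≠ ⊥ → ∀ u : ℤˣ, ∃ ψ ∈ P.sector UZ ΩX ΩZ K l t, ψ ≠ 0 ∧
        GI.pauliX (GI.onOdd 0 (∑ k ∈ N, UX k)) ψ = GI.sgn u • ψ ∧
        GI.pauliX (GI.onOdd (Fin.last (K + 1)) (∑ k ∈ N, UX k)) ψ = GI.sgn u • ψ) ∧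
    -- under the second condition the generalized boundary conditions of the two copies are equal,
    -- they are fixed in each sector, and both values occur among the sectors
    (∀ N : Finset (Fin mZ), N.Nonempty → ∀ S, P.BoundaryRelation ΩZ N S →
      (∀ t, P.sector UZ ΩX ΩZ K l t ≠ ⊥ → ∀ (ε ε' : I → ℤˣ) (η η' : A → ℤˣ),
        P.IsTwoCopies K (P.sector UZ ΩX ΩZ K l t) (P.ficSpace UX) ε ε' η η' →
          ∏ α ∈ S, η α = ∏ k ∈ N, t.dualZ k ∧ ∏ α ∈ S, η' α = ∏ k ∈ N, t.dualZ k) ∧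
      ∀ u : ℤˣ, ∃ t, P.sector UZ ΩX ΩZ K l t ≠ ⊥ ∧ ∏ k ∈ N, t.dualZ k = u) := by
  have hanomalous : P.Anomalous K ↔
      (∃ N : Finset (Fin nX), N.Nonempty ∧ ∃ J, P.ChargeRelation UX N J) ∨
      (∃ N : Finset (Fin mZ), N.Nonempty ∧ ∃ S, P.BoundaryRelation ΩZ N S) := by
    constructor
    · intro h
      by_contra! h'
      exact GI.DualPair.not_anomalous (fun _ => hP.prodOX_mem_span_GX hUX h'.1)
        (fun _ => hP.prodDZ_mem_span_ΓZ hΩZ h'.2) h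
    · rintro (⟨N, hN, J, h⟩ | ⟨N, hN, S, h⟩)
      exacts [h.anomalous hUX hN, h.anomalous hUZ hΩX hΩZ hN]
  have hsum := GI.DualPair.isOrthogonalSum_sector (P := P) (l := l) hUZ hΩX hΩZ
  refine ⟨hanomalous, hsum, GI.DualPair.sector_trivial_ne_bot hUZ hΩX hΩZ,
    GI.DualPair.isTwoCopies_sector_trivial hUZ hUX hΩX hΩZ,
    GI.DualPair.exists_isTwoCopies_sector hUZ hUX hΩX hΩZ,
    fun N hN J h => ⟨fun ψ hψ => h.pauliX_eq hψ, fun t ht u => ?_⟩,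
    fun N hN S h => ⟨fun t ht ε ε' η η' hW => h.prod_eq ht hW,
      GI.DualPair.exists_sector_ne_bot hUZ hΩX hΩZ hN⟩⟩
  obtain ⟨ψ, hψ, hψ₀, hu⟩ := GI.DualPair.exists_mem_sector_pauliX_eq hUZ hUX hΩX hΩZ hN ht u
  exact ⟨ψ, hψ, hψ₀, hu,
    (h.pauliX_eq (hsum.2.le (Submodule.mem_iSup_of_mem t hψ))).symm.trans hu⟩
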